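/- Let $\mu=(\mu_1,\dots,\mu_n)\in\mathbb R^n$ with $\mu_i>-\tfrac12$ for all $i$, write $\mathbb R^n_+=(0,\infty)^n$ and $x^\beta=\prod_i x_i^{\beta_i}$, and put $$C_\mu=\prod_{i}2^{\mu_i}\Gamma(\mu_i+1),\qquad s(x)=\frac{x^{2\mu+1}}{C_\mu},\qquad r(x)=x^{-\mu-1/2}.$$ Let $L^p(\mathbb R^n_+,sr^p)$, $1\le p<\infty$, be the space of (classes of) complex-valued measurable functions with finite norm $\big(\int_{\mathbb R^n_+}|f|^p\,s\,r^p\,dx\big)^{1/p}$, and $L^\infty(\mathbb R^n_+,r)$ the one with norm $\operatorname{ess\,sup}|rf|$. Let $\mathcal H_\mu$ be the Zemanian space of all $\phi\in C^\infty(\mathbb R^n_+)$ such that $\sup_{x\in\mathbb R^n_+}\big|(1+\|x\|^2)^m\,T^k\{x^{-\mu-1/2}\phi(x)\}\big|<\infty$ for all $m\in\mathbb N_0$, $k\in\mathbb N_0^n$, where $T_i=x_i^{-1}\partial/\partial x_i$ and $T^k=T_n^{k_n}\circ\cdots\circ T_1^{k_1}$. The Bessel operator $$S_\mu=\sum_{i=1}^n\Big(\frac{\partial^2}{\partial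 x_i^2}-\frac{4\mu_i^2-1}{4x_i^2}\Big)$$ acts on $\mathcal H_\mu$ and, by transposition $(S_\mu f,\phi)=(f,S_\mu\phi)$, on the dual $\mathcal H'_\mu$; functions in the spaces above act on $\mathcal H_\mu$ by $\phi\mapsto\int_{\mathbb R^n_+} f\phi\,dx$. Let $S_{\mu,p}$ ($1\le p<\infty$) and $S_{\mu,\infty}$ be the parts of $S_\mu$ in $L^p(\mathbb R^n_+,sr^p)$ and in $L^\infty(\mathbb R^n_+,r)$: with $L$ the space in question, the domain is $\{f\in L:\ S_\mu f\in L\}$ and the operator is $f\mapsto S_\mu f$. Then, for each $1\le p\le\infty$, writing $S=S_{\mu,p}$ and $L$ for the corresponding space: 1. $S$ is a closed operator. 2. $-S$ is non-negative, i.e. it is closed, $(-\infty,0)\subset\rho(-S)$, and $\sup_{\lambda>0}\|\lambda(\lambda-S)^{-1}\|<\infty$. 3. For every $\lambda>0$, $\lambda-S$ has an everywhere defined bounded inverse on $L$ with $\|\lambda(\lambda-S)^{-1}\|\le1$. 4. For every $\lambda>0$ and $f\in L$, $(\lambda-S)^{-1}f=N_\lambda\sharp f$ almost everywhere, where $$N_\lambda(x)=2^{-\mu-1}\,x^{\mu+1/2}\,\lambda^{\mu}\,\lambda^{n-1}\int_0^\infty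 e^{-t-\frac{\lambda\|x\|^2}{4t}}\,\frac{dt}{t^{\mu_1+\dots+\mu_n+n}},\qquad 2^{-\mu-1}=\prod_i2^{-\mu_i-1},\quad \lambda^\mu=\prod_i\lambda^{\mu_i},$$ and $\sharp$ is the Hankel convolution $$(f\sharp g)(x)=\int_{\mathbb R^n_+}\int_{\mathbb R^n_+}\prod_{i=1}^nD_{\mu_i}(x_i,y_i,z_i)\,f(y)\,g(z)\,dy\,dz,$$ $$D_\alpha(u,v,w)=\frac{2^{\alpha-1}(uvw)^{-\alpha+1/2}}{\Gamma(\alpha+\frac12)\sqrt\pi}\,A(u,v,w)^{2\alpha-1}\ \text{ if } |u-v|<w<u+v,\qquad D_\alpha(u,v,w)=0\ \text{ otherwise},$$ with $A(u,v,w)=\tfrac14\sqrt{[(u+v)^2-w^2][w^2-(u-v)^2]}$ the area of the triangle with sides $u,v,w$. The double integral defining $(N_\lambda\sharp f)(x)$ converges absolutely for almost every $x$. -/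

import Mathlib

open MeasureTheory Set
open scoped ENNReal ContDiff

noncomputable section

namespace BesselOp

/-! ### Weights and weighted Lebesgue spaces on the open orthant -/

/-- The open orthant `(0,∞)ⁿ`. -/
def orthant (n : ℕ) : Set (Fin n → ℝ) := {x | ∀ i, 0 < x i}

/-- Lebesgue measure on the open orthant. -/
abbrev vol (n : ℕ) : Measure (Fin n → ℝ) := (volume : Measure (Fin n → ℝ)).restrict (orthant n)

/-- `‖x‖² = x₁² + … + xₙ²`. -/
def normSq {n : ℕ} (x : Fin n → ℝ) : ℝ := ∑ i, x i ^ 2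

/-- `C_μ = 2^μ Γ(μ₁+1) ⋯ Γ(μₙ+1)`, where `2^μ = 2^{μ₁} ⋯ 2^{μₙ}`. -/
def constC {n : ℕ} (μ : Fin n → ℝ) : ℝ := ∏ i, ((2 : ℝ) ^ μ i * Real.Gamma (μ i + 1))

/-- `s(x) = x^{2μ+1} / C_μ`. -/
def weightS {n : ℕ} (μ : Fin n → ℝ) (x : Fin n → ℝ) : ℝ :=
  (∏ i, x i ^ (2 * μ i + 1)) / constC μ

/-- `r(x) = x^{-μ-1/2}`. -/
def weightR {n : ℕ} (μ : Fin n → ℝ) (x : Fin n → ℝ) : ℝ := ∏ i, x i ^ (-μ i - 1 / 2)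

/-- The norm, with values in `[0,∞]`, of `L^p((0,∞)ⁿ, s r^p)` for `p < ⊤` and of
`L^∞((0,∞)ⁿ, r)` for `p = ∞`. -/
def wnorm {n : ℕ} (μ : Fin n → ℝ) (p : ℝ≥0∞) (f : (Fin n → ℝ) → ℂ) : ℝ≥0∞ :=
  if p = ⊤ then essSup (fun x => ENNReal.ofReal (weightR μ x) * ‖f x‖ₑ) (vol n)
  else (∫⁻ x in orthant n,
    ‖f x‖ₑ ^ p.toReal * ENNReal.ofReal (weightS μ x * weightR μ x ^ p.toReal)) ^ (1 / p.toReal)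

lemma isOpen_orthant (n : ℕ) : IsOpen (orthant n) := by
  have : orthant n = ⋂ i, {x : Fin n → ℝ | 0 < x i} := by
    ext x; simp [orthant]
  rw [this]
  exact isOpen_iInter_of_finite fun i => isOpen_lt continuous_const (continuous_apply i)

lemma constC_pos {n : ℕ} {μ : Fin n → ℝ} (hμ : ∀ i, -(1 / 2) < μ i) : 0 < constC μ := by
  refine Finset.prod_pos fun i _ => mul_pos (by positivity) (Real.Gamma_pos_of_pos ?_)
  linarith [hμ i]

lemma weightS_pos {n : ℕ} {μ : Fin n → ℝ} (hμ : ∀ i, -(1 / 2) < μ i) {x : Fin n → ℝ}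
    (hx : x ∈ orthant n) : 0 < weightS μ x :=
  div_pos (Finset.prod_pos fun i _ => Real.rpow_pos_of_pos (hx i) _) (constC_pos hμ)

lemma weightR_pos {n : ℕ} (μ : Fin n → ℝ) {x : Fin n → ℝ}
    (hx : x ∈ orthant n) : 0 < weightR μ x :=
  Finset.prod_pos fun i _ => Real.rpow_pos_of_pos (hx i) _

lemma measurable_weightS {n : ℕ} (μ : Fin n → ℝ) : Measurable (weightS μ) := by
  unfold weightS
  exact (Finset.measurable_prod _ fun i _ => (measurable_pi_apply i).pow_const _).div_const _

lemma measurable_weightR {n : ℕ} (μ : Fin n → ℝ) : Measurable (weightR μ) := by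
  unfold weightR
  exact Finset.measurable_prod _ fun i _ => (measurable_pi_apply i).pow_const _

/-- The measure `s(x) dx` on the orthant. -/
def sMeasure {n : ℕ} (μ : Fin n → ℝ) : Measure (Fin n → ℝ) :=
  (vol n).withDensity fun x => ENNReal.ofReal (weightS μ x)

lemma sMeasure_ac {n : ℕ} (μ : Fin n → ℝ) : sMeasure μ ≪ vol n :=
  withDensity_absolutelyContinuous _ _

lemma ac_sMeasure {n : ℕ} {μ : Fin n → ℝ} (hμ : ∀ i, -(1 / 2) < μ i) : vol n ≪ sMeasure μ := by
  refine withDensity_absolutelyContinuous' (measurable_weightS μ).ennreal_ofReal.aemeasurable ?_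
  filter_upwards [ae_restrict_mem (isOpen_orthant n).measurableSet] with x hx
  simpa using weightS_pos hμ hx

/-- Multiplication by `r` is isometric into `L^p(s dx)`. -/
lemma wnorm_eq_eLpNorm {n : ℕ} {μ : Fin n → ℝ} (hμ : ∀ i, -(1 / 2) < μ i) {p : ℝ≥0∞}
    (hp : 1 ≤ p) {f : (Fin n → ℝ) → ℂ} (hf : AEStronglyMeasurable f (vol n)) :
    wnorm μ p f = eLpNorm (fun x => (weightR μ x : ℂ) * f x) p (sMeasure μ) := by
  have hen : ∀ x ∈ orthant n,
      ‖(weightR μ x : ℂ) * f x‖ₑ = ENNReal.ofReal (weightR μ x) * ‖f x‖ₑ := by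
    intro x hx
    rw [enorm_mul]
    congr 1
    rw [← ofReal_norm, Complex.norm_real, Real.norm_of_nonneg (weightR_pos μ hx).le]
  unfold wnorm
  split_ifs with h
  · subst h
    rw [eLpNorm_exponent_top, eLpNormEssSup]
    have h1 : essSup (fun x => ‖(weightR μ x : ℂ) * f x‖ₑ) (sMeasure μ)
        = essSup (fun x => ‖(weightR μ x : ℂ) * f x‖ₑ) (vol n) :=
      le_antisymm (essSup_mono_measure (sMeasure_ac μ)) (essSup_mono_measure (ac_sMeasure hμ))
    rw [h1]
    refine essSup_congr_ae ?_
    filter_upwards [ae_restrict_mem (isOpen_orthant n).measurableSet] with x hx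
    exact (hen x hx).symm
  · have hp0 : p ≠ 0 := (lt_of_lt_of_le one_pos hp).ne'
    rw [eLpNorm_eq_lintegral_rpow_enorm_toReal hp0 h, sMeasure,
      lintegral_withDensity_eq_lintegral_mul₀ (measurable_weightS μ).ennreal_ofReal.aemeasurable]
    · congr 1
      refine setLIntegral_congr_fun (isOpen_orthant n).measurableSet fun x hx => ?_
      have hr := weightR_pos μ hx
      simp only [Pi.mul_apply, hen x hx]
      rw [ENNReal.mul_rpow_of_nonneg _ _ ENNReal.toReal_nonneg,
        ENNReal.ofReal_rpow_of_pos hr, ENNReal.ofReal_mul (weightS_pos hμ hx).le]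
      ring
    · exact (((Complex.measurable_ofReal.comp (measurable_weightR μ)).aemeasurable.mul
        hf.aemeasurable).enorm).pow_const _

lemma wnorm_congr {n : ℕ} (μ : Fin n → ℝ) (p : ℝ≥0∞) {f g : (Fin n → ℝ) → ℂ}
    (h : f =ᵐ[vol n] g) : wnorm μ p f = wnorm μ p g := by
  unfold wnorm
  split_ifs
  · refine essSup_congr_ae ?_
    filter_upwards [h] with x hx
    rw [hx]
  · congr 1
    refine lintegral_congr_ae ?_
    filter_upwards [h] with x hx
    rw [hx]

lemma aesm_mul_weightR {n : ℕ} (μ : Fin n → ℝ) (f : (Fin n → ℝ) →ₘ[vol n] ℂ) :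
    AEStronglyMeasurable (fun x => (weightR μ x : ℂ) * f x) (sMeasure μ) :=
  ((Complex.measurable_ofReal.comp (measurable_weightR μ)).aestronglyMeasurable.mul
    f.aestronglyMeasurable).mono_ac (sMeasure_ac μ)

lemma wnorm_add_le {n : ℕ} {μ : Fin n → ℝ} (hμ : ∀ i, -(1 / 2) < μ i) {p : ℝ≥0∞}
    (hp : 1 ≤ p) (f g : (Fin n → ℝ) →ₘ[vol n] ℂ) :
    wnorm μ p (f + g : (Fin n → ℝ) →ₘ[vol n] ℂ) ≤ wnorm μ p f + wnorm μ p g := by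
  rw [wnorm_congr μ p (AEEqFun.coeFn_add f g),
    wnorm_eq_eLpNorm hμ hp (f.aestronglyMeasurable.add g.aestronglyMeasurable),
    wnorm_eq_eLpNorm hμ hp f.aestronglyMeasurable, wnorm_eq_eLpNorm hμ hp g.aestronglyMeasurable]
  refine le_trans (le_of_eq ?_) (eLpNorm_add_le (aesm_mul_weightR μ f) (aesm_mul_weightR μ g) hp)
  congr 1
  ext x
  simp [mul_add]

lemma wnorm_smul {n : ℕ} {μ : Fin n → ℝ} (hμ : ∀ i, -(1 / 2) < μ i) {p : ℝ≥0∞}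
    (hp : 1 ≤ p) (c : ℂ) (f : (Fin n → ℝ) →ₘ[vol n] ℂ) :
    wnorm μ p (c • f : (Fin n → ℝ) →ₘ[vol n] ℂ) = ‖c‖ₑ * wnorm μ p f := by
  rw [wnorm_congr μ p (AEEqFun.coeFn_smul c f),
    wnorm_eq_eLpNorm hμ hp (f.aestronglyMeasurable.const_smul c),
    wnorm_eq_eLpNorm hμ hp f.aestronglyMeasurable, ← eLpNorm_const_smul]
  congr 1
  ext x
  simp only [Pi.smul_apply, smul_eq_mul]
  ring

lemma wnorm_zero {n : ℕ} {μ : Fin n → ℝ} (hμ : ∀ i, -(1 / 2) < μ i) {p : ℝ≥0∞}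
    (hp : 1 ≤ p) : wnorm μ p (0 : (Fin n → ℝ) →ₘ[vol n] ℂ) = 0 := by
  rw [wnorm_congr μ p AEEqFun.coeFn_zero, wnorm_eq_eLpNorm hμ hp aestronglyMeasurable_zero]
  simp

lemma eq_zero_of_wnorm {n : ℕ} {μ : Fin n → ℝ} (hμ : ∀ i, -(1 / 2) < μ i) {p : ℝ≥0∞}
    (hp : 1 ≤ p) {f : (Fin n → ℝ) →ₘ[vol n] ℂ} (h : wnorm μ p f = 0) : f = 0 := by
  rw [wnorm_eq_eLpNorm hμ hp f.aestronglyMeasurable,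
    eLpNorm_eq_zero_iff (aesm_mul_weightR μ f) (lt_of_lt_of_le one_pos hp).ne'] at h
  refine AEEqFun.ext ?_
  filter_upwards [(ac_sMeasure hμ).ae_le h, AEEqFun.coeFn_zero (α := Fin n → ℝ) (β := ℂ)
    (μ := vol n), ae_restrict_mem (isOpen_orthant n).measurableSet] with x hx h0 hxo
  rw [h0]
  have := (weightR_pos μ hxo).ne'
  simpa [this] using hx

/-- The classes (modulo equality almost everywhere) of measurable functions on the orthant with
finite weighted norm. -/
def weightedLpSubmodule {n : ℕ} {μ : Fin n → ℝ} (hμ : ∀ i, -(1 / 2) < μ i) (p : ℝ≥0∞)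
    (hp : 1 ≤ p) : Submodule ℂ ((Fin n → ℝ) →ₘ[vol n] ℂ) where
  carrier := {f | wnorm μ p f < ⊤}
  add_mem' {f g} hf hg :=
    lt_of_le_of_lt (wnorm_add_le hμ hp f g) (ENNReal.add_lt_top.2 ⟨hf, hg⟩)
  zero_mem' := by simp [wnorm_zero hμ hp]
  smul_mem' c f hf := by
    have hf' : wnorm μ p f < ⊤ := hf
    simpa only [mem_ofPred_eq, wnorm_smul hμ hp] using ENNReal.mul_lt_top enorm_lt_top hf'

/-- The space `L^p((0,∞)ⁿ, s r^p)` (`1 ≤ p < ⊤`), respectively `L^∞((0,∞)ⁿ, r)` (`p = ∞`). -/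
def WeightedLp {n : ℕ} {μ : Fin n → ℝ} (hμ : ∀ i, -(1 / 2) < μ i) (p : ℝ≥0∞)
    [hp : Fact (1 ≤ p)] : Type :=
  weightedLpSubmodule hμ p hp.out

namespace WeightedLp

variable {n : ℕ} {μ : Fin n → ℝ} {hμ : ∀ i, -(1 / 2) < μ i} {p : ℝ≥0∞} [hp : Fact (1 ≤ p)]

instance : AddCommGroup (WeightedLp hμ p) :=
  inferInstanceAs (AddCommGroup (weightedLpSubmodule hμ p hp.out))

instance : Module ℂ (WeightedLp hμ p) :=
  inferInstanceAs (Module ℂ (weightedLpSubmodule hμ p hp.out))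

/-- The almost-everywhere class underlying an element of the space. -/
def toAEEqFun (f : WeightedLp hμ p) : (Fin n → ℝ) →ₘ[vol n] ℂ :=
  (show weightedLpSubmodule hμ p hp.out from f).1

instance : CoeFun (WeightedLp hμ p) fun _ => (Fin n → ℝ) → ℂ := ⟨fun f => f.toAEEqFun⟩

lemma toAEEqFun_injective :
    Function.Injective (toAEEqFun : WeightedLp hμ p → ((Fin n → ℝ) →ₘ[vol n] ℂ)) :=
  Subtype.val_injective

lemma toAEEqFun_zero : (0 : WeightedLp hμ p).toAEEqFun = 0 := rfl

lemma toAEEqFun_add (f g : WeightedLp hμ p) :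
    (f + g).toAEEqFun = f.toAEEqFun + g.toAEEqFun := rfl

lemma toAEEqFun_smul (c : ℂ) (f : WeightedLp hμ p) :
    (c • f).toAEEqFun = c • f.toAEEqFun := rfl

lemma wnorm_lt_top (f : WeightedLp hμ p) : wnorm μ p f < ⊤ :=
  (show weightedLpSubmodule hμ p hp.out from f).2

instance : NormedAddCommGroup (WeightedLp hμ p) :=
  AddGroupNorm.toNormedAddCommGroup
    { toFun := fun f => (wnorm μ p f).toReal
      map_zero' := by
        rw [toAEEqFun_zero, wnorm_zero hμ hp.out]; rfl
      add_le' := fun f g => by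
        rw [← ENNReal.toReal_add f.wnorm_lt_top.ne g.wnorm_lt_top.ne]
        refine ENNReal.toReal_mono
          (ENNReal.add_lt_top.2 ⟨f.wnorm_lt_top, g.wnorm_lt_top⟩).ne ?_
        rw [toAEEqFun_add]
        exact wnorm_add_le hμ hp.out _ _
      neg' := fun f => by
        have h : (-f).toAEEqFun = (-1 : ℂ) • f.toAEEqFun := by
          rw [← toAEEqFun_smul, neg_one_smul]
        rw [h, wnorm_smul hμ hp.out]
        simp
      eq_zero_of_map_eq_zero' := fun f h => by
        rcases (ENNReal.toReal_eq_zero_iff _).1 h with h | h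
        · exact toAEEqFun_injective (eq_zero_of_wnorm hμ hp.out h)
        · exact absurd h f.wnorm_lt_top.ne }

lemma norm_def (f : WeightedLp hμ p) : ‖f‖ = (wnorm μ p f).toReal := rfl

instance : NormedSpace ℂ (WeightedLp hμ p) where
  norm_smul_le c f := by
    rw [norm_def, toAEEqFun_smul, wnorm_smul hμ hp.out, ENNReal.toReal_mul, norm_def]
    simp

end WeightedLp

/-! ### The Zemanian space and the Bessel operator on its dual -/

/-- The partial derivative `∂f/∂xᵢ`. -/
def pderiv {n : ℕ} (i : Fin n) (f : (Fin n → ℝ) → ℂ) (x : Fin n → ℝ) : ℂ :=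
  fderiv ℝ f x (Pi.single i 1)

/-- `Tᵢ = xᵢ⁻¹ ∂/∂xᵢ`. -/
def opT {n : ℕ} (i : Fin n) (f : (Fin n → ℝ) → ℂ) (x : Fin n → ℝ) : ℂ :=
  ((x i)⁻¹ : ℝ) • pderiv i f x

/-- `T^k = Tₙ^{kₙ} ∘ ⋯ ∘ T₁^{k₁}`. -/
def opTpow {n : ℕ} (k : Fin n → ℕ) (f : (Fin n → ℝ) → ℂ) : (Fin n → ℝ) → ℂ :=
  (List.finRange n).foldl (fun g i => (opT i)^[k i] g) f

/-- Membership in the Zemanian space `H_μ`: smooth functions on the open orthant for which all the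
numbers `sup_x |(1+‖x‖²)^m T^k {x^{-μ-1/2} φ(x)}|` are finite. Only the restriction of `φ` to the
orthant matters. -/
structure IsZemanian {n : ℕ} (μ : Fin n → ℝ) (φ : (Fin n → ℝ) → ℂ) : Prop where
  smooth : ContDiffOn ℝ ∞ φ (orthant n)
  bounded : ∀ (m : ℕ) (k : Fin n → ℕ), ∃ C : ℝ, ∀ x ∈ orthant n,
    ‖((1 + normSq x) ^ m : ℝ) • opTpow k (fun y => weightR μ y • φ y) x‖ ≤ C

/-- The Bessel operator `S_μ = ∑ᵢ (∂²/∂xᵢ² - (4μᵢ²-1)/(4xᵢ²))` on smooth functions. -/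
def besselS {n : ℕ} (μ : Fin n → ℝ) (φ : (Fin n → ℝ) → ℂ) (x : Fin n → ℝ) : ℂ :=
  ∑ i, (pderiv i (pderiv i φ) x - ((4 * μ i ^ 2 - 1) / (4 * x i ^ 2) : ℝ) • φ x)

/-- `S_μ f = g` in the dual `H'_μ` of the Zemanian space, for functions `f, g` acting on `H_μ` by
integration: `(S_μ f, φ) = (f, S_μ φ) = (g, φ)` for all `φ ∈ H_μ`. The integrability clauses say
that the pairings make sense; they hold for all `f, g` in the weighted Lebesgue spaces, as these
consist of regular elements of `H'_μ` and `S_μ` maps `H_μ` into itself. -/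
def IsBesselImage {n : ℕ} (μ : Fin n → ℝ) (f g : (Fin n → ℝ) → ℂ) : Prop :=
  ∀ φ, IsZemanian μ φ →
    IntegrableOn (fun x => f x * besselS μ φ x) (orthant n) ∧
    IntegrableOn (fun x => g x * φ x) (orthant n) ∧
    ∫ x in orthant n, f x * besselS μ φ x = ∫ x in orthant n, g x * φ x

lemma IsBesselImage.congr {n : ℕ} {μ : Fin n → ℝ} {f f' g g' : (Fin n → ℝ) → ℂ}
    (h : IsBesselImage μ f g) (hf : f =ᵐ[vol n] f') (hg : g =ᵐ[vol n] g') :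
    IsBesselImage μ f' g' := by
  intro φ hφ
  obtain ⟨h1, h2, h3⟩ := h φ hφ
  have e1 : (fun x => f x * besselS μ φ x) =ᵐ[vol n] fun x => f' x * besselS μ φ x := by
    filter_upwards [hf] with x hx
    rw [hx]
  have e2 : (fun x => g x * φ x) =ᵐ[vol n] fun x => g' x * φ x := by
    filter_upwards [hg] with x hx
    rw [hx]
  exact ⟨h1.congr e1, h2.congr e2, by rw [← integral_congr_ae e1, h3, integral_congr_ae e2]⟩

lemma IsBesselImage.add {n : ℕ} {μ : Fin n → ℝ} {f f' g g' : (Fin n → ℝ) → ℂ}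
    (h : IsBesselImage μ f g) (h' : IsBesselImage μ f' g') :
    IsBesselImage μ (f + f') (g + g') := by
  intro φ hφ
  obtain ⟨h1, h2, h3⟩ := h φ hφ
  obtain ⟨h1', h2', h3'⟩ := h' φ hφ
  simp only [Pi.add_apply, add_mul]
  exact ⟨h1.add h1', h2.add h2', by rw [integral_add h1 h1', integral_add h2 h2', h3, h3']⟩

lemma IsBesselImage.smul {n : ℕ} {μ : Fin n → ℝ} {f g : (Fin n → ℝ) → ℂ}
    (h : IsBesselImage μ f g) (c : ℂ) : IsBesselImage μ (c • f) (c • g) := by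
  intro φ hφ
  obtain ⟨h1, h2, h3⟩ := h φ hφ
  simp only [Pi.smul_apply, smul_eq_mul, mul_assoc]
  exact ⟨h1.const_mul c, h2.const_mul c, by
    rw [integral_const_mul, integral_const_mul, h3]⟩

/-- Smooth functions with compact support inside the open orthant. -/
structure IsTest {n : ℕ} (f : (Fin n → ℝ) → ℂ) : Prop where
  smooth : ContDiff ℝ ∞ f
  compact : HasCompactSupport f
  supp : tsupport f ⊆ orthant n

lemma IsTest.mul_left {n : ℕ} {f : (Fin n → ℝ) → ℂ} (hf : IsTest f) {h : (Fin n → ℝ) → ℝ}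
    (hh : ∀ x ∈ orthant n, ContDiffAt ℝ ∞ h x) : IsTest fun x => h x • f x := by
  have hsub : tsupport (fun x => h x • f x) ⊆ tsupport f :=
    closure_mono fun x hx => by
      simp only [Function.mem_support] at hx ⊢
      exact fun h0 => hx (by simp [h0])
  refine ⟨contDiff_iff_contDiffAt.2 fun x => ?_,
    hf.compact.of_isClosed_subset (isClosed_tsupport _) hsub, hsub.trans hf.supp⟩
  by_cases hx : x ∈ tsupport f
  · exact (hh x (hf.supp hx)).smul hf.smooth.contDiffAt
  · have h0 : (fun x => h x • f x) =ᶠ[nhds x] fun _ => 0 := by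
      filter_upwards [notMem_tsupport_iff_eventuallyEq.1 hx] with y hy
      simp [hy]
    exact contDiffAt_const.congr_of_eventuallyEq h0

lemma IsTest.pderiv {n : ℕ} {f : (Fin n → ℝ) → ℂ} (hf : IsTest f) (i : Fin n) :
    IsTest (pderiv i f) := by
  have hsub : tsupport (BesselOp.pderiv i f) ⊆ tsupport f := by
    refine subset_trans (closure_mono fun x hx => ?_) (tsupport_fderiv_subset ℝ (f := f))
    simp only [Function.mem_support, BesselOp.pderiv] at hx ⊢
    exact fun h0 => hx (by simp [h0])
  refine ⟨?_, hf.compact.of_isClosed_subset (isClosed_tsupport _) hsub, hsub.trans hf.supp⟩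
  exact (hf.smooth.fderiv_right (m := ∞) (by simp)).clm_apply contDiff_const

lemma IsTest.opT {n : ℕ} {f : (Fin n → ℝ) → ℂ} (hf : IsTest f) (i : Fin n) :
    IsTest (opT i f) :=
  (hf.pderiv i).mul_left (h := fun x => (x i)⁻¹) fun x hx =>
    (contDiff_apply ℝ ℝ i).contDiffAt.inv (hx i).ne'

lemma IsTest.opTpow {n : ℕ} {f : (Fin n → ℝ) → ℂ} (hf : IsTest f) (k : Fin n → ℕ) :
    IsTest (opTpow k f) := by
  have hit : ∀ (i : Fin n) (m : ℕ) (g : (Fin n → ℝ) → ℂ), IsTest g →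
      IsTest ((BesselOp.opT i)^[m] g) := by
    intro i m
    induction m with
    | zero => exact fun g hg => hg
    | succ m ih => exact fun g hg => ih _ (hg.opT i)
  unfold BesselOp.opTpow
  generalize List.finRange n = l
  induction l generalizing f with
  | nil => exact hf
  | cons a l ih => exact ih (hit a _ f hf)

lemma contDiffAt_weightR {n : ℕ} (μ : Fin n → ℝ) {x : Fin n → ℝ} (hx : x ∈ orthant n) :
    ContDiffAt ℝ ∞ (weightR μ) x := by
  unfold weightR
  exact contDiffAt_prod fun i _ =>
    (contDiff_apply ℝ ℝ i).contDiffAt.rpow_const_of_ne (hx i).ne'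

/-- Test functions belong to the Zemanian space. -/
lemma IsTest.isZemanian {n : ℕ} {f : (Fin n → ℝ) → ℂ} (hf : IsTest f) (μ : Fin n → ℝ) :
    IsZemanian μ f := by
  refine ⟨hf.smooth.contDiffOn, fun m k => ?_⟩
  have h1 : IsTest fun x => weightR μ x • f x :=
    hf.mul_left fun x hx => contDiffAt_weightR μ hx
  have h2 : IsTest fun x => ((1 + normSq x) ^ m : ℝ) •
      BesselOp.opTpow k (fun y => weightR μ y • f y) x := by
    refine (h1.opTpow k).mul_left (h := fun x => (1 + normSq x) ^ m) fun _ _ => ?_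
    refine ContDiff.contDiffAt (ContDiff.pow (contDiff_const.add ?_) m)
    exact ContDiff.sum fun i _ => (contDiff_apply ℝ ℝ i).pow 2
  obtain ⟨C, hC⟩ := h2.compact.exists_bound_of_continuous h2.smooth.continuous
  exact ⟨C, fun x _ => hC x⟩

lemma isTest_ofReal {n : ℕ} {g : (Fin n → ℝ) → ℝ} (h1 : ContDiff ℝ ∞ g)
    (h2 : HasCompactSupport g) (h3 : tsupport g ⊆ orthant n) : IsTest fun x => (g x : ℂ) := by
  have hsub : tsupport (fun x => (g x : ℂ)) ⊆ tsupport g :=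
    closure_mono fun x hx => by simpa using hx
  exact ⟨Complex.ofRealCLM.contDiff.comp h1,
    h2.of_isClosed_subset (isClosed_tsupport _) hsub, hsub.trans h3⟩

/-- The image `S_μ f` is determined almost everywhere by `f`. -/
lemma IsBesselImage.unique {n : ℕ} {μ : Fin n → ℝ} {f g g' : (Fin n → ℝ) → ℂ}
    (h : IsBesselImage μ f g) (h' : IsBesselImage μ f g') : g =ᵐ[vol n] g' := by
  have hint : ∀ φ : (Fin n → ℝ) → ℂ, IsTest φ →
      IntegrableOn (fun x => (g x - g' x) * φ x) (orthant n) ∧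
      ∫ x in orthant n, (g x - g' x) * φ x = 0 := by
    intro φ hφ
    obtain ⟨-, h2, h3⟩ := h φ (hφ.isZemanian μ)
    obtain ⟨-, h2', h3'⟩ := h' φ (hφ.isZemanian μ)
    simp only [sub_mul]
    exact ⟨h2.sub h2', by rw [integral_sub h2 h2', ← h3, ← h3', sub_self]⟩
  have hloc : LocallyIntegrableOn (fun x => g x - g' x) (orthant n) volume := by
    intro x hx
    obtain ⟨φ, hs, hc, hd, -, h1⟩ :=
      exists_contDiff_tsupport_subset (n := ⊤) ((isOpen_orthant n).mem_nhds hx)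
    have hφ := isTest_ofReal hd hc hs
    have hi := (hint _ hφ).1
    have hne : {y | φ y ≠ 0} ∩ orthant n ∈ nhds x :=
      Filter.inter_mem (hd.continuous.continuousAt.eventually_ne (by rw [h1]; exact one_ne_zero))
        ((isOpen_orthant n).mem_nhds hx)
    obtain ⟨K, hK, hKs, hKc⟩ := local_compact_nhds hne
    refine ⟨K, mem_nhdsWithin_of_mem_nhds hK, ?_⟩
    have hi' : IntegrableOn (fun x => (g x - g' x) * (φ x : ℂ)) K :=
      hi.mono_set fun y hy => (hKs hy).2
    have hcont : ContinuousOn (fun y => ((φ y : ℂ))⁻¹) K :=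
      (Complex.continuous_ofReal.comp hd.continuous).continuousOn.inv₀ fun y hy => by
        simpa using (hKs hy).1
    refine (hi'.mul_continuousOn hcont hKc).congr_fun (fun y hy => ?_) hKc.measurableSet
    have : (φ y : ℂ) ≠ 0 := by simpa using (hKs hy).1
    simp only [mul_assoc, mul_inv_cancel₀ this, mul_one]
  have hae := (isOpen_orthant n).ae_eq_zero_of_integral_contDiff_smul_eq_zero hloc
    fun φ hd hc hs => by
      have h0 := (hint _ (isTest_ofReal hd hc hs)).2
      rw [setIntegral_eq_integral_of_forall_compl_eq_zero] at h0
      · rw [← h0]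
        refine integral_congr_ae (Filter.Eventually.of_forall fun x => ?_)
        simp only [Complex.real_smul, mul_comm]
      · intro x hx
        have : φ x = 0 := by
          by_contra hne
          exact hx (hs (subset_tsupport _ hne))
        simp [this]
  rw [Filter.EventuallyEq, ae_restrict_iff' (isOpen_orthant n).measurableSet]
  filter_upwards [hae] with x hx hxo
  exact sub_eq_zero.1 (hx hxo)

section Part

variable {n : ℕ} {μ : Fin n → ℝ} (hμ : ∀ i, -(1 / 2) < μ i) (p : ℝ≥0∞) [hp : Fact (1 ≤ p)]

/-- `{f ∈ L : S_μ f ∈ L}`, where `L` is `L^p(s r^p)` or `L^∞(r)`. -/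
def partDomain : Submodule ℂ (WeightedLp hμ p) where
  carrier := {f | ∃ g : WeightedLp hμ p, IsBesselImage μ f g}
  add_mem' := by
    rintro f f' ⟨g, hg⟩ ⟨g', hg'⟩
    exact ⟨g + g', (hg.add hg').congr (AEEqFun.coeFn_add _ _).symm (AEEqFun.coeFn_add _ _).symm⟩
  zero_mem' := by
    refine ⟨0, IsBesselImage.congr (f := 0) (g := 0) ?_ (AEEqFun.coeFn_zero).symm
      (AEEqFun.coeFn_zero).symm⟩
    intro φ _
    simp [IntegrableOn]
  smul_mem' := by
    rintro c f ⟨g, hg⟩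
    exact ⟨c • g, (hg.smul c).congr (AEEqFun.coeFn_smul _ _).symm (AEEqFun.coeFn_smul _ _).symm⟩

/-- The element `S_μ f` of `L`, for `f` in the domain. -/
def partFun (f : partDomain hμ p) : WeightedLp hμ p := f.2.choose

lemma partFun_spec (f : partDomain hμ p) : IsBesselImage μ f.1 (partFun hμ p f) :=
  f.2.choose_spec

lemma partFun_eq {f : partDomain hμ p} {g : WeightedLp hμ p} (h : IsBesselImage μ f.1 g) :
    partFun hμ p f = g :=
  WeightedLp.toAEEqFun_injective (AEEqFun.ext ((partFun_spec hμ p f).unique h))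

/-- The part of `S_μ` in `L^p(s r^p)` (`1 ≤ p < ⊤`), respectively in `L^∞(r)` (`p = ∞`), as an
unbounded operator. -/
def besselPart : WeightedLp hμ p →ₗ.[ℂ] WeightedLp hμ p where
  domain := partDomain hμ p
  toFun :=
    { toFun := partFun hμ p
      map_add' := fun f f' => partFun_eq hμ p
        (((partFun_spec hμ p f).add (partFun_spec hμ p f')).congr
          (AEEqFun.coeFn_add _ _).symm (AEEqFun.coeFn_add _ _).symm)
      map_smul' := fun c f => partFun_eq hμ p
        (((partFun_spec hμ p f).smul c).congr
          (AEEqFun.coeFn_smul _ _).symm (AEEqFun.coeFn_smul _ _).symm) }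

end Part

/-! ### Resolvents and non-negative operators -/

section Operators

variable {X : Type*} [NormedAddCommGroup X] [NormedSpace ℂ X]

/-- The operator `z + A` with the domain of `A`. -/
def shift (z : ℂ) (A : X →ₗ.[ℂ] X) : X →ₗ.[ℂ] X := (z • (LinearMap.id : X →ₗ[ℂ] X)) +ᵥ A

/-- `R` is the everywhere defined bounded inverse `B⁻¹` of the unbounded operator `B`. -/
def IsBoundedInverse (B : X →ₗ.[ℂ] X) (R : X →L[ℂ] X) : Prop :=
  (∀ x : X, ∃ h : R x ∈ B.domain, B ⟨R x, h⟩ = x) ∧ ∀ x : B.domain, R (B x) = x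

/-- The resolvent set of `A`. -/
def resolventSet (A : X →ₗ.[ℂ] X) : Set ℂ :=
  {z | ∃ R : X →L[ℂ] X, IsBoundedInverse (shift z (-A)) R}

/-- Non-negative operators: closed, with `(-∞,0) ⊆ ρ(A)` and `sup_{t>0} ‖t (t + A)⁻¹‖ < ∞`. -/
structure IsNonnegative (A : X →ₗ.[ℂ] X) : Prop where
  closed : A.IsClosed
  neg_mem_resolventSet : ∀ t : ℝ, t < 0 → (t : ℂ) ∈ resolventSet A
  bounded : ∃ M : ℝ, ∀ t : ℝ, 0 < t → ∀ R : X →L[ℂ] X,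
    IsBoundedInverse (shift (t : ℂ) A) R → ‖(t : ℂ) • R‖ ≤ M

end Operators

/-! ### Hankel convolution and the resolvent kernel -/

/-- The area of the triangle with sides `u, v, w`. -/
def triangleArea (u v w : ℝ) : ℝ :=
  1 / 4 * √(((u + v) ^ 2 - w ^ 2) * (w ^ 2 - (u - v) ^ 2))

open Classical in
/-- The one-dimensional Delsarte kernel; it vanishes when `u, v, w` are not the sides of a
non-degenerate triangle. -/
def delsarte (α u v w : ℝ) : ℝ :=
  if |u - v| < w ∧ w < u + v then
    2 ^ (α - 1) * (u * v * w) ^ (-α + 1 / 2) / (Real.Gamma (α + 1 / 2) * √Real.pi)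
      * triangleArea u v w ^ (2 * α - 1)
  else 0

/-- The `n`-dimensional Delsarte kernel. -/
def kernelD {n : ℕ} (μ x y z : Fin n → ℝ) : ℝ := ∏ i, delsarte (μ i) (x i) (y i) (z i)

/-- The integrand of the Hankel convolution `f ♯ g` at `x`, as a function of `(y, z)`. -/
def convIntegrand {n : ℕ} (μ : Fin n → ℝ) (f g : (Fin n → ℝ) → ℂ) (x : Fin n → ℝ)
    (w : (Fin n → ℝ) × (Fin n → ℝ)) : ℂ :=
  (kernelD μ x w.1 w.2 : ℂ) * f w.1 * g w.2

/-- The Hankel convolution `(f ♯ g)(x) = ∫∫ D_μ(x,y,z) f(y) g(z) dy dz`. -/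
def hankelConv {n : ℕ} (μ : Fin n → ℝ) (f g : (Fin n → ℝ) → ℂ) (x : Fin n → ℝ) : ℂ :=
  ∫ w, convIntegrand μ f g x w ∂((vol n).prod (vol n))

/-- `𝒩_ν(w) = ∫₀^∞ e^{-t - w²/(4t)} t^{-ν-1} dt`. -/
def calN (ν w : ℝ) : ℝ := ∫ t in Ioi (0 : ℝ), Real.exp (-t - w ^ 2 / (4 * t)) / t ^ (ν + 1)

/-- `N_λ(x) = 2^{-μ-1} x^{μ+1/2} λ^μ λ^{n-1} 𝒩_{μ₁+⋯+μₙ+n-1}(‖√λ x‖)` (with `l` for `λ`), where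
`2^{-μ-1} = ∏ᵢ 2^{-μᵢ-1}` and `λ^μ = ∏ᵢ λ^{μᵢ}`. -/
def kernelN {n : ℕ} (μ : Fin n → ℝ) (l : ℝ) (x : Fin n → ℝ) : ℝ :=
  (∏ i, (2 : ℝ) ^ (-μ i - 1)) * (∏ i, x i ^ (μ i + 1 / 2)) * (∏ i, l ^ μ i) * l ^ ((n : ℝ) - 1)
    * calN (∑ i, μ i + n - 1) (√(normSq fun i => √l * x i))

end BesselOp

end

open BesselOp

open MeasureTheory Set
open scoped ENNReal NNReal ContDiff

/-! Write w = 1/r = x^{μ+1/2} and let G_σ be the Gaussian `gam μ σ`, with one time σ_i for each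
coordinate; below, σ+τ means that the scalar τ is added to every σ_i. The proof runs on the heat
flow of S and needs no Hankel transform. The substitution t = λτ turns N_λ into the Laplace
transform ∫ e^{-λτ} G_{(τ,…,τ)} dτ (`kernelN_eq`). Contraction. The Delsarte kernel is the
half-plane measure q^{2α} dp dq seen in bipolar coordinates, so Gaussian integrals against it are
explicit: G_τ ♯ G_σ = G_{σ+τ} and G_τ ♯ w = w (`lintegral_kernelD_gam_gam`,
`lintegral_kernelD_gam_powW`). Hence K(x,z) = ∫ D(x,y,z) N_λ(y) dy is non-negative, symmetric, and
satisfies ∫ K(x,z) w(z) dz = w(x)/λ (`lintegral_kerE_powW`). As r = 1/w and s = w²/C_μ,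
multiplication by r turns λK into a symmetric Markov operator on L^p(s dx), and Jensen's inequality
bounds its norm by 1 for every p (`wnorm_hankelConv_le`). Identification. All the weighted spaces
lie in L¹(w dx) + w L^∞. Zemanian functions, their images under S, and Gaussians lie in L¹(w dx) ∩ w
L^∞. The two classes pair absolutely, and N_λ ♯ is symmetric for the pairing
(`integral_hankelConv_mul`). The heat equation ∂_τ G_{σ+τ} = S G_{σ+τ} integrates to ∫ e^{-λτ} (λ -
S) G_{σ+τ} dτ = G_σ, and the G_σ are total (`InSum.ae_eq_zero`). Testing against G_σ gives N_λ ♯ (λ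
- S)φ = φ for Zemanian φ (`IsZemanian.hankelConv_resolvent`); by duality S(N_λ ♯ f) = λ N_λ ♯ f - f
for f in L. If S f = λ f, then f is orthogonal to every (λ - S) G_{σ+τ}, hence to every G_σ, hence
zero. So N_λ ♯ is the two-sided inverse of λ - S, and the remaining assertions follow. It is never
needed that S or N_λ ♯ preserves the Zemanian space. -/

namespace BesselOp

/-! ### Bipolar coordinates and Gaussian integrals against the Delsarte kernel -/

/-- The distances from the point `(p, q)` to the points `(0, 0)` and `(x, 0)`. -/
noncomputable def bipolar (x : ℝ) (w : ℝ × ℝ) : ℝ × ℝ :=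
  (√(w.1 ^ 2 + w.2 ^ 2), √((w.1 - x) ^ 2 + w.2 ^ 2))

/-- The derivative of `bipolar x`. -/
noncomputable def bipolarDeriv (x : ℝ) (w : ℝ × ℝ) : ℝ × ℝ →L[ℝ] ℝ × ℝ :=
  (Matrix.toLin (.finTwoProd ℝ) (.finTwoProd ℝ)
    !![w.1 / (bipolar x w).1, w.2 / (bipolar x w).1;
      (w.1 - x) / (bipolar x w).2, w.2 / (bipolar x w).2]).toContinuousLinearMap

lemma hasFDerivAt_bipolar (x : ℝ) {w : ℝ × ℝ} (hw : 0 < w.2) :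
    HasFDerivAt (bipolar x) (bipolarDeriv x w) w := by
  have h1 : 0 < w.1 ^ 2 + w.2 ^ 2 := by positivity
  have h2 : 0 < (w.1 - x) ^ 2 + w.2 ^ 2 := by positivity
  have d1 := (((hasFDerivAt_fst (𝕜 := ℝ) (p := w)).pow 2).add
    ((hasFDerivAt_snd (𝕜 := ℝ) (p := w)).pow 2)).sqrt h1.ne'
  have d2 := ((((hasFDerivAt_fst (𝕜 := ℝ) (p := w)).sub_const x).pow 2).add
    ((hasFDerivAt_snd (𝕜 := ℝ) (p := w)).pow 2)).sqrt h2.ne'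
  unfold bipolarDeriv
  rw [Matrix.toLin_finTwoProd_toContinuousLinearMap]
  refine (d1.prodMk d2).congr_fderiv ?_
  have e1 : √(w.1 ^ 2 + w.2 ^ 2) ≠ 0 := (Real.sqrt_pos.2 h1).ne'
  have e2 : √((w.1 - x) ^ 2 + w.2 ^ 2) ≠ 0 := (Real.sqrt_pos.2 h2).ne'
  ext <;> simp [bipolar] <;> field_simp

lemma det_bipolarDeriv (x : ℝ) {w : ℝ × ℝ} :
    (bipolarDeriv x w).det = x * w.2 / ((bipolar x w).1 * (bipolar x w).2) := by
  unfold bipolarDeriv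
  simp only [LinearMap.det_toContinuousLinearMap, LinearMap.det_toLin, Matrix.det_fin_two_of]
  rw [div_mul_div_comm, div_mul_div_comm, ← sub_div]
  ring

/-- The sides `(y, z)` of the non-degenerate triangles with third side `x`. -/
def triangleSet (x : ℝ) : Set (ℝ × ℝ) :=
  {w | 0 < w.1 ∧ 0 < w.2 ∧ |x - w.1| < w.2 ∧ w.2 < x + w.1}

lemma bipolar_sq {x : ℝ} {w : ℝ × ℝ} :
    (bipolar x w).1 ^ 2 = w.1 ^ 2 + w.2 ^ 2 ∧ (bipolar x w).2 ^ 2 = (w.1 - x) ^ 2 + w.2 ^ 2 :=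
  ⟨Real.sq_sqrt (by positivity), Real.sq_sqrt (by positivity)⟩

lemma bipolar_pos (x : ℝ) {w : ℝ × ℝ} (hw : 0 < w.2) :
    0 < (bipolar x w).1 ∧ 0 < (bipolar x w).2 :=
  ⟨Real.sqrt_pos.2 (by positivity), Real.sqrt_pos.2 (by positivity)⟩

/-- The difference of the two squared distances is 2xp - x², which determines p; then q² is known,
and q > 0 fixes its sign. -/
lemma injOn_bipolar {x : ℝ} (hx : 0 < x) : InjOn (bipolar x) {w | 0 < w.2} := by
  intro w hw v hv h
  obtain ⟨a1, a2⟩ := bipolar_sq (x := x) (w := w)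
  obtain ⟨b1, b2⟩ := bipolar_sq (x := x) (w := v)
  rw [h] at a1 a2
  have e1 : w.1 = v.1 := by
    have : 2 * x * (w.1 - v.1) = 0 := by nlinarith
    have h0 := (mul_eq_zero.1 this).resolve_left (by positivity)
    linarith
  have e2 : w.2 = v.2 := by
    have hw' : 0 < w.2 := hw
    have hv' : 0 < v.2 := hv
    rw [e1] at a1
    nlinarith
  exact Prod.ext e1 e2

/-- By Heron's identity 4x²(y² - p²) = ((x+y)² - z²)(z² - (x-y)²), where p is the foot of the
altitude. So strict triangle inequalities are exactly what makes the height √(y² - p²) positive. -/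
lemma image_bipolar {x : ℝ} (hx : 0 < x) :
    bipolar x '' {w | 0 < w.2} = triangleSet x := by
  ext ⟨y, z⟩
  constructor
  · rintro ⟨w, hw, h⟩
    have hw' : 0 < w.2 := hw
    obtain ⟨a1, a2⟩ := bipolar_sq (x := x) (w := w)
    obtain ⟨c1, c2⟩ := bipolar_pos x hw'
    rw [h] at a1 a2 c1 c2
    simp only at a1 a2 c1 c2
    have hq : 0 < w.2 ^ 2 := by positivity
    have k1 : w.1 < y := lt_of_pow_lt_pow_left₀ 2 c1.le (by nlinarith)
    have k2 : -w.1 < y := lt_of_pow_lt_pow_left₀ 2 c1.le (by nlinarith)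
    refine ⟨c1, c2, ?_, ?_⟩
    · refine lt_of_pow_lt_pow_left₀ 2 c2.le ?_
      rw [sq_abs]
      simp only
      nlinarith
    · refine lt_of_pow_lt_pow_left₀ 2 (by simp only; positivity) ?_
      simp only
      nlinarith
  · rintro ⟨hy, hz, h1, h2⟩
    simp only at hy hz h1 h2
    obtain ⟨h3, h4⟩ := abs_lt.1 h1
    set p := (y ^ 2 - z ^ 2 + x ^ 2) / (2 * x) with hp
    have hpx : 2 * x * p = y ^ 2 - z ^ 2 + x ^ 2 := by rw [hp]; field_simp
    have hpos : 0 < ((x + y) ^ 2 - z ^ 2) * (z ^ 2 - (x - y) ^ 2) := by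
      apply mul_pos <;> nlinarith
    have hq : 0 < y ^ 2 - p ^ 2 := by
      have : 4 * x ^ 2 * (y ^ 2 - p ^ 2) = ((x + y) ^ 2 - z ^ 2) * (z ^ 2 - (x - y) ^ 2) := by
        have : 4 * x ^ 2 * (y ^ 2 - p ^ 2) = 4 * x ^ 2 * y ^ 2 - (2 * x * p) ^ 2 := by ring
        rw [this, hpx]
        ring
      rw [← this] at hpos
      exact (mul_pos_iff_of_pos_left (by positivity)).1 hpos
    refine ⟨(p, √(y ^ 2 - p ^ 2)), Real.sqrt_pos.2 hq, ?_⟩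
    unfold bipolar
    simp only [Real.sq_sqrt hq.le]
    refine Prod.ext ?_ ?_
    · simp [Real.sqrt_sq hy.le]
    · have : (p - x) ^ 2 + (y ^ 2 - p ^ 2) = z ^ 2 := by linear_combination -hpx
      simp only [this, Real.sqrt_sq hz.le]

/-- The triangle has base x and height q. -/
lemma triangleArea_bipolar {x : ℝ} (hx : 0 < x) {w : ℝ × ℝ} (hw : 0 < w.2) :
    triangleArea x (bipolar x w).1 (bipolar x w).2 = x * w.2 / 2 := by
  obtain ⟨a1, a2⟩ := bipolar_sq (x := x) (w := w)
  unfold triangleArea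
  have : ((x + (bipolar x w).1) ^ 2 - (bipolar x w).2 ^ 2)
      * ((bipolar x w).2 ^ 2 - (x - (bipolar x w).1) ^ 2) = (2 * x * w.2) ^ 2 := by
    have : ((x + (bipolar x w).1) ^ 2 - (bipolar x w).2 ^ 2)
      * ((bipolar x w).2 ^ 2 - (x - (bipolar x w).1) ^ 2)
      = 4 * x ^ 2 * (bipolar x w).1 ^ 2
        - ((bipolar x w).1 ^ 2 - (bipolar x w).2 ^ 2 + x ^ 2) ^ 2 := by ring
    rw [this, a1, a2]
    ring
  rw [this, Real.sqrt_sq (by positivity)]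
  ring

lemma measurable_triangleArea :
    Measurable fun w : ℝ × ℝ × ℝ => triangleArea w.1 w.2.1 w.2.2 := by
  unfold triangleArea
  fun_prop

lemma measurable_delsarte (α : ℝ) :
    Measurable fun w : ℝ × ℝ × ℝ => delsarte α w.1 w.2.1 w.2.2 := by
  unfold delsarte
  refine Measurable.ite ?_ ?_ measurable_const
  · have h1 : Measurable fun w : ℝ × ℝ × ℝ => |w.1 - w.2.1| := by fun_prop
    have h2 : Measurable fun w : ℝ × ℝ × ℝ => w.2.2 := by fun_prop
    have h3 : Measurable fun w : ℝ × ℝ × ℝ => w.1 + w.2.1 := by fun_prop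
    exact (measurableSet_lt h1 h2).inter (measurableSet_lt h2 h3)
  · exact (((Measurable.pow_const (by fun_prop) _).const_mul _).div_const _).mul
      (measurable_triangleArea.pow_const _)

lemma delsarte_nonneg {α u v w : ℝ} (hα : -(1 / 2) < α) (hu : 0 < u) (hv : 0 < v) (hw : 0 < w) :
    0 ≤ delsarte α u v w := by
  unfold delsarte
  split_ifs
  · have : 0 < Real.Gamma (α + 1 / 2) := Real.Gamma_pos_of_pos (by linarith)
    have : 0 ≤ triangleArea u v w := by unfold triangleArea; positivity
    positivity
  · exact le_rfl

lemma delsarte_swap (α u v w : ℝ) :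
    delsarte α u v w = delsarte α w v u := by
  have h : (|u - v| < w ∧ w < u + v) ↔ (|w - v| < u ∧ u < w + v) := by
    simp only [abs_lt]
    constructor <;> rintro ⟨⟨h1, h2⟩, h3⟩ <;> refine ⟨⟨?_, ?_⟩, ?_⟩ <;> linarith
  have ht : triangleArea u v w = triangleArea w v u := by
    unfold triangleArea
    congr 2
    ring
  unfold delsarte
  simp only [h, ht, show u * v * w = w * v * u by ring]

lemma lintegral_rpow_mul_exp_neg_mul_sq {s b : ℝ} (hs : -1 < s) (hb : 0 < b) :
    ∫⁻ q in Ioi (0 : ℝ), ENNReal.ofReal (q ^ s * Real.exp (-b * q ^ 2))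
      = ENNReal.ofReal (b ^ (-(s + 1) / 2) * (1 / 2) * Real.Gamma ((s + 1) / 2)) := by
  rw [← ofReal_integral_eq_lintegral_ofReal (integrableOn_rpow_mul_exp_neg_mul_sq hb hs)]
  · have := integral_rpow_mul_exp_neg_mul_rpow (p := 2) two_pos hs hb
    simp only [Real.rpow_two] at this
    rw [this]
  · filter_upwards [ae_restrict_mem measurableSet_Ioi] with q hq
    have : (0 : ℝ) < q := hq
    simp only [Pi.zero_apply]
    positivity

/-- Completing the square moves the centre to bx/(a+b). The case b = 0 is kept because the function
w will be treated as a Gaussian of zero rate. -/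
lemma lintegral_exp_two_centers {a b : ℝ} (ha : 0 < a) (hb : 0 ≤ b) (x : ℝ) :
    ∫⁻ p : ℝ, ENNReal.ofReal (Real.exp (-a * p ^ 2 - b * (p - x) ^ 2))
      = ENNReal.ofReal (√(Real.pi / (a + b)) * Real.exp (-(a * b / (a + b) * x ^ 2))) := by
  have hab : 0 < a + b := by positivity
  have h : ∀ p, Real.exp (-a * p ^ 2 - b * (p - x) ^ 2)
      = Real.exp (-(a * b / (a + b) * x ^ 2))
        * Real.exp (-(a + b) * (p - b * x / (a + b)) ^ 2) := by
    intro p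
    rw [← Real.exp_add]
    congr 1
    field_simp
    ring
  simp_rw [h, ENNReal.ofReal_mul (Real.exp_pos _).le]
  rw [lintegral_const_mul _ (by fun_prop),
    lintegral_sub_right_eq_self (fun p => ENNReal.ofReal (Real.exp (-(a + b) * p ^ 2))),
    ← ofReal_integral_eq_lintegral_ofReal (integrable_exp_neg_mul_sq hab)
      (Filter.Eventually.of_forall fun _ => (Real.exp_pos _).le), integral_gaussian,
    ← ENNReal.ofReal_mul (Real.exp_pos _).le, ENNReal.ofReal_mul (Real.exp_pos _).le,
    ENNReal.ofReal_mul (by positivity), mul_comm]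

/-- The powers of y and z from the Jacobian, the kernel and the two Gaussians cancel, since (-α +
1/2) + (α + 1/2) - 1 = 0. The exponent involves only squared distances, so what remains is a
function of p times a function of q. -/
lemma delsarte_bipolar {α a b x : ℝ} (hx : 0 < x) {w : ℝ × ℝ}
    (hw : 0 < w.2) :
    x * w.2 / ((bipolar x w).1 * (bipolar x w).2)
      * (delsarte α x (bipolar x w).1 (bipolar x w).2
        * ((bipolar x w).1 ^ (α + 1 / 2) * Real.exp (-a * (bipolar x w).1 ^ 2))
        * ((bipolar x w).2 ^ (α + 1 / 2) * Real.exp (-b * (bipolar x w).2 ^ 2)))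
      = 2 ^ (-α) / (Real.Gamma (α + 1 / 2) * √Real.pi) * x ^ (α + 1 / 2)
        * (Real.exp (-a * w.1 ^ 2 - b * (w.1 - x) ^ 2)
          * (w.2 ^ (2 * α) * Real.exp (-(a + b) * w.2 ^ 2))) := by
  have hmem : bipolar x w ∈ triangleSet x := by
    rw [← image_bipolar hx]; exact mem_image_of_mem _ hw
  obtain ⟨-, -, t1, t2⟩ := hmem
  obtain ⟨a1, a2⟩ := bipolar_sq (x := x) (w := w)
  obtain ⟨c1, c2⟩ := bipolar_pos x hw
  unfold delsarte
  rw [if_pos ⟨t1, t2⟩, triangleArea_bipolar hx hw, a1, a2]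
  set y := (bipolar x w).1
  set z := (bipolar x w).2
  set q := w.2
  have hexp : Real.exp (-a * w.1 ^ 2 - b * (w.1 - x) ^ 2) * Real.exp (-(a + b) * q ^ 2)
      = Real.exp (-a * (w.1 ^ 2 + q ^ 2)) * Real.exp (-b * ((w.1 - x) ^ 2 + q ^ 2)) := by
    rw [← Real.exp_add, ← Real.exp_add]
    congr 1
    ring
  -- With every factor written as the exponential of a logarithm, this identity between powers
  -- becomes a linear identity between logarithms.
  have hpow : x * q / (y * z) * (2 ^ (α - 1) * (x * y * z) ^ (-α + 1 / 2)
      * (x * q / 2) ^ (2 * α - 1) * y ^ (α + 1 / 2) * z ^ (α + 1 / 2))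
      = 2 ^ (-α) * x ^ (α + 1 / 2) * q ^ (2 * α) := by
    have hlog : ∀ t : ℝ, 0 < t → ∀ s : ℝ, t ^ s = Real.exp (Real.log t * s) :=
      fun t ht s => Real.rpow_def_of_pos ht s
    have hl : ∀ t : ℝ, 0 < t → t = Real.exp (Real.log t) := fun t ht => (Real.exp_log ht).symm
    have e1 : x * q / (y * z) = Real.exp (Real.log x + Real.log q - (Real.log y + Real.log z)) := by
      rw [Real.exp_sub, Real.exp_add, Real.exp_add, Real.exp_log hx, Real.exp_log hw,
        Real.exp_log c1, Real.exp_log c2]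
    rw [e1, hlog _ (by positivity : 0 < x * y * z), hlog _ (by positivity : 0 < x * q / 2),
      hlog y c1, hlog z c2, hlog q hw, hlog x hx, hlog 2 two_pos, hlog 2 two_pos,
      Real.log_div (by positivity) two_ne_zero, Real.log_mul hx.ne' hw.ne',
      Real.log_mul (by positivity) c2.ne', Real.log_mul hx.ne' c1.ne']
    simp only [← Real.exp_add]
    congr 1
    ring
  calc _ = x * q / (y * z) * (2 ^ (α - 1) * (x * y * z) ^ (-α + 1 / 2)
      * (x * q / 2) ^ (2 * α - 1) * y ^ (α + 1 / 2) * z ^ (α + 1 / 2))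
      / (Real.Gamma (α + 1 / 2) * √Real.pi)
      * (Real.exp (-a * (w.1 ^ 2 + q ^ 2)) * Real.exp (-b * ((w.1 - x) ^ 2 + q ^ 2))) := by ring
    _ = _ := by rw [hpow, ← hexp]; ring

/-- The Hankel convolution of two one-dimensional Gaussians. -/
lemma lintegral_delsarte_gaussian {α a b x : ℝ} (hα : -(1 / 2) < α) (ha : 0 < a) (hb : 0 ≤ b)
    (hx : 0 < x) :
    ∫⁻ y in Ioi (0 : ℝ), ∫⁻ z in Ioi (0 : ℝ), ENNReal.ofReal (delsarte α x y z
        * (y ^ (α + 1 / 2) * Real.exp (-a * y ^ 2)) * (z ^ (α + 1 / 2) * Real.exp (-b * z ^ 2)))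
      = ENNReal.ofReal ((2 * (a + b)) ^ (-(α + 1)) * x ^ (α + 1 / 2)
        * Real.exp (-(a * b / (a + b) * x ^ 2))) := by
  set G : ℝ × ℝ → ℝ≥0∞ := fun w => ENNReal.ofReal (delsarte α x w.1 w.2
        * (w.1 ^ (α + 1 / 2) * Real.exp (-a * w.1 ^ 2))
        * (w.2 ^ (α + 1 / 2) * Real.exp (-b * w.2 ^ 2))) with hG
  have hGm : Measurable G := by
    refine Measurable.ennreal_ofReal (Measurable.mul (Measurable.mul ?_ ?_) ?_)
    · exact (measurable_delsarte α).comp (measurable_const.prodMk measurable_id)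
    · exact (measurable_fst.pow_const _).mul (by fun_prop)
    · exact (measurable_snd.pow_const _).mul (by fun_prop)
  have hgam : 0 < Real.Gamma (α + 1 / 2) := Real.Gamma_pos_of_pos (by linarith)
  have hab : 0 < a + b := by positivity
  have hU : MeasurableSet {w : ℝ × ℝ | 0 < w.2} := measurableSet_lt measurable_const measurable_snd
  have hT : MeasurableSet (triangleSet x) :=
    (measurableSet_lt measurable_const measurable_fst).inter
      ((measurableSet_lt measurable_const measurable_snd).inter
        ((measurableSet_lt (by fun_prop) measurable_snd).inter
          (measurableSet_lt measurable_snd (by fun_prop))))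
  have hUp : {w : ℝ × ℝ | 0 < w.2} = univ ×ˢ Ioi 0 := by ext; simp
  calc _ = ∫⁻ w in Ioi (0 : ℝ) ×ˢ Ioi (0 : ℝ), G w := by
        rw [Measure.volume_eq_prod, ← Measure.prod_restrict, lintegral_prod _ hGm.aemeasurable]
    -- Off the triangle set the Delsarte kernel vanishes.
    _ = ∫⁻ w in triangleSet x, G w := by
        rw [← lintegral_indicator (measurableSet_Ioi.prod measurableSet_Ioi),
          ← lintegral_indicator hT]
        congr 1
        ext w
        by_cases h3 : w ∈ triangleSet x
        · have h4 : w ∈ Ioi (0 : ℝ) ×ˢ Ioi (0 : ℝ) := ⟨h3.1, h3.2.1⟩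
          rw [indicator_of_mem h3, indicator_of_mem h4]
        rw [indicator_of_notMem h3]
        by_cases h4 : w ∈ Ioi (0 : ℝ) ×ˢ Ioi (0 : ℝ)
        · have : delsarte α x w.1 w.2 = 0 := if_neg fun h => h3 ⟨h4.1, h4.2, h.1, h.2⟩
          simp [hG, this]
        · rw [indicator_of_notMem h4]
    _ = ∫⁻ w in {w : ℝ × ℝ | 0 < w.2},
          ENNReal.ofReal |(bipolarDeriv x w).det| * G (bipolar x w) := by
        rw [← image_bipolar hx]
        exact lintegral_image_eq_lintegral_abs_det_fderiv_mul volume hU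
          (fun w hw => (hasFDerivAt_bipolar x hw).hasFDerivWithinAt) (injOn_bipolar hx) G
    _ = ∫⁻ w in univ ×ˢ Ioi (0 : ℝ),
          ENNReal.ofReal (2 ^ (-α) / (Real.Gamma (α + 1 / 2) * √Real.pi) * x ^ (α + 1 / 2))
          * (ENNReal.ofReal (Real.exp (-a * w.1 ^ 2 - b * (w.1 - x) ^ 2))
          * ENNReal.ofReal (w.2 ^ (2 * α) * Real.exp (-(a + b) * w.2 ^ 2))) := by
        rw [← hUp]
        refine setLIntegral_congr_fun hU fun w hw => ?_
        obtain ⟨c1, c2⟩ := bipolar_pos x hw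
        have hw' : 0 < w.2 := hw
        have hnn : 0 ≤ x * w.2 / ((bipolar x w).1 * (bipolar x w).2) := by positivity
        rw [det_bipolarDeriv, abs_of_nonneg hnn, hG, ← ENNReal.ofReal_mul hnn,
          delsarte_bipolar hx hw, ENNReal.ofReal_mul (by positivity),
          ENNReal.ofReal_mul (Real.exp_pos _).le]
    _ = _ := by
        have m1 : Measurable fun p : ℝ =>
            ENNReal.ofReal (Real.exp (-a * p ^ 2 - b * (p - x) ^ 2)) := by fun_prop
        have m2 : Measurable fun q : ℝ =>
            ENNReal.ofReal (q ^ (2 * α) * Real.exp (-(a + b) * q ^ 2)) :=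
          ((measurable_id.pow_const _).mul (by fun_prop)).ennreal_ofReal
        -- The integral factors: p gives a Gaussian with two centres, q gives a value of Γ at α +
        -- 1/2 that cancels the one in the kernel. Convergence of the q-integral at 0 is the
        -- condition 2α > -1.
        rw [lintegral_const_mul' _ _ ENNReal.ofReal_ne_top,
          Measure.volume_eq_prod, ← Measure.prod_restrict,
          lintegral_prod_mul m1.aemeasurable m2.aemeasurable, Measure.restrict_univ,
          lintegral_exp_two_centers ha hb,
          lintegral_rpow_mul_exp_neg_mul_sq (by linarith) hab,
          ← ENNReal.ofReal_mul (by positivity), ← ENNReal.ofReal_mul (by positivity)]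
        congr 1
        rw [Real.sqrt_div Real.pi_pos.le, show (2 * α + 1) / 2 = α + 1 / 2 by ring,
          Real.mul_rpow two_pos.le hab.le, show (-(2 * α + 1) / 2) = -(α + 1) + 1 / 2 by ring,
          Real.rpow_add hab, ← Real.sqrt_eq_rpow, show -(α + 1) = -α + -1 by ring,
          Real.rpow_add two_pos, Real.rpow_neg_one]
        have := Real.sqrt_pos.2 hab
        have := Real.sqrt_pos.2 Real.pi_pos
        generalize Real.Gamma (α + 1 / 2) = g at hgam ⊢
        field_simp


/-! ### Product integrals over the orthant -/

lemma vol_eq_pi (n : ℕ) :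
    vol n = Measure.pi fun _ : Fin n => (volume : Measure ℝ).restrict (Ioi 0) := by
  have h : orthant n = univ.pi fun _ => Ioi (0 : ℝ) := by
    ext x
    simp [orthant]
  rw [← Measure.restrict_pi_pi, ← volume_pi, ← h]

lemma lintegral_pi_prod {n : ℕ} (ν : Fin n → Measure ℝ) [∀ i, SigmaFinite (ν i)]
    {f : Fin n → ℝ → ℝ≥0∞} (hf : ∀ i, Measurable (f i)) :
    ∫⁻ x, ∏ i, f i (x i) ∂Measure.pi ν = ∏ i, ∫⁻ t, f i t ∂ν i := by
  induction n with
  | zero => simp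
  | succ n ih =>
    rw [← (measurePreserving_piFinSuccAbove ν 0).symm.lintegral_comp_emb
      (MeasurableEquiv.measurableEmbedding _)]
    simp only [MeasurableEquiv.piFinSuccAbove_symm_apply, Fin.insertNthEquiv, Fin.prod_univ_succ,
      Fin.insertNth_zero, Equiv.coe_fn_mk, Fin.cons_succ, Fin.zero_succAbove, Fin.cons_zero]
    refine (lintegral_prod_mul (f := f 0)
      (g := fun x : Fin n → ℝ => ∏ i : Fin n, f i.succ (x i)) (hf 0).aemeasurable
      (Finset.measurable_prod _ fun i _ =>
        (hf i.succ).comp (measurable_pi_apply i)).aemeasurable).trans ?_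
    rw [ih _ fun i => hf i.succ]

lemma lintegral_vol_prod {n : ℕ} {f : Fin n → ℝ → ℝ≥0∞} (hf : ∀ i, Measurable (f i)) :
    ∫⁻ x, ∏ i, f i (x i) ∂vol n = ∏ i, ∫⁻ t in Ioi (0 : ℝ), f i t := by
  rw [vol_eq_pi, lintegral_pi_prod _ hf]

lemma lintegral_vol_vol_prod {n : ℕ} {f : Fin n → ℝ × ℝ → ℝ≥0∞} (hf : ∀ i, Measurable (f i)) :
    ∫⁻ y, ∫⁻ z, ∏ i, f i (y i, z i) ∂vol n ∂vol n
      = ∏ i, ∫⁻ s in Ioi (0 : ℝ), ∫⁻ t in Ioi (0 : ℝ), f i (s, t) := by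
  have h (y : Fin n → ℝ) : ∫⁻ z, ∏ i, f i (y i, z i) ∂vol n
      = ∏ i, ∫⁻ t in Ioi (0 : ℝ), f i (y i, t) :=
    lintegral_vol_prod (f := fun i t => f i (y i, t))
      fun i => (hf i).comp (measurable_const.prodMk measurable_id)
  simp_rw [h]
  exact lintegral_vol_prod (f := fun i s => ∫⁻ t in Ioi (0 : ℝ), f i (s, t))
    fun i => (hf i).lintegral_prod_right'

lemma ae_mem_orthant (n : ℕ) : ∀ᵐ x ∂vol n, x ∈ orthant n :=
  ae_restrict_mem (isOpen_orthant n).measurableSet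

/-! ### Gaussians -/

/-- `w(x) = x^{μ+1/2}`, the reciprocal of `r`. -/
noncomputable def powW {n : ℕ} (μ x : Fin n → ℝ) : ℝ := ∏ i, x i ^ (μ i + 1 / 2)

/-- The one-dimensional Gaussian `x^{α+1/2} (2σ)^{-α-1} e^{-x²/(4σ)}`. -/
noncomputable def gauss (α σ x : ℝ) : ℝ :=
  x ^ (α + 1 / 2) * ((2 * σ) ^ (-(α + 1)) * Real.exp (-(x ^ 2 / (4 * σ))))

/-- The Gaussian `∏ xᵢ^{μᵢ+1/2} (2σᵢ)^{-μᵢ-1} e^{-xᵢ²/(4σᵢ)}`. -/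
noncomputable def gam {n : ℕ} (μ σ x : Fin n → ℝ) : ℝ := ∏ i, gauss (μ i) (σ i) (x i)

lemma powW_pos {n : ℕ} (μ : Fin n → ℝ) {x : Fin n → ℝ} (hx : x ∈ orthant n) : 0 < powW μ x :=
  Finset.prod_pos fun i _ => Real.rpow_pos_of_pos (hx i) _

lemma measurable_powW {n : ℕ} (μ : Fin n → ℝ) : Measurable (powW μ) :=
  Finset.measurable_prod _ fun i _ => (measurable_pi_apply i).pow_const _

lemma powW_mul_weightR {n : ℕ} (μ : Fin n → ℝ) {x : Fin n → ℝ} (hx : x ∈ orthant n) :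
    powW μ x * weightR μ x = 1 := by
  unfold powW weightR
  rw [← Finset.prod_mul_distrib]
  refine Finset.prod_eq_one fun i _ => ?_
  rw [← Real.rpow_add (hx i)]
  simp

lemma powW_sq {n : ℕ} {μ : Fin n → ℝ} (hμ : ∀ i, -(1 / 2) < μ i) {x : Fin n → ℝ}
    (hx : x ∈ orthant n) : powW μ x ^ 2 = constC μ * weightS μ x := by
  unfold powW weightS
  rw [mul_div_cancel₀ _ (constC_pos hμ).ne', ← Finset.prod_pow]
  refine Finset.prod_congr rfl fun i _ => ?_
  rw [← Real.rpow_natCast, ← Real.rpow_mul (hx i).le]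
  congr 1
  push_cast
  ring

lemma gauss_pos {α σ x : ℝ} (hσ : 0 < σ) (hx : 0 < x) : 0 < gauss α σ x := by
  unfold gauss
  positivity

lemma measurable_gauss (α : ℝ) : Measurable fun w : ℝ × ℝ => gauss α w.1 w.2 := by
  unfold gauss
  refine (Measurable.pow_const (by fun_prop) _).mul ((Measurable.pow_const (by fun_prop) _).mul ?_)
  fun_prop

lemma gam_pos {n : ℕ} (μ : Fin n → ℝ) {σ x : Fin n → ℝ} (hσ : ∀ i, 0 < σ i)
    (hx : x ∈ orthant n) : 0 < gam μ σ x :=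
  Finset.prod_pos fun i _ => gauss_pos (hσ i) (hx i)

lemma measurable_gam_uncurry {n : ℕ} (μ : Fin n → ℝ) :
    Measurable fun w : (Fin n → ℝ) × (Fin n → ℝ) => gam μ w.1 w.2 :=
  Finset.measurable_prod _ fun i _ => (measurable_gauss (μ i)).comp
    (f := fun w : (Fin n → ℝ) × (Fin n → ℝ) => (w.1 i, w.2 i)) (((measurable_pi_apply i).comp measurable_fst).prodMk
      ((measurable_pi_apply i).comp measurable_snd))

lemma measurable_gam {n : ℕ} (μ σ : Fin n → ℝ) : Measurable (gam μ σ) :=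
  (measurable_gam_uncurry μ).comp (measurable_const.prodMk measurable_id)

lemma measurable_gam_add {n : ℕ} (μ σ : Fin n → ℝ) :
    Measurable fun w : ℝ × (Fin n → ℝ) => gam μ (fun i => σ i + w.1) w.2 :=
  (measurable_gam_uncurry μ).comp
    (Measurable.prodMk (measurable_pi_lambda _ fun i => by fun_prop) measurable_snd)

lemma measurable_gam_const {n : ℕ} (μ : Fin n → ℝ) :
    Measurable fun w : ℝ × (Fin n → ℝ) => gam μ (fun _ => w.1) w.2 := by
  simpa using measurable_gam_add μ 0

/-- The factor (2σ)^{-α-1} in `gauss` is the normalisation that makes this mass independent of σ. -/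
lemma lintegral_rpow_mul_gauss {α σ : ℝ} (hα : -(1 / 2) < α) (hσ : 0 < σ) :
    ∫⁻ x in Ioi (0 : ℝ), ENNReal.ofReal (x ^ (α + 1 / 2) * gauss α σ x)
      = ENNReal.ofReal (2 ^ α * Real.Gamma (α + 1)) := by
  have h : ∀ x ∈ Ioi (0 : ℝ), ENNReal.ofReal (x ^ (α + 1 / 2) * gauss α σ x)
      = ENNReal.ofReal ((2 * σ) ^ (-(α + 1)))
        * ENNReal.ofReal (x ^ (2 * α + 1) * Real.exp (-(1 / (4 * σ)) * x ^ 2)) := by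
    intro x hx
    have hx' : 0 < x := hx
    rw [← ENNReal.ofReal_mul (by positivity)]
    congr 1
    unfold gauss
    have e : x ^ (2 * α + 1) = x ^ (α + 1 / 2) * x ^ (α + 1 / 2) := by
      rw [← Real.rpow_add hx']
      congr 1
      ring
    rw [e]
    have : -(x ^ 2 / (4 * σ)) = -(1 / (4 * σ)) * x ^ 2 := by ring
    rw [this]
    ring
  have hg : 0 < Real.Gamma (α + 1) := Real.Gamma_pos_of_pos (by linarith)
  rw [setLIntegral_congr_fun measurableSet_Ioi h, lintegral_const_mul' _ _ ENNReal.ofReal_ne_top,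
    lintegral_rpow_mul_exp_neg_mul_sq (by linarith) (by positivity),
    ← ENNReal.ofReal_mul (by positivity)]
  congr 1
  rw [show (2 * α + 1 + 1) / 2 = α + 1 by ring, show -(2 * α + 1 + 1) / 2 = -(α + 1) by ring,
    one_div, Real.inv_rpow (by positivity), ← Real.rpow_neg (by positivity), neg_neg,
    show 4 * σ = 2 * σ * 2 by ring, Real.mul_rpow (by positivity) two_pos.le,
    Real.rpow_neg (by positivity), Real.rpow_add two_pos, Real.rpow_one]
  have : 0 < (2 * σ) ^ (α + 1) := by positivity
  generalize Real.Gamma (α + 1) = g at hg ⊢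
  generalize (2 * σ) ^ (α + 1) = t at this ⊢
  field_simp

/-- The mass against w does not depend on σ, so the heat flow conserves it; this makes all later
integrals in τ converge with e^{-λτ} as the only decay. -/
lemma lintegral_powW_mul_gam {n : ℕ} {μ σ : Fin n → ℝ} (hμ : ∀ i, -(1 / 2) < μ i)
    (hσ : ∀ i, 0 < σ i) :
    ∫⁻ x, ENNReal.ofReal (powW μ x) * ENNReal.ofReal (gam μ σ x) ∂vol n
      = ENNReal.ofReal (constC μ) := by
  have h : ∀ᵐ x ∂vol n, ENNReal.ofReal (powW μ x) * ENNReal.ofReal (gam μ σ x)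
      = ∏ i, ENNReal.ofReal (x i ^ (μ i + 1 / 2) * gauss (μ i) (σ i) (x i)) := by
    filter_upwards [ae_mem_orthant n] with x hx
    rw [← ENNReal.ofReal_mul (powW_pos μ hx).le, powW, gam, ← Finset.prod_mul_distrib,
      ENNReal.ofReal_prod_of_nonneg]
    intro i _
    have := hx i
    have := gauss_pos (α := μ i) (hσ i) (hx i)
    positivity
  rw [lintegral_congr_ae h, lintegral_vol_prod
    (f := fun i t => ENNReal.ofReal (t ^ (μ i + 1 / 2) * gauss (μ i) (σ i) t))]
  · simp_rw [lintegral_rpow_mul_gauss (hμ _) (hσ _)]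
    rw [constC, ENNReal.ofReal_prod_of_nonneg]
    intro i _
    have : 0 < Real.Gamma (μ i + 1) := Real.Gamma_pos_of_pos (by linarith [hμ i])
    positivity
  · intro i
    exact ((measurable_id.pow_const _).mul
      ((measurable_gauss (μ i)).comp (measurable_const.prodMk measurable_id))).ennreal_ofReal

/-- With rates a = 1/(4τ) and b = 1/(4σ), ab/(a+b) = 1/(4(σ+τ)), and the normalising factors combine
through (2τ)(2σ)·2(a+b) = 2(σ+τ). -/
lemma lintegral_delsarte_gauss_gauss {α τ σ x : ℝ} (hα : -(1 / 2) < α) (hτ : 0 < τ) (hσ : 0 < σ)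
    (hx : 0 < x) :
    ∫⁻ y in Ioi (0 : ℝ), ∫⁻ z in Ioi (0 : ℝ),
        ENNReal.ofReal (delsarte α x y z * gauss α τ y * gauss α σ z)
      = ENNReal.ofReal (gauss α (σ + τ) x) := by
  have h : ∀ y z, ENNReal.ofReal (delsarte α x y z * gauss α τ y * gauss α σ z)
      = ENNReal.ofReal ((2 * τ) ^ (-(α + 1)) * (2 * σ) ^ (-(α + 1))) * ENNReal.ofReal
        (delsarte α x y z * (y ^ (α + 1 / 2) * Real.exp (-(1 / (4 * τ)) * y ^ 2))
          * (z ^ (α + 1 / 2) * Real.exp (-(1 / (4 * σ)) * z ^ 2))) := by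
    intro y z
    rw [← ENNReal.ofReal_mul (by positivity)]
    congr 1
    unfold gauss
    rw [show -(y ^ 2 / (4 * τ)) = -(1 / (4 * τ)) * y ^ 2 by ring,
      show -(z ^ 2 / (4 * σ)) = -(1 / (4 * σ)) * z ^ 2 by ring]
    ring
  simp_rw [h, lintegral_const_mul' _ _ ENNReal.ofReal_ne_top]
  rw [lintegral_delsarte_gaussian hα (by positivity) (by positivity) hx,
    ← ENNReal.ofReal_mul (by positivity)]
  congr 1
  unfold gauss
  have e1 : 1 / (4 * τ) * (1 / (4 * σ)) / (1 / (4 * τ) + 1 / (4 * σ)) * x ^ 2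
      = x ^ 2 / (4 * (σ + τ)) := by
    field_simp
  rw [e1, ← mul_assoc, ← mul_assoc, ← Real.mul_rpow (by positivity) (by positivity),
    ← Real.mul_rpow (by positivity) (by positivity)]
  have e2 : 2 * τ * (2 * σ) * (2 * (1 / (4 * τ) + 1 / (4 * σ))) = 2 * (σ + τ) := by
    field_simp
    ring
  rw [e2]
  ring

/-- The degenerate case b = 0 of the Gaussian formula: the exponential disappears and the constants
cancel, so the power is a fixed point of the heat flow. -/
lemma lintegral_delsarte_gauss_rpow {α τ x : ℝ} (hα : -(1 / 2) < α) (hτ : 0 < τ) (hx : 0 < x) :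
    ∫⁻ y in Ioi (0 : ℝ), ∫⁻ z in Ioi (0 : ℝ),
        ENNReal.ofReal (delsarte α x y z * gauss α τ y * z ^ (α + 1 / 2))
      = ENNReal.ofReal (x ^ (α + 1 / 2)) := by
  have h : ∀ y z, ENNReal.ofReal (delsarte α x y z * gauss α τ y * z ^ (α + 1 / 2))
      = ENNReal.ofReal ((2 * τ) ^ (-(α + 1))) * ENNReal.ofReal
        (delsarte α x y z * (y ^ (α + 1 / 2) * Real.exp (-(1 / (4 * τ)) * y ^ 2))
          * (z ^ (α + 1 / 2) * Real.exp (-0 * z ^ 2))) := by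
    intro y z
    rw [← ENNReal.ofReal_mul (by positivity)]
    congr 1
    unfold gauss
    rw [show -(y ^ 2 / (4 * τ)) = -(1 / (4 * τ)) * y ^ 2 by ring]
    simp
    ring
  simp_rw [h, lintegral_const_mul' _ _ ENNReal.ofReal_ne_top]
  rw [lintegral_delsarte_gaussian hα (by positivity) le_rfl hx,
    ← ENNReal.ofReal_mul (by positivity)]
  congr 1
  rw [← mul_assoc, ← mul_assoc, ← Real.mul_rpow (by positivity) (by positivity)]
  have e2 : 2 * τ * (2 * (1 / (4 * τ) + 0)) = 1 := by field_simp; ring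
  rw [e2]
  simp

lemma measurable_kernelD {n : ℕ} (μ : Fin n → ℝ) :
    Measurable fun w : (Fin n → ℝ) × (Fin n → ℝ) × (Fin n → ℝ) =>
      kernelD μ w.1 w.2.1 w.2.2 :=
  Finset.measurable_prod _ fun i _ => (measurable_delsarte (μ i)).comp
    (f := fun w : (Fin n → ℝ) × (Fin n → ℝ) × (Fin n → ℝ) => (w.1 i, w.2.1 i, w.2.2 i))
    (((measurable_pi_apply i).comp measurable_fst).prodMk
      (((measurable_pi_apply i).comp (measurable_fst.comp measurable_snd)).prodMk
        ((measurable_pi_apply i).comp (measurable_snd.comp measurable_snd))))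

lemma kernelD_nonneg {n : ℕ} {μ x y z : Fin n → ℝ} (hμ : ∀ i, -(1 / 2) < μ i)
    (hx : x ∈ orthant n) (hy : y ∈ orthant n) (hz : z ∈ orthant n) : 0 ≤ kernelD μ x y z :=
  Finset.prod_nonneg fun i _ => delsarte_nonneg (hμ i) (hx i) (hy i) (hz i)

lemma kernelD_swap {n : ℕ} (μ x y z : Fin n → ℝ) : kernelD μ x y z = kernelD μ z y x :=
  Finset.prod_congr rfl fun _ _ => delsarte_swap _ _ _ _

lemma lintegral_kernelD_prod {n : ℕ} {μ σ : Fin n → ℝ} {x : Fin n → ℝ}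
    (hμ : ∀ i, -(1 / 2) < μ i) (hσ : ∀ i, 0 < σ i) (hx : x ∈ orthant n) {v : Fin n → ℝ → ℝ}
    (hv : ∀ i, Measurable (v i)) (hv0 : ∀ i t, 0 < t → 0 ≤ v i t) :
    ∫⁻ y, ∫⁻ z, ENNReal.ofReal (kernelD μ x y z) * ENNReal.ofReal (gam μ σ y)
        * ENNReal.ofReal (∏ i, v i (z i)) ∂vol n ∂vol n
      = ∏ i, ∫⁻ s in Ioi (0 : ℝ), ∫⁻ t in Ioi (0 : ℝ),
        ENNReal.ofReal (delsarte (μ i) (x i) s t * gauss (μ i) (σ i) s * v i t) := by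
  rw [← lintegral_vol_vol_prod (f := fun i w => ENNReal.ofReal
    (delsarte (μ i) (x i) w.1 w.2 * gauss (μ i) (σ i) w.1 * v i w.2))]
  · refine lintegral_congr_ae ?_
    filter_upwards [ae_mem_orthant n] with y hy
    refine lintegral_congr_ae ?_
    filter_upwards [ae_mem_orthant n] with z hz
    rw [← ENNReal.ofReal_mul (kernelD_nonneg hμ hx hy hz), ← ENNReal.ofReal_mul
      (mul_nonneg (kernelD_nonneg hμ hx hy hz) (gam_pos μ hσ hy).le), kernelD, gam,
      ← Finset.prod_mul_distrib, ← Finset.prod_mul_distrib, ENNReal.ofReal_prod_of_nonneg]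
    intro i _
    exact mul_nonneg (mul_nonneg (delsarte_nonneg (hμ i) (hx i) (hy i) (hz i))
      (gauss_pos (hσ i) (hy i)).le) (hv0 i _ (hz i))
  · intro i
    exact ((((measurable_delsarte (μ i)).comp (measurable_const.prodMk measurable_id)).mul
      ((measurable_gauss (μ i)).comp (measurable_const.prodMk measurable_fst))).mul
        ((hv i).comp measurable_snd)).ennreal_ofReal

/-- The Hankel convolution of two Gaussians is a Gaussian. -/
lemma lintegral_kernelD_gam_gam {n : ℕ} {μ σ ρ : Fin n → ℝ} {x : Fin n → ℝ}
    (hμ : ∀ i, -(1 / 2) < μ i) (hσ : ∀ i, 0 < σ i) (hρ : ∀ i, 0 < ρ i) (hx : x ∈ orthant n) :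
    ∫⁻ y, ∫⁻ z, ENNReal.ofReal (kernelD μ x y z) * ENNReal.ofReal (gam μ σ y)
        * ENNReal.ofReal (gam μ ρ z) ∂vol n ∂vol n
      = ENNReal.ofReal (gam μ (fun i => ρ i + σ i) x) := by
  have := lintegral_kernelD_prod hμ hσ hx (v := fun i => gauss (μ i) (ρ i))
    (fun i => (measurable_gauss (μ i)).comp (measurable_const.prodMk measurable_id))
    fun i _ ht => (gauss_pos (hρ i) ht).le
  unfold gam at this ⊢
  rw [this, ENNReal.ofReal_prod_of_nonneg
    fun i _ => (gauss_pos (add_pos (hρ i) (hσ i)) (hx i)).le]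
  exact Finset.prod_congr rfl fun i _ =>
    lintegral_delsarte_gauss_gauss (hμ i) (hσ i) (hρ i) (hx i)

lemma lintegral_kernelD_gam_powW {n : ℕ} {μ σ : Fin n → ℝ} {x : Fin n → ℝ}
    (hμ : ∀ i, -(1 / 2) < μ i) (hσ : ∀ i, 0 < σ i) (hx : x ∈ orthant n) :
    ∫⁻ y, ∫⁻ z, ENNReal.ofReal (kernelD μ x y z) * ENNReal.ofReal (gam μ σ y)
        * ENNReal.ofReal (powW μ z) ∂vol n ∂vol n = ENNReal.ofReal (powW μ x) := by
  have := lintegral_kernelD_prod hμ hσ hx (v := fun i t => t ^ (μ i + 1 / 2))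
    (fun i => measurable_id.pow_const _) fun _ _ ht => (Real.rpow_pos_of_pos ht _).le
  unfold powW
  rw [this, ENNReal.ofReal_prod_of_nonneg fun i _ => (Real.rpow_pos_of_pos (hx i) _).le]
  exact Finset.prod_congr rfl fun i _ => lintegral_delsarte_gauss_rpow (hμ i) (hσ i) (hx i)


/-! ### The resolvent kernel as a mixture of Gaussians -/

lemma gam_const_eq {n : ℕ} (μ : Fin n → ℝ) {τ : ℝ} (hτ : 0 < τ) (x : Fin n → ℝ) :
    gam μ (fun _ => τ) x = powW μ x * ((∏ i, (2 : ℝ) ^ (-μ i - 1)) * τ ^ (-(∑ i, μ i + n)))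
      * Real.exp (-(normSq x / (4 * τ))) := by
  have h1 : -(∑ i, μ i + n) = ∑ i, (-μ i - 1) := by
    simp [Finset.sum_sub_distrib]
    ring
  have h2 : -(normSq x / (4 * τ)) = ∑ i, -(x i ^ 2 / (4 * τ)) := by
    rw [normSq, Finset.sum_div, Finset.sum_neg_distrib]
  rw [h1, h2, Real.exp_sum, Real.rpow_sum_of_pos hτ, powW, gam, ← Finset.prod_mul_distrib,
    ← Finset.prod_mul_distrib, ← Finset.prod_mul_distrib]
  refine Finset.prod_congr rfl fun i _ => ?_
  rw [gauss, Real.mul_rpow two_pos.le hτ.le, show -(μ i + 1) = -μ i - 1 by ring]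
  ring

/-- The substitution t = λτ exhibits N_λ as the Laplace transform of the heat kernels, which is how
a resolvent arises from its semigroup. -/
lemma kernelN_eq {n : ℕ} (μ : Fin n → ℝ) {l : ℝ} (hl : 0 < l) (x : Fin n → ℝ) :
    kernelN μ l x = ∫ τ in Ioi (0 : ℝ), Real.exp (-(l * τ)) * gam μ (fun _ => τ) x := by
  have hw : (√(normSq fun i => √l * x i)) ^ 2 = l * normSq x := by
    have h : (normSq fun i => √l * x i) = l * normSq x := by
      rw [normSq, normSq, Finset.mul_sum]
      exact Finset.sum_congr rfl fun i _ => by rw [mul_pow, Real.sq_sqrt hl.le]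
    have h0 : 0 ≤ normSq x := Finset.sum_nonneg fun _ _ => sq_nonneg _
    rw [h, Real.sq_sqrt (mul_nonneg hl.le h0)]
  have hc := integral_comp_mul_left_Ioi (fun t => Real.exp (-t - l * normSq x / (4 * t))
    / t ^ (∑ i, μ i + n - 1 + 1)) 0 hl
  rw [mul_zero, smul_eq_mul, eq_inv_mul_iff_mul_eq₀ hl.ne'] at hc
  rw [kernelN, calN, hw, ← hc, ← mul_assoc, ← integral_const_mul]
  refine setIntegral_congr_fun measurableSet_Ioi fun τ hτ => ?_
  have hτ' : 0 < τ := hτ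
  have e1 : Real.exp (-(l * τ) - l * normSq x / (4 * (l * τ)))
      = Real.exp (-(l * τ)) * Real.exp (-(normSq x / (4 * τ))) := by
    rw [← Real.exp_add]
    congr 1
    field_simp
    ring
  simp only [e1]
  rw [gam_const_eq μ hτ', sub_add_cancel, Real.mul_rpow hl.le hτ'.le, Real.rpow_neg hτ'.le,
    Real.rpow_add hl (∑ i, μ i), Real.rpow_sub_one hl.ne', Real.rpow_sum_of_pos hl, powW]
  have h1 : 0 < ∏ i, l ^ μ i := Finset.prod_pos fun i _ => Real.rpow_pos_of_pos hl _
  have h2 : 0 < l ^ (n : ℝ) := Real.rpow_pos_of_pos hl _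
  have h3 : 0 < τ ^ (∑ i, μ i + (n : ℝ)) := Real.rpow_pos_of_pos hτ' _
  generalize ∏ i, x i ^ (μ i + 1 / 2) = P
  field_simp

lemma kernelN_nonneg {n : ℕ} (μ : Fin n → ℝ) {l : ℝ} (hl : 0 < l) {x : Fin n → ℝ}
    (hx : x ∈ orthant n) : 0 ≤ kernelN μ l x := by
  rw [kernelN_eq μ hl]
  exact setIntegral_nonneg measurableSet_Ioi fun τ hτ =>
    mul_nonneg (Real.exp_pos _).le (gam_pos μ (fun _ => hτ) hx).le

lemma measurable_kernelN {n : ℕ} (μ : Fin n → ℝ) (l : ℝ) : Measurable (kernelN μ l) := by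
  have hN (ν : ℝ) : Measurable (calN ν) := by
    have : Measurable fun w : ℝ × ℝ => Real.exp (-w.2 - w.1 ^ 2 / (4 * w.2)) / w.2 ^ (ν + 1) :=
      Measurable.div (by fun_prop) (measurable_snd.pow_const _)
    exact (this.stronglyMeasurable.integral_prod_right' (ν := volume.restrict (Ioi 0))).measurable
  unfold kernelN
  refine Measurable.mul (Measurable.mul_const (Measurable.mul_const (Measurable.const_mul
    (measurable_powW μ) _) _) _) ((hN _).comp ?_)
  unfold normSq
  exact (Finset.measurable_sum _ fun i _ =>
    ((measurable_pi_apply i).const_mul _).pow_const 2).sqrt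

lemma lintegral_exp_neg_mul {l : ℝ} (hl : 0 < l) :
    ∫⁻ τ in Ioi (0 : ℝ), ENNReal.ofReal (Real.exp (-(l * τ))) = ENNReal.ofReal l⁻¹ := by
  have h := integral_exp_mul_Ioi (a := -l) (by linarith) 0
  have hi := integrableOn_exp_mul_Ioi (a := -l) (by linarith) 0
  simp only [neg_mul] at h hi
  rw [← ofReal_integral_eq_lintegral_ofReal hi
    (Filter.Eventually.of_forall fun _ => (Real.exp_pos _).le), h]
  simp

lemma measurable_exp_gam_const {n : ℕ} (μ : Fin n → ℝ) (l : ℝ) :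
    Measurable fun w : ℝ × (Fin n → ℝ) =>
      ENNReal.ofReal (Real.exp (-(l * w.1))) * ENNReal.ofReal (gam μ (fun _ => w.1) w.2) :=
  (by fun_prop : Measurable fun w : ℝ × (Fin n → ℝ) =>
    ENNReal.ofReal (Real.exp (-(l * w.1)))).mul (measurable_gam_const μ).ennreal_ofReal

/-- A divergent Bochner integral has the default value 0, so passing to the Lebesgue integral
requires finiteness. That holds almost everywhere because the integral of the right-hand side
against w is C_μ/λ. -/
lemma ofReal_kernelN_ae {n : ℕ} {μ : Fin n → ℝ} (hμ : ∀ i, -(1 / 2) < μ i) {l : ℝ} (hl : 0 < l) :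
    ∀ᵐ y ∂vol n, ENNReal.ofReal (kernelN μ l y) = ∫⁻ τ in Ioi (0 : ℝ),
      ENNReal.ofReal (Real.exp (-(l * τ))) * ENNReal.ofReal (gam μ (fun _ => τ) y) := by
  have hm := measurable_exp_gam_const μ l
  have hfin : ∫⁻ y, ENNReal.ofReal (powW μ y) * (∫⁻ τ in Ioi (0 : ℝ),
      ENNReal.ofReal (Real.exp (-(l * τ))) * ENNReal.ofReal (gam μ (fun _ => τ) y)) ∂vol n
      ≠ ⊤ := by
    have h1 (y : Fin n → ℝ) : ENNReal.ofReal (powW μ y) * ∫⁻ τ in Ioi (0 : ℝ),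
        ENNReal.ofReal (Real.exp (-(l * τ))) * ENNReal.ofReal (gam μ (fun _ => τ) y)
        = ∫⁻ τ in Ioi (0 : ℝ), ENNReal.ofReal (Real.exp (-(l * τ)))
          * (ENNReal.ofReal (powW μ y) * ENNReal.ofReal (gam μ (fun _ => τ) y)) := by
      rw [← lintegral_const_mul' _ _ ENNReal.ofReal_ne_top]
      exact lintegral_congr fun τ => by ring
    have h2 : ∀ τ ∈ Ioi (0 : ℝ), ∫⁻ y, ENNReal.ofReal (Real.exp (-(l * τ)))
          * (ENNReal.ofReal (powW μ y) * ENNReal.ofReal (gam μ (fun _ => τ) y)) ∂vol n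
        = ENNReal.ofReal (Real.exp (-(l * τ))) * ENNReal.ofReal (constC μ) := by
      intro τ hτ
      rw [lintegral_const_mul' _ _ ENNReal.ofReal_ne_top,
        lintegral_powW_mul_gam hμ fun _ => hτ]
    simp_rw [h1]
    rw [lintegral_lintegral_swap, setLIntegral_congr_fun measurableSet_Ioi h2,
      lintegral_mul_const' _ _ ENNReal.ofReal_ne_top, lintegral_exp_neg_mul hl]
    · exact ENNReal.mul_ne_top ENNReal.ofReal_ne_top ENNReal.ofReal_ne_top
    · have : Measurable fun w : (Fin n → ℝ) × ℝ => ENNReal.ofReal (powW μ w.1) *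
          (ENNReal.ofReal (Real.exp (-(l * w.2))) * ENNReal.ofReal (gam μ (fun _ => w.2) w.1)) :=
        ((measurable_powW μ).comp measurable_fst).ennreal_ofReal.mul (hm.comp measurable_swap)
      convert this.aemeasurable using 1
      ext w
      simp only [Function.uncurry]
      ring
  have hae := ae_lt_top' (Measurable.mul (measurable_powW μ).ennreal_ofReal
    (hm.comp measurable_swap).lintegral_prod_right').aemeasurable hfin
  filter_upwards [hae, ae_mem_orthant n] with y hy hyo
  have hy' : ∫⁻ τ in Ioi (0 : ℝ),
      ENNReal.ofReal (Real.exp (-(l * τ))) * ENNReal.ofReal (gam μ (fun _ => τ) y) < ⊤ := by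
    refine lt_top_iff_ne_top.2 fun h => hy.ne ?_
    rw [Pi.mul_apply]
    refine (congrArg _ h).trans (ENNReal.mul_top ?_)
    simpa using powW_pos μ hyo
  have hpos : ∀ᵐ τ ∂(volume : Measure ℝ).restrict (Ioi 0),
      0 ≤ Real.exp (-(l * τ)) * gam μ (fun _ => τ) y := by
    filter_upwards [ae_restrict_mem measurableSet_Ioi] with τ hτ
    exact mul_nonneg (Real.exp_pos _).le (gam_pos μ (fun _ => hτ) hyo).le
  have hmy : Measurable fun τ => Real.exp (-(l * τ)) * gam μ (fun _ => τ) y :=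
    Measurable.mul (by fun_prop)
      ((measurable_gam_const μ).comp (measurable_id.prodMk measurable_const))
  simp_rw [← ENNReal.ofReal_mul (Real.exp_pos _).le] at hy' ⊢
  rw [kernelN_eq μ hl, ofReal_integral_eq_lintegral_ofReal _ hpos]
  refine ⟨hmy.aestronglyMeasurable, ?_⟩
  rw [hasFiniteIntegral_iff_ofReal hpos]
  exact hy'

/-- The kernel `∫ D_μ(x,y,z) N_λ(y) dy` of the resolvent, with values in `[0,∞]`. -/
noncomputable def kerE {n : ℕ} (μ : Fin n → ℝ) (l : ℝ) (x z : Fin n → ℝ) : ℝ≥0∞ :=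
  ∫⁻ y, ENNReal.ofReal (kernelD μ x y z) * ENNReal.ofReal (kernelN μ l y) ∂vol n

/-- The kernel `∫ D_μ(x,y,z) N_λ(y) dy` of the resolvent. -/
noncomputable def kerR {n : ℕ} (μ : Fin n → ℝ) (l : ℝ) (x z : Fin n → ℝ) : ℝ :=
  ∫ y, kernelD μ x y z * kernelN μ l y ∂vol n

lemma kerE_swap {n : ℕ} (μ : Fin n → ℝ) (l : ℝ) (x z : Fin n → ℝ) :
    kerE μ l x z = kerE μ l z x := by
  unfold kerE
  simp_rw [kernelD_swap μ x _ z]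

lemma kerR_swap {n : ℕ} (μ : Fin n → ℝ) (l : ℝ) (x z : Fin n → ℝ) :
    kerR μ l x z = kerR μ l z x := by
  unfold kerR
  simp_rw [kernelD_swap μ x _ z]

lemma measurable_kernelD_mul_kernelN {n : ℕ} (μ : Fin n → ℝ) (l : ℝ) :
    Measurable fun w : ((Fin n → ℝ) × (Fin n → ℝ)) × (Fin n → ℝ) =>
      kernelD μ w.1.1 w.2 w.1.2 * kernelN μ l w.2 :=
  ((measurable_kernelD μ).comp ((measurable_fst.comp measurable_fst).prodMk
    (measurable_snd.prodMk (measurable_snd.comp measurable_fst)))).mul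
    ((measurable_kernelN μ l).comp measurable_snd)

lemma measurable_kernelD_mul_kernelN_ofReal {n : ℕ} (μ : Fin n → ℝ) (l : ℝ) :
    Measurable fun w : ((Fin n → ℝ) × (Fin n → ℝ)) × (Fin n → ℝ) =>
      ENNReal.ofReal (kernelD μ w.1.1 w.2 w.1.2) * ENNReal.ofReal (kernelN μ l w.2) :=
  ((measurable_kernelD μ).comp ((measurable_fst.comp measurable_fst).prodMk
    (measurable_snd.prodMk (measurable_snd.comp measurable_fst)))).ennreal_ofReal.mul
    ((measurable_kernelN μ l).comp measurable_snd).ennreal_ofReal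

lemma measurable_kerE {n : ℕ} (μ : Fin n → ℝ) (l : ℝ) :
    Measurable fun w : (Fin n → ℝ) × (Fin n → ℝ) => kerE μ l w.1 w.2 :=
  (measurable_kernelD_mul_kernelN_ofReal μ l).lintegral_prod_right'

lemma measurable_kerE_right {n : ℕ} (μ : Fin n → ℝ) (l : ℝ) (x : Fin n → ℝ) :
    Measurable (kerE μ l x) :=
  Measurable.of_uncurry_left (f := kerE μ l) (measurable_kerE μ l)

lemma measurable_kerR {n : ℕ} (μ : Fin n → ℝ) (l : ℝ) :
    Measurable fun w : (Fin n → ℝ) × (Fin n → ℝ) => kerR μ l w.1 w.2 :=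
  (measurable_kernelD_mul_kernelN μ l).stronglyMeasurable.integral_prod_right'.measurable

lemma enorm_kernelD_mul_kernelN {n : ℕ} {μ x y z : Fin n → ℝ} {l : ℝ} (hl : 0 < l)
    (hμ : ∀ i, -(1 / 2) < μ i) (hx : x ∈ orthant n) (hy : y ∈ orthant n) (hz : z ∈ orthant n) :
    ‖kernelD μ x y z * kernelN μ l y‖ₑ
      = ENNReal.ofReal (kernelD μ x y z) * ENNReal.ofReal (kernelN μ l y) := by
  rw [enorm_mul, Real.enorm_of_nonneg (kernelD_nonneg hμ hx hy hz),
    Real.enorm_of_nonneg (kernelN_nonneg μ hl hy)]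

lemma enorm_kerR_le {n : ℕ} {μ x z : Fin n → ℝ} {l : ℝ} (hl : 0 < l)
    (hμ : ∀ i, -(1 / 2) < μ i) (hx : x ∈ orthant n) (hz : z ∈ orthant n) :
    ‖kerR μ l x z‖ₑ ≤ kerE μ l x z := by
  refine (enorm_integral_le_lintegral_enorm _).trans (lintegral_mono_ae ?_)
  filter_upwards [ae_mem_orthant n] with y hy
  rw [enorm_kernelD_mul_kernelN hl hμ hx hy hz]

/-- Tonelli brings the Laplace variable outermost, so that the explicit formulas for v = w and v =
G_σ can be applied at each fixed τ. -/
lemma lintegral_kerE_mul {n : ℕ} {μ : Fin n → ℝ} (hμ : ∀ i, -(1 / 2) < μ i) {l : ℝ} (hl : 0 < l)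
    (x : Fin n → ℝ) {v : (Fin n → ℝ) → ℝ≥0∞} (hv : Measurable v) :
    ∫⁻ z, kerE μ l x z * v z ∂vol n
      = ∫⁻ τ in Ioi (0 : ℝ), ENNReal.ofReal (Real.exp (-(l * τ))) * ∫⁻ y, ∫⁻ z,
        ENNReal.ofReal (kernelD μ x y z) * ENNReal.ofReal (gam μ (fun _ => τ) y) * v z
          ∂vol n ∂vol n := by
  have hm := measurable_exp_gam_const μ l
  have hD : Measurable fun w : (Fin n → ℝ) × (Fin n → ℝ) => ENNReal.ofReal (kernelD μ x w.1 w.2) :=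
    ((measurable_kernelD μ).comp (measurable_const.prodMk measurable_id)).ennreal_ofReal
  have hN := (measurable_kernelN μ l).ennreal_ofReal
  have hDv : Measurable fun y => ∫⁻ z, ENNReal.ofReal (kernelD μ x y z) * v z ∂vol n :=
    (hD.mul (hv.comp measurable_snd)).lintegral_prod_right'
  calc _ = ∫⁻ z, ∫⁻ y, ENNReal.ofReal (kernelN μ l y)
          * (ENNReal.ofReal (kernelD μ x y z) * v z) ∂vol n ∂vol n := by
        refine lintegral_congr fun z => ?_
        rw [kerE, ← lintegral_mul_const]
        · exact lintegral_congr fun y => by ring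
        · exact (hD.comp (measurable_id.prodMk measurable_const)).mul hN
    _ = ∫⁻ y, ∫⁻ z, ENNReal.ofReal (kernelN μ l y)
          * (ENNReal.ofReal (kernelD μ x y z) * v z) ∂vol n ∂vol n := by
        refine lintegral_lintegral_swap (Measurable.aemeasurable ?_)
        exact (hN.comp measurable_snd).mul
          ((hD.comp measurable_swap).mul (hv.comp measurable_fst))
    _ = ∫⁻ y, (∫⁻ τ in Ioi (0 : ℝ), ENNReal.ofReal (Real.exp (-(l * τ)))
          * ENNReal.ofReal (gam μ (fun _ => τ) y)
          * ∫⁻ z, ENNReal.ofReal (kernelD μ x y z) * v z ∂vol n) ∂vol n := by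
        refine lintegral_congr_ae ?_
        filter_upwards [ofReal_kernelN_ae hμ hl] with y hy
        rw [lintegral_const_mul' _ _ ENNReal.ofReal_ne_top, hy, lintegral_mul_const]
        exact hm.comp (measurable_id.prodMk measurable_const)
    _ = ∫⁻ τ in Ioi (0 : ℝ), ∫⁻ y, ENNReal.ofReal (Real.exp (-(l * τ)))
          * ENNReal.ofReal (gam μ (fun _ => τ) y)
          * ∫⁻ z, ENNReal.ofReal (kernelD μ x y z) * v z ∂vol n ∂vol n := by
        refine lintegral_lintegral_swap (Measurable.aemeasurable ?_)
        exact (hm.comp measurable_swap).mul (hDv.comp measurable_fst)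
    _ = _ := by
        refine lintegral_congr fun τ => ?_
        rw [← lintegral_const_mul' _ _ ENNReal.ofReal_ne_top]
        refine lintegral_congr fun y => ?_
        rw [mul_assoc, ← lintegral_const_mul' _ _ ENNReal.ofReal_ne_top]
        congr 1
        exact lintegral_congr fun z => by ring

/-- Invariance of w under each heat kernel, integrated against e^{-λτ}. This Markov property is the
source of every norm estimate. -/
lemma lintegral_kerE_powW {n : ℕ} {μ : Fin n → ℝ} (hμ : ∀ i, -(1 / 2) < μ i) {l : ℝ} (hl : 0 < l)
    {x : Fin n → ℝ} (hx : x ∈ orthant n) :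
    ∫⁻ z, kerE μ l x z * ENNReal.ofReal (powW μ z) ∂vol n
      = ENNReal.ofReal l⁻¹ * ENNReal.ofReal (powW μ x) := by
  rw [lintegral_kerE_mul hμ hl x (measurable_powW μ).ennreal_ofReal, ← lintegral_exp_neg_mul hl,
    ← lintegral_mul_const' _ _ ENNReal.ofReal_ne_top]
  refine setLIntegral_congr_fun measurableSet_Ioi fun τ hτ => ?_
  rw [lintegral_kernelD_gam_powW hμ (fun _ => hτ) hx]

lemma lintegral_kerE_gam {n : ℕ} {μ : Fin n → ℝ} (hμ : ∀ i, -(1 / 2) < μ i) {l : ℝ} (hl : 0 < l)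
    {σ : Fin n → ℝ} (hσ : ∀ i, 0 < σ i) {x : Fin n → ℝ} (hx : x ∈ orthant n) :
    ∫⁻ z, kerE μ l x z * ENNReal.ofReal (gam μ σ z) ∂vol n
      = ∫⁻ τ in Ioi (0 : ℝ), ENNReal.ofReal (Real.exp (-(l * τ)))
        * ENNReal.ofReal (gam μ (fun i => σ i + τ) x) := by
  rw [lintegral_kerE_mul hμ hl x (measurable_gam μ σ).ennreal_ofReal]
  refine setLIntegral_congr_fun measurableSet_Ioi fun τ hτ => ?_
  rw [lintegral_kernelD_gam_gam hμ (fun _ => hτ) hσ hx]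

/-! ### Hankel convolution with the resolvent kernel -/

section Conv

variable {n : ℕ} {μ : Fin n → ℝ} {l : ℝ} {f : (Fin n → ℝ) → ℂ}

lemma aestronglyMeasurable_convIntegrand (hf : AEStronglyMeasurable f (vol n)) (x : Fin n → ℝ) :
    AEStronglyMeasurable (convIntegrand μ (fun y => (kernelN μ l y : ℂ)) f x)
      ((vol n).prod (vol n)) := by
  unfold convIntegrand
  refine AEStronglyMeasurable.mul (Measurable.aestronglyMeasurable ?_) hf.comp_snd
  exact (Complex.measurable_ofReal.comp ((measurable_kernelD μ).comp
    (measurable_const.prodMk measurable_id))).mul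
    (Complex.measurable_ofReal.comp ((measurable_kernelN μ l).comp measurable_fst))

lemma lintegral_enorm_convIntegrand (hμ : ∀ i, -(1 / 2) < μ i) (hl : 0 < l)
    (hf : AEStronglyMeasurable f (vol n)) {x : Fin n → ℝ} (hx : x ∈ orthant n) :
    ∫⁻ w, ‖convIntegrand μ (fun y => (kernelN μ l y : ℂ)) f x w‖ₑ ∂(vol n).prod (vol n)
      = ∫⁻ z, kerE μ l x z * ‖f z‖ₑ ∂vol n := by
  rw [lintegral_prod_symm _ (aestronglyMeasurable_convIntegrand hf x).enorm]
  refine lintegral_congr_ae ?_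
  filter_upwards [ae_mem_orthant n] with z hz
  rw [kerE, ← lintegral_mul_const' _ _ enorm_ne_top]
  refine lintegral_congr_ae ?_
  filter_upwards [ae_mem_orthant n] with y hy
  rw [← enorm_kernelD_mul_kernelN hl hμ hx hy hz, convIntegrand, enorm_mul, ← Complex.ofReal_mul]
  congr 1
  rw [← ofReal_norm, ← ofReal_norm, Complex.norm_real]

lemma enorm_hankelConv_le (hμ : ∀ i, -(1 / 2) < μ i) (hl : 0 < l)
    (hf : AEStronglyMeasurable f (vol n)) {x : Fin n → ℝ} (hx : x ∈ orthant n) :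
    ‖hankelConv μ (fun y => (kernelN μ l y : ℂ)) f x‖ₑ ≤ ∫⁻ z, kerE μ l x z * ‖f z‖ₑ ∂vol n :=
  (enorm_integral_le_lintegral_enorm _).trans
    (lintegral_enorm_convIntegrand hμ hl hf hx).le

lemma integrable_convIntegrand (hμ : ∀ i, -(1 / 2) < μ i) (hl : 0 < l)
    (hf : AEStronglyMeasurable f (vol n)) {x : Fin n → ℝ} (hx : x ∈ orthant n)
    (h : ∫⁻ z, kerE μ l x z * ‖f z‖ₑ ∂vol n < ⊤) :
    Integrable (convIntegrand μ (fun y => (kernelN μ l y : ℂ)) f x) ((vol n).prod (vol n)) :=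
  ⟨aestronglyMeasurable_convIntegrand hf x, by
    rw [hasFiniteIntegral_iff_enorm, lintegral_enorm_convIntegrand hμ hl hf hx]; exact h⟩

lemma hankelConv_eq (hμ : ∀ i, -(1 / 2) < μ i) (hl : 0 < l)
    (hf : AEStronglyMeasurable f (vol n)) {x : Fin n → ℝ} (hx : x ∈ orthant n)
    (h : ∫⁻ z, kerE μ l x z * ‖f z‖ₑ ∂vol n < ⊤) :
    hankelConv μ (fun y => (kernelN μ l y : ℂ)) f x = ∫ z, (kerR μ l x z : ℂ) * f z ∂vol n := by
  rw [hankelConv, integral_prod_symm _ (integrable_convIntegrand hμ hl hf hx h)]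
  refine integral_congr_ae (Filter.Eventually.of_forall fun z => ?_)
  simp only [convIntegrand]
  rw [integral_mul_const, kerR, ← integral_complex_ofReal]
  simp

lemma aestronglyMeasurable_hankelConv (hf : AEStronglyMeasurable f (vol n)) :
    AEStronglyMeasurable (hankelConv μ (fun y => (kernelN μ l y : ℂ)) f) (vol n) := by
  unfold hankelConv
  refine AEStronglyMeasurable.integral_prod_right' (ν := (vol n).prod (vol n))
    (f := fun w : (Fin n → ℝ) × (Fin n → ℝ) × (Fin n → ℝ) =>
      convIntegrand μ (fun y => (kernelN μ l y : ℂ)) f w.1 w.2) ?_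
  unfold convIntegrand
  refine AEStronglyMeasurable.mul (Measurable.aestronglyMeasurable ?_) hf.comp_snd.comp_snd
  exact (Complex.measurable_ofReal.comp (measurable_kernelD μ)).mul
    (Complex.measurable_ofReal.comp ((measurable_kernelN μ l).comp
      (measurable_fst.comp measurable_snd)))

end Conv


/-! ### The dual classes L¹(w dx) + w L^∞ and L¹(w dx) ∩ w L^∞ -/

section Classes

variable {n : ℕ} {μ : Fin n → ℝ} {l : ℝ} {f g : (Fin n → ℝ) → ℂ}

/-- Membership in `L¹(w dx) + w L^∞`. -/
def InSum (μ : Fin n → ℝ) (f : (Fin n → ℝ) → ℂ) : Prop :=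
  AEStronglyMeasurable f (vol n) ∧ ∃ (C : ℝ≥0) (h : (Fin n → ℝ) → ℝ≥0∞),
    AEMeasurable h (vol n) ∧ ∫⁻ x, ENNReal.ofReal (powW μ x) * h x ∂vol n < ⊤ ∧
    ∀ᵐ x ∂vol n, ‖f x‖ₑ ≤ C * ENNReal.ofReal (powW μ x) + h x

/-- Membership in `L¹(w dx) ∩ w L^∞`. -/
def InInter (μ : Fin n → ℝ) (f : (Fin n → ℝ) → ℂ) : Prop :=
  AEStronglyMeasurable f (vol n) ∧
    (∃ C : ℝ≥0, ∀ᵐ x ∂vol n, ‖f x‖ₑ ≤ C * ENNReal.ofReal (powW μ x)) ∧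
    ∫⁻ x, ENNReal.ofReal (powW μ x) * ‖f x‖ₑ ∂vol n < ⊤

lemma InInter.inSum (hf : InInter μ f) : InSum μ f := by
  obtain ⟨h1, ⟨C, hC⟩, -⟩ := hf
  exact ⟨h1, C, 0, aemeasurable_const, by simp, by simpa using hC⟩

lemma InInter.add (hf : InInter μ f) (hg : InInter μ g) : InInter μ (f + g) := by
  obtain ⟨f1, ⟨C, hC⟩, f2⟩ := hf
  obtain ⟨g1, ⟨D, hD⟩, g2⟩ := hg
  refine ⟨f1.add g1, ⟨C + D, ?_⟩, ?_⟩
  · filter_upwards [hC, hD] with x h1 h2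
    refine (enorm_add_le _ _).trans ((add_le_add h1 h2).trans ?_)
    rw [ENNReal.coe_add, add_mul]
  · refine lt_of_le_of_lt (lintegral_mono fun x => mul_le_mul_right (enorm_add_le _ _) _) ?_
    have hm : AEMeasurable (fun x => ENNReal.ofReal (powW μ x) * ‖f x‖ₑ) (vol n) :=
      (measurable_powW μ).ennreal_ofReal.aemeasurable.mul f1.enorm
    simp_rw [mul_add]
    rw [lintegral_add_left' hm]
    exact ENNReal.add_lt_top.2 ⟨f2, g2⟩

lemma InInter.const_smul (hf : InInter μ f) (c : ℂ) : InInter μ (c • f) := by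
  obtain ⟨f1, ⟨C, hC⟩, f2⟩ := hf
  refine ⟨f1.const_smul c, ⟨‖c‖₊ * C, ?_⟩, ?_⟩
  · filter_upwards [hC] with x hx
    rw [Pi.smul_apply, enorm_smul, ENNReal.coe_mul, mul_assoc]
    exact mul_le_mul_right hx _
  · simp_rw [Pi.smul_apply, enorm_smul, mul_left_comm _ ‖c‖ₑ]
    rw [lintegral_const_mul' _ _ enorm_ne_top]
    exact ENNReal.mul_lt_top enorm_lt_top f2

lemma InInter.sub (hf : InInter μ f) (hg : InInter μ g) : InInter μ (f - g) := by
  have := hf.add (hg.const_smul (-1))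
  rwa [neg_one_smul, ← sub_eq_add_neg] at this

/-- A uniform bound for the pairing of the two classes. -/
lemma InSum.exists_bound (hf : InSum μ f) : ∃ A B : ℝ≥0, ∀ (C : ℝ≥0) (g : (Fin n → ℝ) → ℝ≥0∞),
    AEMeasurable g (vol n) → (∀ᵐ x ∂vol n, g x ≤ C * ENNReal.ofReal (powW μ x)) →
    ∫⁻ x, ‖f x‖ₑ * g x ∂vol n
      ≤ A * ∫⁻ x, ENNReal.ofReal (powW μ x) * g x ∂vol n + B * C := by
  obtain ⟨f1, A, h, hm, hh, hle⟩ := hf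
  -- The part A w of f is paired with the w-mass of g, and the part h with the bound g ≤ C w. The
  -- constants do not depend on g, so the estimate can be used uniformly along the heat flow.
  refine ⟨A, (∫⁻ x, ENNReal.ofReal (powW μ x) * h x ∂vol n).toNNReal, fun C g hg hgC => ?_⟩
  rw [ENNReal.coe_toNNReal hh.ne, ← lintegral_mul_const' _ _ ENNReal.coe_ne_top,
    ← lintegral_const_mul' _ _ ENNReal.coe_ne_top, ← lintegral_add_left']
  · refine lintegral_mono_ae ?_
    filter_upwards [hle, hgC] with x h1 h2
    calc ‖f x‖ₑ * g x ≤ (A * ENNReal.ofReal (powW μ x) + h x) * g x := mul_le_mul_left h1 _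
      _ = A * (ENNReal.ofReal (powW μ x) * g x) + h x * g x := by ring
      _ ≤ A * (ENNReal.ofReal (powW μ x) * g x) + h x * (C * ENNReal.ofReal (powW μ x)) :=
        add_le_add le_rfl (mul_le_mul_right h2 _)
      _ = _ := by ring
  · exact ((measurable_powW μ).ennreal_ofReal.aemeasurable.mul hg).const_mul _

lemma InSum.lintegral_mul_lt_top (hf : InSum μ f) (hg : InInter μ g) :
    ∫⁻ x, ‖f x‖ₑ * ‖g x‖ₑ ∂vol n < ⊤ := by
  obtain ⟨A, B, h⟩ := hf.exists_bound
  obtain ⟨g1, ⟨C, hC⟩, g2⟩ := hg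
  exact lt_of_le_of_lt (h C _ g1.enorm hC) (ENNReal.add_lt_top.2
    ⟨ENNReal.mul_lt_top ENNReal.coe_lt_top g2,
      ENNReal.mul_lt_top ENNReal.coe_lt_top ENNReal.coe_lt_top⟩)

lemma InSum.integrable_mul (hf : InSum μ f) (hg : InInter μ g) :
    Integrable (fun x => f x * g x) (vol n) := by
  refine ⟨hf.1.mul hg.1, ?_⟩
  rw [hasFiniteIntegral_iff_enorm]
  simpa only [enorm_mul] using hf.lintegral_mul_lt_top hg

lemma lintegral_kerE_swap {u v : (Fin n → ℝ) → ℝ≥0∞} (hu : AEMeasurable u (vol n))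
    (hv : AEMeasurable v (vol n)) :
    ∫⁻ x, u x * ∫⁻ z, kerE μ l x z * v z ∂vol n ∂vol n
      = ∫⁻ z, v z * ∫⁻ x, kerE μ l z x * u x ∂vol n ∂vol n := by
  have hK := measurable_kerE μ l
  have h1 (x : Fin n → ℝ) : u x * ∫⁻ z, kerE μ l x z * v z ∂vol n
      = ∫⁻ z, u x * (kerE μ l x z * v z) ∂vol n := by
    rw [lintegral_const_mul'']
    exact (measurable_kerE_right μ l _).aemeasurable.mul hv
  have h2 (z : Fin n → ℝ) : v z * ∫⁻ x, kerE μ l z x * u x ∂vol n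
      = ∫⁻ x, u x * (kerE μ l x z * v z) ∂vol n := by
    rw [← lintegral_const_mul'']
    · refine lintegral_congr fun x => ?_
      rw [kerE_swap μ l z x]
      ring
    · exact (measurable_kerE_right μ l _).aemeasurable.mul hu
  simp_rw [h1, h2]
  refine lintegral_lintegral_swap ?_
  exact (hu.comp_quasiMeasurePreserving Measure.quasiMeasurePreserving_fst).mul
    (hK.aemeasurable.mul (hv.comp_quasiMeasurePreserving Measure.quasiMeasurePreserving_snd))

variable (hμ : ∀ i, -(1 / 2) < μ i) (hl : 0 < l)
include hμ hl

/-- The kernel is positive, so domination by w is preserved, up to the factor 1/λ. -/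
lemma lintegral_kerE_le {u : (Fin n → ℝ) → ℝ≥0∞} {C : ℝ≥0∞}
    (h : ∀ᵐ z ∂vol n, u z ≤ C * ENNReal.ofReal (powW μ z)) {x : Fin n → ℝ} (hx : x ∈ orthant n) :
    ∫⁻ z, kerE μ l x z * u z ∂vol n ≤ C * ENNReal.ofReal l⁻¹ * ENNReal.ofReal (powW μ x) := by
  have hm : Measurable fun z => kerE μ l x z * ENNReal.ofReal (powW μ z) :=
    (measurable_kerE_right μ l x).mul
      (measurable_powW μ).ennreal_ofReal
  rw [mul_assoc, ← lintegral_kerE_powW hμ hl hx, ← lintegral_const_mul _ hm]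
  refine lintegral_mono_ae ?_
  filter_upwards [h] with z hz
  calc _ ≤ kerE μ l x z * (C * ENNReal.ofReal (powW μ z)) := mul_le_mul_right hz _
    _ = _ := by ring

/-- The Markov property transposed: by symmetry of the kernel, the w-mass is multiplied exactly by
1/λ. -/
lemma lintegral_powW_kerE {u : (Fin n → ℝ) → ℝ≥0∞} (hu : AEMeasurable u (vol n)) :
    ∫⁻ x, ENNReal.ofReal (powW μ x) * ∫⁻ z, kerE μ l x z * u z ∂vol n ∂vol n
      = ENNReal.ofReal l⁻¹ * ∫⁻ x, ENNReal.ofReal (powW μ x) * u x ∂vol n := by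
  rw [lintegral_kerE_swap (measurable_powW μ).ennreal_ofReal.aemeasurable hu,
    ← lintegral_const_mul' _ _ ENNReal.ofReal_ne_top]
  refine lintegral_congr_ae ?_
  filter_upwards [ae_mem_orthant n] with x hx
  rw [lintegral_kerE_powW hμ hl hx]
  ring

/-- The part of f dominated by w gives a finite value at every point of the orthant. The part in
L¹(w dx) gives a function of finite w-mass, hence one finite almost everywhere. -/
lemma InSum.ae_lintegral_kerE_lt_top (hf : InSum μ f) :
    ∀ᵐ x ∂vol n, ∫⁻ z, kerE μ l x z * ‖f z‖ₑ ∂vol n < ⊤ := by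
  obtain ⟨f1, A, h, hm, hh, hle⟩ := hf
  have hK := measurable_kerE μ l
  have hfin : ∫⁻ x, ENNReal.ofReal (powW μ x) * ∫⁻ z, kerE μ l x z * h z ∂vol n ∂vol n ≠ ⊤ := by
    rw [lintegral_powW_kerE hμ hl hm]
    exact ENNReal.mul_ne_top ENNReal.ofReal_ne_top hh.ne
  have hmeas : AEMeasurable (fun x => ∫⁻ z, kerE μ l x z * h z ∂vol n) (vol n) :=
    (hK.aemeasurable.mul (hm.comp_quasiMeasurePreserving
      Measure.quasiMeasurePreserving_snd)).lintegral_prod_right'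
  have hmeas' : AEMeasurable
      (fun x => ENNReal.ofReal (powW μ x) * ∫⁻ z, kerE μ l x z * h z ∂vol n) (vol n) :=
    (measurable_powW μ).ennreal_ofReal.aemeasurable.mul hmeas
  filter_upwards [ae_lt_top' hmeas' hfin, ae_mem_orthant n] with x hx hxo
  have h1 : ∫⁻ z, kerE μ l x z * h z ∂vol n < ⊤ := by
    refine lt_top_iff_ne_top.2 fun h0 => hx.ne ?_
    rw [h0]
    refine ENNReal.mul_top ?_
    simpa using powW_pos μ hxo
  calc ∫⁻ z, kerE μ l x z * ‖f z‖ₑ ∂vol n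
      ≤ ∫⁻ z, (kerE μ l x z * (A * ENNReal.ofReal (powW μ z)) + kerE μ l x z * h z) ∂vol n := by
        refine lintegral_mono_ae ?_
        filter_upwards [hle] with z hz
        rw [← mul_add]
        exact mul_le_mul_right hz _
    _ = ∫⁻ z, kerE μ l x z * (A * ENNReal.ofReal (powW μ z)) ∂vol n
        + ∫⁻ z, kerE μ l x z * h z ∂vol n :=
        lintegral_add_left ((measurable_kerE_right μ l x).mul ((measurable_powW μ).ennreal_ofReal.const_mul _)) _
    _ < ⊤ := by
        refine ENNReal.add_lt_top.2 ⟨lt_of_le_of_lt (lintegral_kerE_le hμ hl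
          (Filter.Eventually.of_forall fun _ => le_rfl) hxo) ?_, h1⟩
        exact ENNReal.mul_lt_top (ENNReal.mul_lt_top ENNReal.coe_lt_top ENNReal.ofReal_lt_top)
          ENNReal.ofReal_lt_top

lemma InInter.hankelConv (hf : InInter μ f) :
    InInter μ (hankelConv μ (fun y => (kernelN μ l y : ℂ)) f) := by
  obtain ⟨f1, ⟨C, hC⟩, f2⟩ := hf
  refine ⟨aestronglyMeasurable_hankelConv f1, ⟨C * l⁻¹.toNNReal, ?_⟩, ?_⟩
  · filter_upwards [ae_mem_orthant n] with x hx
    rw [ENNReal.coe_mul]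
    exact (enorm_hankelConv_le hμ hl f1 hx).trans (lintegral_kerE_le hμ hl hC hx)
  · refine lt_of_le_of_lt ?_ (ENNReal.mul_lt_top (a := ENNReal.ofReal l⁻¹)
      ENNReal.ofReal_lt_top f2)
    rw [← lintegral_powW_kerE hμ hl f1.enorm]
    refine lintegral_mono_ae ?_
    filter_upwards [ae_mem_orthant n] with x hx
    exact mul_le_mul_right (enorm_hankelConv_le hμ hl f1 hx) _

/-- Convolution with the resolvent kernel is symmetric. -/
lemma integral_hankelConv_mul (hf : InSum μ f) (hg : InInter μ g) :
    ∫ x, BesselOp.hankelConv μ (fun y => (kernelN μ l y : ℂ)) f x * g x ∂vol n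
      = ∫ x, f x * BesselOp.hankelConv μ (fun y => (kernelN μ l y : ℂ)) g x ∂vol n := by
  have hK := measurable_kerE μ l
  have hKR := (Complex.measurable_ofReal.comp (measurable_kerR μ l)).aestronglyMeasurable
    (μ := (vol n).prod (vol n))
  obtain ⟨A, B, hAB⟩ := hf.exists_bound
  -- Absolute convergence for Fubini: by symmetry the kernel is moved onto |g|, where it preserves
  -- both the w-bound and the finite w-mass, and the result is paired with |f|.
  have hfin : ∫⁻ x, ‖g x‖ₑ * ∫⁻ z, kerE μ l x z * ‖f z‖ₑ ∂vol n ∂vol n < ⊤ := by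
    rw [lintegral_kerE_swap hg.1.enorm hf.1.enorm]
    obtain ⟨g1, ⟨C, hC⟩, g2⟩ := hg
    refine lt_of_le_of_lt (hAB (C * l⁻¹.toNNReal) _ (hK.aemeasurable.mul
      (g1.enorm.comp_quasiMeasurePreserving
      Measure.quasiMeasurePreserving_snd)).lintegral_prod_right' ?_) ?_
    · filter_upwards [ae_mem_orthant n] with x hx
      rw [ENNReal.coe_mul]
      exact lintegral_kerE_le hμ hl hC hx
    · refine ENNReal.add_lt_top.2 ⟨ENNReal.mul_lt_top ENNReal.coe_lt_top ?_,
        ENNReal.mul_lt_top ENNReal.coe_lt_top ENNReal.coe_lt_top⟩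
      refine lt_of_eq_of_lt (lintegral_powW_kerE hμ hl g1.enorm) ?_
      exact ENNReal.mul_lt_top ENNReal.ofReal_lt_top g2
  have hint : Integrable (Function.uncurry fun x z => (kerR μ l x z : ℂ) * f z * g x)
      ((vol n).prod (vol n)) := by
    have hm : AEStronglyMeasurable (Function.uncurry fun x z => (kerR μ l x z : ℂ) * f z * g x)
        ((vol n).prod (vol n)) := (hKR.mul hf.1.comp_snd).mul hg.1.comp_fst
    refine ⟨hm, ?_⟩
    rw [hasFiniteIntegral_iff_enorm, lintegral_prod _ hm.enorm]
    refine lt_of_le_of_lt (lintegral_mono_ae ?_) hfin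
    filter_upwards [ae_mem_orthant n] with x hx
    rw [← lintegral_const_mul' _ _ enorm_ne_top]
    refine lintegral_mono_ae ?_
    filter_upwards [ae_mem_orthant n] with z hz
    simp only [Function.uncurry]
    rw [enorm_mul, enorm_mul, mul_comm]
    refine mul_le_mul_right (mul_le_mul_left (le_trans (le_of_eq ?_)
      (enorm_kerR_le hl hμ hx hz)) _) _
    rw [← ofReal_norm, ← ofReal_norm, Complex.norm_real]
  have e1 : ∫ x, BesselOp.hankelConv μ (fun y => (kernelN μ l y : ℂ)) f x * g x ∂vol n
      = ∫ x, ∫ z, (kerR μ l x z : ℂ) * f z * g x ∂vol n ∂vol n := by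
    refine integral_congr_ae ?_
    filter_upwards [hf.ae_lintegral_kerE_lt_top hμ hl, ae_mem_orthant n] with x hx hxo
    rw [hankelConv_eq hμ hl hf.1 hxo hx, integral_mul_const]
  have e2 : ∫ z, f z * BesselOp.hankelConv μ (fun y => (kernelN μ l y : ℂ)) g z ∂vol n
      = ∫ z, ∫ x, (kerR μ l x z : ℂ) * f z * g x ∂vol n ∂vol n := by
    refine integral_congr_ae ?_
    filter_upwards [hg.inSum.ae_lintegral_kerE_lt_top hμ hl, ae_mem_orthant n] with z hz hzo
    rw [hankelConv_eq hμ hl hg.1 hzo hz, ← integral_const_mul]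
    refine integral_congr_ae (Filter.Eventually.of_forall fun x => ?_)
    simp only [kerR_swap μ l z x]
    ring
  rw [e1, e2, integral_integral_swap hint]

end Classes

/-! ### Boundedness on the weighted Lebesgue spaces -/

section Bound

variable {n : ℕ} {μ : Fin n → ℝ} {l : ℝ} {f : (Fin n → ℝ) → ℂ} {p : ℝ≥0∞}

/-- Jensen's inequality for the resolvent kernel. -/
lemma lintegral_kerE_rpow_le (hμ : ∀ i, -(1 / 2) < μ i) (hl : 0 < l)
    (hf : AEStronglyMeasurable f (vol n)) {q : ℝ} (hq : 1 ≤ q) {x : Fin n → ℝ}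
    (hx : x ∈ orthant n) :
    (∫⁻ z, kerE μ l x z * ‖f z‖ₑ ∂vol n) ^ q
      ≤ (∫⁻ z, kerE μ l x z * (ENNReal.ofReal (powW μ z)
          * (ENNReal.ofReal (weightR μ z) * ‖f z‖ₑ) ^ q) ∂vol n)
        * (ENNReal.ofReal l⁻¹ * ENNReal.ofReal (powW μ x)) ^ (q - 1) := by
  have hq0 : 0 < q := by linarith
  have hden : Measurable fun z => kerE μ l x z * ENNReal.ofReal (powW μ z) :=
    (measurable_kerE_right μ l x).mul (measurable_powW μ).ennreal_ofReal
  -- The measure K(x,z) w(z) dz has total mass w(x)/λ; Hölder's inequality for u = r f against it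
  -- produces the power q - 1 of that mass.
  obtain ⟨ν, hν⟩ : ∃ ν, ν = (vol n).withDensity
    fun z => kerE μ l x z * ENNReal.ofReal (powW μ z) := ⟨_, rfl⟩
  obtain ⟨u, hu⟩ : ∃ u : (Fin n → ℝ) → ℂ, u = fun z => (weightR μ z : ℂ) * f z := ⟨_, rfl⟩
  have hum : AEStronglyMeasurable u (vol n) := by
    rw [hu]
    exact (Complex.measurable_ofReal.comp (measurable_weightR μ)).aestronglyMeasurable.mul hf
  have hun : ∀ z ∈ orthant n, ‖u z‖ₑ = ENNReal.ofReal (weightR μ z) * ‖f z‖ₑ := by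
    intro z hz
    rw [hu]
    simp only [enorm_mul]
    rw [← ofReal_norm, Complex.norm_real, Real.norm_of_nonneg (weightR_pos μ hz).le]
  have huniv : ν univ = ENNReal.ofReal l⁻¹ * ENNReal.ofReal (powW μ x) := by
    rw [hν, withDensity_apply _ MeasurableSet.univ, Measure.restrict_univ,
      lintegral_kerE_powW hμ hl hx]
  have humν : AEStronglyMeasurable u ν := by
    rw [hν]
    exact hum.mono_ac (withDensity_absolutelyContinuous _ _)
  have hJ := eLpNorm'_le_eLpNorm'_mul_rpow_measure_univ one_pos hq humν
  rw [eLpNorm'_eq_lintegral_enorm, eLpNorm'_eq_lintegral_enorm, huniv] at hJ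
  simp only [ENNReal.rpow_one, div_one] at hJ
  have i1 : ∫⁻ z, ‖u z‖ₑ ∂ν = ∫⁻ z, kerE μ l x z * ‖f z‖ₑ ∂vol n := by
    rw [hν, lintegral_withDensity_eq_lintegral_mul₀ hden.aemeasurable hum.enorm]
    refine lintegral_congr_ae ?_
    filter_upwards [ae_mem_orthant n] with z hz
    rw [Pi.mul_apply, hun z hz, mul_assoc, ← mul_assoc (ENNReal.ofReal (powW μ z)),
      ← ENNReal.ofReal_mul (powW_pos μ hz).le, powW_mul_weightR μ hz, ENNReal.ofReal_one, one_mul]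
  have i2 : ∫⁻ z, ‖u z‖ₑ ^ q ∂ν = ∫⁻ z, kerE μ l x z * (ENNReal.ofReal (powW μ z)
          * (ENNReal.ofReal (weightR μ z) * ‖f z‖ₑ) ^ q) ∂vol n := by
    rw [hν, lintegral_withDensity_eq_lintegral_mul₀ hden.aemeasurable (hum.enorm.pow_const _)]
    refine lintegral_congr_ae ?_
    filter_upwards [ae_mem_orthant n] with z hz
    rw [Pi.mul_apply, hun z hz, mul_assoc]
  rw [i1, i2] at hJ
  refine (ENNReal.rpow_le_rpow hJ hq0.le).trans (le_of_eq ?_)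
  rw [ENNReal.mul_rpow_of_nonneg _ _ hq0.le, ← ENNReal.rpow_mul, ← ENNReal.rpow_mul,
    one_div_mul_cancel hq0.ne', ENNReal.rpow_one]
  congr 2
  field_simp

/-- For p = ∞ this is domination by w. For finite p, Jensen's inequality contributes λ^{-(p-1)} and
the transposed Markov property contributes λ^{-1}; together they give λ^{-p} inside the p-th root.
-/
lemma wnorm_hankelConv_le (hμ : ∀ i, -(1 / 2) < μ i) (hl : 0 < l) (hp : 1 ≤ p)
    (hf : AEStronglyMeasurable f (vol n)) :
    wnorm μ p (hankelConv μ (fun y => (kernelN μ l y : ℂ)) f)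
      ≤ ENNReal.ofReal l⁻¹ * wnorm μ p f := by
  have hwr : ∀ x ∈ orthant n, ENNReal.ofReal (powW μ x) * ENNReal.ofReal (weightR μ x) = 1 := by
    intro x hx
    rw [← ENNReal.ofReal_mul (powW_pos μ hx).le, powW_mul_weightR μ hx, ENNReal.ofReal_one]
  unfold wnorm
  split_ifs with h
  · have hle := ENNReal.ae_le_essSup (μ := vol n)
      fun x => ENNReal.ofReal (weightR μ x) * ‖f x‖ₑ
    set M := essSup (fun x => ENNReal.ofReal (weightR μ x) * ‖f x‖ₑ) (vol n)
    have hle' : ∀ᵐ x ∂vol n, ‖f x‖ₑ ≤ M * ENNReal.ofReal (powW μ x) := by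
      filter_upwards [hle, ae_mem_orthant n] with x hx hxo
      calc ‖f x‖ₑ = ENNReal.ofReal (powW μ x) * ENNReal.ofReal (weightR μ x) * ‖f x‖ₑ := by
            rw [hwr x hxo, one_mul]
        _ ≤ ENNReal.ofReal (powW μ x) * M := by
            rw [mul_assoc]; exact mul_le_mul_right hx _
        _ = _ := mul_comm _ _
    refine essSup_le_of_ae_le _ ?_
    filter_upwards [ae_mem_orthant n] with x hx
    calc _ ≤ ENNReal.ofReal (weightR μ x)
          * (M * ENNReal.ofReal l⁻¹ * ENNReal.ofReal (powW μ x)) :=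
          mul_le_mul_right ((enorm_hankelConv_le hμ hl hf hx).trans
            (lintegral_kerE_le hμ hl hle' hx)) _
      _ = ENNReal.ofReal l⁻¹ * M
          * (ENNReal.ofReal (powW μ x) * ENNReal.ofReal (weightR μ x)) := by ring
      _ = _ := by rw [hwr x hx, mul_one]
  · set q := p.toReal
    have hq : 1 ≤ q := by
      rw [← ENNReal.toReal_one]
      exact ENNReal.toReal_mono h hp
    have hq0 : 0 < q := by linarith
    have hC := constC_pos hμ
    have hli : 0 < l⁻¹ := inv_pos.2 hl
    set U : (Fin n → ℝ) → ℝ≥0∞ := fun z => ENNReal.ofReal (powW μ z)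
      * (ENNReal.ofReal (weightR μ z) * ‖f z‖ₑ) ^ q with hU
    have hUm : AEMeasurable U (vol n) :=
      (measurable_powW μ).ennreal_ofReal.aemeasurable.mul
        (((measurable_weightR μ).ennreal_ofReal.aemeasurable.mul hf.enorm).pow_const _)
    -- Since r = 1/w and s = w²/C_μ, the power w^{q-1} left by Jensen's inequality reduces the
    -- weight s r^q to w/C_μ, the weight for which the kernel conserves mass.
    have hws : ∀ x ∈ orthant n, (powW μ x) ^ (q - 1) * (weightS μ x * weightR μ x ^ q)
        = (constC μ)⁻¹ * powW μ x := by
      intro x hx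
      have hw := powW_pos μ hx
      have hr : weightR μ x = (powW μ x)⁻¹ :=
        eq_inv_of_mul_eq_one_right (powW_mul_weightR μ hx)
      have hs : weightS μ x = (constC μ)⁻¹ * powW μ x ^ 2 := by
        rw [powW_sq hμ hx, inv_mul_cancel_left₀ hC.ne']
      rw [hr, hs, Real.inv_rpow hw.le, Real.rpow_sub_one hw.ne']
      have := Real.rpow_pos_of_pos hw q
      field_simp
    have hUs : ∀ x ∈ orthant n, ‖f x‖ₑ ^ q * ENNReal.ofReal (weightS μ x * weightR μ x ^ q)
        = ENNReal.ofReal (constC μ)⁻¹ * (ENNReal.ofReal (powW μ x) * U x) := by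
      intro x hx
      have hw := powW_pos μ hx
      have hr := weightR_pos μ hx
      have hs : weightS μ x = (constC μ)⁻¹ * (powW μ x * powW μ x) := by
        rw [← sq, powW_sq hμ hx, inv_mul_cancel_left₀ hC.ne']
      rw [hU, hs]
      simp only
      rw [ENNReal.mul_rpow_of_nonneg _ _ hq0.le, ENNReal.ofReal_rpow_of_pos hr,
        ENNReal.ofReal_mul (by positivity), ENNReal.ofReal_mul (by positivity),
        ENNReal.ofReal_mul hw.le]
      ring
    calc _ ≤ (∫⁻ x in orthant n, ENNReal.ofReal l⁻¹ ^ (q - 1) * (ENNReal.ofReal (constC μ)⁻¹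
          * (ENNReal.ofReal (powW μ x) * ∫⁻ z, kerE μ l x z * U z ∂vol n))) ^ (1 / q) := by
          refine ENNReal.rpow_le_rpow ?_ (by positivity)
          refine setLIntegral_mono_ae' (isOpen_orthant n).measurableSet
            (Filter.Eventually.of_forall fun x hx => ?_)
          have hw := powW_pos μ hx
          calc _ ≤ (∫⁻ z, kerE μ l x z * U z ∂vol n)
              * (ENNReal.ofReal l⁻¹ * ENNReal.ofReal (powW μ x)) ^ (q - 1)
              * ENNReal.ofReal (weightS μ x * weightR μ x ^ q) :=
                mul_le_mul_left ((ENNReal.rpow_le_rpow (enorm_hankelConv_le hμ hl hf hx)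
                  hq0.le).trans (lintegral_kerE_rpow_le hμ hl hf hq hx)) _
            _ = ENNReal.ofReal l⁻¹ ^ (q - 1) * (ENNReal.ofReal ((powW μ x) ^ (q - 1)
                * (weightS μ x * weightR μ x ^ q)) * ∫⁻ z, kerE μ l x z * U z ∂vol n) := by
                rw [ENNReal.mul_rpow_of_nonneg _ _ (by linarith),
                  ENNReal.ofReal_rpow_of_pos hw,
                  ENNReal.ofReal_mul (Real.rpow_pos_of_pos hw _).le]
                ring
            _ = _ := by
                rw [hws x hx, ENNReal.ofReal_mul (by positivity)]
                ring
      _ = (ENNReal.ofReal l⁻¹ ^ q * ∫⁻ x in orthant n,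
          ‖f x‖ₑ ^ q * ENNReal.ofReal (weightS μ x * weightR μ x ^ q)) ^ (1 / q) := by
          congr 1
          rw [lintegral_const_mul' _ _ (ENNReal.rpow_ne_top_of_nonneg (by linarith)
            ENNReal.ofReal_ne_top), lintegral_const_mul' _ _ ENNReal.ofReal_ne_top,
            lintegral_powW_kerE hμ hl hUm,
            setLIntegral_congr_fun (isOpen_orthant n).measurableSet hUs,
            lintegral_const_mul' _ _ ENNReal.ofReal_ne_top]
          have : ENNReal.ofReal l⁻¹ ^ q = ENNReal.ofReal l⁻¹ ^ (q - 1) * ENNReal.ofReal l⁻¹ := by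
            rw [ENNReal.ofReal_rpow_of_pos hli, ENNReal.ofReal_rpow_of_pos hli,
              ← ENNReal.ofReal_mul (by positivity), ← Real.rpow_add_one hli.ne', sub_add_cancel]
          rw [this]
          ring
      _ = _ := by
          rw [ENNReal.mul_rpow_of_nonneg _ _ (by positivity), ← ENNReal.rpow_mul,
            mul_one_div_cancel hq0.ne', ENNReal.rpow_one]

/-- The weighted Lebesgue spaces are contained in `L¹(w dx) + w L^∞`. -/
lemma inSum_of_wnorm_lt_top (hμ : ∀ i, -(1 / 2) < μ i) (hp : 1 ≤ p)
    (hf : AEStronglyMeasurable f (vol n)) (h : wnorm μ p f < ⊤) : InSum μ f := by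
  have hwr : ∀ x ∈ orthant n, ENNReal.ofReal (powW μ x) * ENNReal.ofReal (weightR μ x) = 1 := by
    intro x hx
    rw [← ENNReal.ofReal_mul (powW_pos μ hx).le, powW_mul_weightR μ hx, ENNReal.ofReal_one]
  have hfw : ∀ x ∈ orthant n, ‖f x‖ₑ
      = ENNReal.ofReal (powW μ x) * (ENNReal.ofReal (weightR μ x) * ‖f x‖ₑ) := by
    intro x hx
    rw [← mul_assoc, hwr x hx, one_mul]
  refine ⟨hf, ?_⟩
  unfold wnorm at h
  split_ifs at h with hpt
  · refine ⟨(essSup (fun x => ENNReal.ofReal (weightR μ x) * ‖f x‖ₑ) (vol n)).toNNReal, 0,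
      aemeasurable_const, by simp, ?_⟩
    rw [ENNReal.coe_toNNReal h.ne]
    filter_upwards [ENNReal.ae_le_essSup (μ := vol n)
      fun x => ENNReal.ofReal (weightR μ x) * ‖f x‖ₑ, ae_mem_orthant n] with x hx hxo
    rw [hfw x hxo, mul_comm, Pi.zero_apply, add_zero]
    exact mul_le_mul_left hx _
  · set q := p.toReal
    have hq : 1 ≤ q := by
      rw [← ENNReal.toReal_one]
      exact ENNReal.toReal_mono hpt hp
    have hq0 : 0 < q := by linarith
    have hC := constC_pos hμ
    rw [ENNReal.rpow_lt_top_iff_of_pos (by positivity)] at h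
    -- With t = r|f|, the inequality t ≤ 1 + t^q gives |f| = w t ≤ w + w t^q; the w-mass of the
    -- second term is C_μ times the q-th power of the norm.
    refine ⟨1, fun x => ENNReal.ofReal (powW μ x) * (ENNReal.ofReal (weightR μ x) * ‖f x‖ₑ) ^ q,
      (measurable_powW μ).ennreal_ofReal.aemeasurable.mul
        (((measurable_weightR μ).ennreal_ofReal.aemeasurable.mul hf.enorm).pow_const _), ?_, ?_⟩
    · have hUs : ∀ x ∈ orthant n, ENNReal.ofReal (powW μ x) * (ENNReal.ofReal (powW μ x)
          * (ENNReal.ofReal (weightR μ x) * ‖f x‖ₑ) ^ q) = ENNReal.ofReal (constC μ)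
            * (‖f x‖ₑ ^ q * ENNReal.ofReal (weightS μ x * weightR μ x ^ q)) := by
        intro x hx
        have hw := powW_pos μ hx
        have hr := weightR_pos μ hx
        have hs := weightS_pos hμ hx
        rw [ENNReal.mul_rpow_of_nonneg _ _ hq0.le, ENNReal.ofReal_rpow_of_pos hr, ← mul_assoc,
          ← ENNReal.ofReal_mul hw.le, ← sq, powW_sq hμ hx, ENNReal.ofReal_mul hC.le,
          ENNReal.ofReal_mul hs.le]
        ring
      rw [setLIntegral_congr_fun (isOpen_orthant n).measurableSet hUs,
        lintegral_const_mul' _ _ ENNReal.ofReal_ne_top]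
      exact ENNReal.mul_lt_top ENNReal.ofReal_lt_top h
    · filter_upwards [ae_mem_orthant n] with x hx
      rw [ENNReal.coe_one, one_mul]
      nth_rewrite 1 [hfw x hx]
      set t := ENNReal.ofReal (weightR μ x) * ‖f x‖ₑ
      have ht : t ≤ 1 + t ^ q := by
        rcases le_total t 1 with h1 | h1
        · exact h1.trans le_self_add
        · refine le_add_left ?_
          calc t = t ^ (1 : ℝ) := (ENNReal.rpow_one t).symm
            _ ≤ t ^ q := ENNReal.rpow_le_rpow_of_exponent_le h1 hq
      calc _ ≤ ENNReal.ofReal (powW μ x) * (1 + t ^ q) := mul_le_mul_right ht _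
        _ = _ := by rw [mul_add, mul_one]

end Bound


/-! ### The Bessel operator in terms of the operators `Tᵢ` -/

section Calculus

variable {n : ℕ} {μ : Fin n → ℝ} {φ ψ : (Fin n → ℝ) → ℂ} {x : Fin n → ℝ}

lemma orthant_mem_nhds (hx : x ∈ orthant n) : orthant n ∈ nhds x :=
  (isOpen_orthant n).mem_nhds hx

lemma pderiv_congr {i : Fin n} (h : EqOn φ ψ (orthant n)) (hx : x ∈ orthant n) :
    pderiv i φ x = pderiv i ψ x := by
  unfold pderiv
  rw [(Filter.eventuallyEq_of_mem (orthant_mem_nhds hx) h).fderiv_eq]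

lemma opT_congr {i : Fin n} (h : EqOn φ ψ (orthant n)) :
    EqOn (opT i φ) (opT i ψ) (orthant n) := by
  intro x hx
  unfold opT
  rw [pderiv_congr h hx]

lemma contDiffOn_pderiv (i : Fin n) (h : ContDiffOn ℝ ∞ ψ (orthant n)) :
    ContDiffOn ℝ ∞ (pderiv i ψ) (orthant n) :=
  (h.fderiv_of_isOpen (isOpen_orthant n) (by simp)).clm_apply contDiffOn_const

lemma contDiffOn_opT (i : Fin n) (h : ContDiffOn ℝ ∞ ψ (orthant n)) :
    ContDiffOn ℝ ∞ (opT i ψ) (orthant n) := by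
  have hinv : ContDiffOn ℝ ∞ (fun x : Fin n → ℝ => (x i)⁻¹) (orthant n) := fun x hx =>
    ((contDiff_apply ℝ ℝ i).contDiffAt.inv (hx i).ne').contDiffWithinAt
  exact hinv.smul (contDiffOn_pderiv i h)

lemma differentiableAt_of_contDiffOn (h : ContDiffOn ℝ ∞ ψ (orthant n)) (hx : x ∈ orthant n) :
    DifferentiableAt ℝ ψ x :=
  (h.contDiffAt (orthant_mem_nhds hx)).differentiableAt (by simp)

lemma contDiffAt_powW (hx : x ∈ orthant n) : ContDiffAt ℝ ∞ (powW μ) x := by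
  unfold powW
  exact contDiffAt_prod fun i _ =>
    (contDiff_apply ℝ ℝ i).contDiffAt.rpow_const_of_ne (hx i).ne'

lemma pderiv_smul (i : Fin n) {a : (Fin n → ℝ) → ℝ} (ha : DifferentiableAt ℝ a x)
    (hψ : DifferentiableAt ℝ ψ x) :
    pderiv i (fun y => a y • ψ y) x
      = a x • pderiv i ψ x + (fderiv ℝ a x (Pi.single i 1)) • ψ x := by
  unfold pderiv
  rw [fderiv_fun_smul ha hψ]
  simp

lemma fderiv_coord_comp (i : Fin n) {a : ℝ → ℝ} {a' : ℝ} (ha : HasDerivAt a a' (x i)) :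
    fderiv ℝ (fun y : Fin n → ℝ => a (y i)) x (Pi.single i 1) = a' := by
  have := ha.comp_hasFDerivAt x (hasFDerivAt_apply (𝕜 := ℝ) i x)
  rw [HasFDerivAt.fderiv (f := fun y : Fin n → ℝ => a (y i)) this]
  simp

lemma fderiv_powW (i : Fin n) (hx : x ∈ orthant n) :
    fderiv ℝ (powW μ) x (Pi.single i 1) = powW μ x * ((μ i + 1 / 2) / x i) := by
  have hexp : (fun y => Real.exp (∑ j, Real.log (y j) * (μ j + 1 / 2))) =ᶠ[nhds x] powW μ := by
    filter_upwards [orthant_mem_nhds hx] with y hy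
    rw [Real.exp_sum, powW]
    exact Finset.prod_congr rfl fun j _ => (Real.rpow_def_of_pos (hy j) _).symm
  have hd (j : Fin n) := (((hasFDerivAt_apply (𝕜 := ℝ) j x).log (hx j).ne').mul_const
    (μ j + 1 / 2))
  have h := (HasFDerivAt.fun_sum (u := Finset.univ) fun j _ => hd j).exp
  rw [← hexp.fderiv_eq, h.fderiv, ← hexp.self_of_nhds]
  simp only [smul_apply, FunLike.coe_smul, FunLike.coe_sum, Finset.sum_apply, Pi.smul_apply,
    ContinuousLinearMap.proj_apply, smul_eq_mul]
  congr 1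
  rw [Finset.sum_eq_single i]
  · simp
    ring
  · intro j _ hj
    simp [hj]
  · simp

/-- If `φ = w ψ`, then the `i`-th term of `S_μ φ` is `w (xᵢ² Tᵢ² ψ + (2μᵢ+2) Tᵢ ψ)`. -/
lemma pderiv_powW_smul (i : Fin n) (hψ : ContDiffOn ℝ ∞ ψ (orthant n)) (hx : x ∈ orthant n) :
    pderiv i (fun y => powW μ y • ψ y) x
      = powW μ x • (((μ i + 1 / 2) / x i) • ψ x + x i • opT i ψ x) := by
  have hxi := (hx i).ne'
  rw [pderiv_smul i ((contDiffAt_powW hx).differentiableAt (by simp))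
    (differentiableAt_of_contDiffOn hψ hx), fderiv_powW i hx, opT, smul_smul (x i),
    mul_inv_cancel₀ hxi, one_smul, smul_add, smul_smul, add_comm]

/-- Differentiating w twice yields (μ_i + 1/2)(μ_i - 1/2)/x_i² times w, which is exactly the
singular potential. After it cancels, only T_i and T_i² remain, and these are what the Zemanian
seminorms control. -/
lemma bessel_term_eq (i : Fin n) (h : EqOn φ (fun y => powW μ y • ψ y) (orthant n))
    (hψ : ContDiffOn ℝ ∞ ψ (orthant n)) (hx : x ∈ orthant n) :
    pderiv i (pderiv i φ) x - ((4 * μ i ^ 2 - 1) / (4 * x i ^ 2) : ℝ) • φ x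
      = powW μ x • ((2 * μ i + 2) • opT i ψ x + x i ^ 2 • opT i (opT i ψ) x) := by
  have hxi := (hx i).ne'
  have hT := contDiffOn_opT i hψ
  have h1 : EqOn (pderiv i φ) (fun y => powW μ y •
      (((μ i + 1 / 2) / y i) • ψ y + y i • opT i ψ y)) (orthant n) := fun y hy => by
    rw [pderiv_congr h hy, pderiv_powW_smul i hψ hy]
  have da : ∀ y ∈ orthant n, HasDerivAt (fun t : ℝ => (μ i + 1 / 2) / t)
      (-(μ i + 1 / 2) / (y i) ^ 2) (y i) := fun y hy => by
    have := (hasDerivAt_inv (hy i).ne').const_mul (μ i + 1 / 2)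
    have e : (fun t : ℝ => (μ i + 1 / 2) / t) = fun t => (μ i + 1 / 2) * t⁻¹ := by
      ext t
      rw [div_eq_mul_inv]
    rw [e]
    exact this.congr_deriv (by ring)
  have ca : ContDiffOn ℝ ∞ (fun y : Fin n → ℝ => (μ i + 1 / 2) / y i) (orthant n) := fun y hy =>
    (contDiffAt_const.div (contDiff_apply ℝ ℝ i).contDiffAt (hy i).ne').contDiffWithinAt
  have cb : ContDiffOn ℝ ∞ (fun y : Fin n → ℝ => y i) (orthant n) :=
    (contDiff_apply ℝ ℝ i).contDiffOn
  have hθ : ContDiffOn ℝ ∞ (fun y => ((μ i + 1 / 2) / y i) • ψ y + y i • opT i ψ y)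
      (orthant n) := (ca.smul hψ).add (cb.smul hT)
  have dax : DifferentiableAt ℝ (fun y : Fin n → ℝ => (μ i + 1 / 2) / y i) x :=
    (ca.contDiffAt (orthant_mem_nhds hx)).differentiableAt (by simp)
  have dbx : DifferentiableAt ℝ (fun y : Fin n → ℝ => y i) x :=
    (contDiff_apply (n := 1) ℝ ℝ i).differentiable one_ne_zero x
  have dψ := differentiableAt_of_contDiffOn hψ hx
  have dT := differentiableAt_of_contDiffOn hT hx
  have hp : pderiv i ψ x = x i • opT i ψ x := by
    rw [opT, smul_smul, mul_inv_cancel₀ hxi, one_smul]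
  have hpT : pderiv i (opT i ψ) x = x i • opT i (opT i ψ) x := by
    rw [opT, smul_smul, mul_inv_cancel₀ hxi, one_smul]
  have h2 : pderiv i (fun y => ((μ i + 1 / 2) / y i) • ψ y + y i • opT i ψ y) x
      = ((μ i + 1 / 2) / x i) • pderiv i ψ x + (-(μ i + 1 / 2) / (x i) ^ 2) • ψ x
        + (x i • pderiv i (opT i ψ) x + (1 : ℝ) • opT i ψ x) := by
    have := pderiv_smul i dax dψ
    rw [fderiv_coord_comp i (da x hx)] at this
    rw [← this]
    have := pderiv_smul i dbx dT
    rw [fderiv_coord_comp i (a := fun t => t) (hasDerivAt_id (x i))] at this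
    rw [← this]
    unfold pderiv
    rw [fderiv_fun_add (dax.fun_smul dψ) (dbx.fun_smul dT)]
    rfl
  rw [pderiv_congr h1 hx, pderiv_smul i ((contDiffAt_powW hx).differentiableAt (by simp))
    (differentiableAt_of_contDiffOn hθ hx), h2, fderiv_powW i hx, h hx, hp, hpT]
  simp only [Complex.real_smul]
  push_cast
  have : (x i : ℂ) ≠ 0 := by exact_mod_cast hxi
  field_simp
  ring

lemma foldl_opT_single (i : Fin n) (m : ℕ) (L : List (Fin n)) (f : (Fin n → ℝ) → ℂ) :
    L.foldl (fun g j => (opT j)^[(Pi.single i m : Fin n → ℕ) j] g) f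
      = (opT i)^[m * L.count i] f := by
  induction L generalizing f with
  | nil => simp
  | cons a L ih =>
    rw [List.foldl_cons, ih]
    by_cases h : a = i
    · subst h
      rw [Pi.single_eq_same, List.count_cons_self, ← Function.iterate_add_apply]
      congr 1
    · rw [Pi.single_eq_of_ne h, List.count_cons_of_ne h]
      rfl

lemma opTpow_single (i : Fin n) (m : ℕ) (f : (Fin n → ℝ) → ℂ) :
    opTpow (Pi.single i m) f = (opT i)^[m] f := by
  unfold opTpow
  rw [foldl_opT_single, List.count_eq_one_of_mem (List.nodup_finRange n) (List.mem_finRange i),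
    mul_one]

lemma normSq_nonneg (x : Fin n → ℝ) : 0 ≤ normSq x := Finset.sum_nonneg fun _ _ => sq_nonneg _

lemma sq_le_normSq (x : Fin n → ℝ) (i : Fin n) : x i ^ 2 ≤ normSq x :=
  Finset.single_le_sum (f := fun j => x j ^ 2) (fun _ _ => sq_nonneg _) (Finset.mem_univ i)

/-- The function `r φ` attached to an element `φ` of the Zemanian space. -/
noncomputable def reduced (μ : Fin n → ℝ) (φ : (Fin n → ℝ) → ℂ) (y : Fin n → ℝ) : ℂ :=
  weightR μ y • φ y

lemma eqOn_powW_smul_reduced : EqOn φ (fun y => powW μ y • reduced μ φ y) (orthant n) :=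
  fun y hy => by simp only [reduced, smul_smul, powW_mul_weightR μ hy, one_smul]

lemma IsZemanian.contDiffOn_reduced (hφ : IsZemanian μ φ) :
    ContDiffOn ℝ ∞ (reduced μ φ) (orthant n) :=
  ContDiffOn.smul (fun _ hx => (contDiffAt_weightR μ hx).contDiffWithinAt) hφ.smooth

lemma IsZemanian.bound_opT_iterate (hφ : IsZemanian μ φ) (i : Fin n) (m M : ℕ) :
    ∃ C : ℝ, 0 ≤ C ∧ ∀ x ∈ orthant n,
      ‖(opT i)^[m] (reduced μ φ) x‖ * (1 + normSq x) ^ M ≤ C := by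
  obtain ⟨C, hC⟩ := hφ.bounded M (Pi.single i m)
  refine ⟨max C 0, le_max_right _ _, fun x hx => le_trans (le_of_eq ?_)
    ((hC x hx).trans (le_max_left _ _))⟩
  rw [opTpow_single, norm_smul, Real.norm_of_nonneg (by have := normSq_nonneg x; positivity),
    mul_comm]
  rfl

lemma IsZemanian.bound_reduced (hφ : IsZemanian μ φ) (M : ℕ) :
    ∃ C : ℝ, 0 ≤ C ∧ ∀ x ∈ orthant n, ‖reduced μ φ x‖ * (1 + normSq x) ^ M ≤ C := by
  obtain ⟨C, hC⟩ := hφ.bounded M 0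
  refine ⟨max C 0, le_max_right _ _, fun x hx => le_trans (le_of_eq ?_)
    ((hC x hx).trans (le_max_left _ _))⟩
  have : opTpow (0 : Fin n → ℕ) (fun y => weightR μ y • φ y) = reduced μ φ := by
    unfold opTpow
    generalize List.finRange n = L
    induction L with
    | nil => rfl
    | cons a L ih => exact ih
  rw [this, norm_smul, Real.norm_of_nonneg (by have := normSq_nonneg x; positivity), mul_comm]

/-- The `i`-th term of the Bessel operator. -/
noncomputable def besselTerm (μ : Fin n → ℝ) (i : Fin n) (φ : (Fin n → ℝ) → ℂ)
    (x : Fin n → ℝ) : ℂ :=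
  pderiv i (pderiv i φ) x - ((4 * μ i ^ 2 - 1) / (4 * x i ^ 2) : ℝ) • φ x

/-- The factor x_i² in front of T_i² costs one extra power of 1 + ‖x‖². Decay relative to w is all
that the pairings require of S φ. -/
lemma IsZemanian.bound_besselTerm (hφ : IsZemanian μ φ) (i : Fin n) (M : ℕ) :
    ∃ C : ℝ, 0 ≤ C ∧ ∀ x ∈ orthant n,
      ‖besselTerm μ i φ x‖ * (1 + normSq x) ^ M ≤ C * powW μ x := by
  obtain ⟨C, hC0, hC⟩ := hφ.bound_opT_iterate i 1 M
  obtain ⟨D, hD0, hD⟩ := hφ.bound_opT_iterate i 2 (M + 1)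
  refine ⟨|2 * μ i + 2| * C + D, by positivity, fun x hx => ?_⟩
  have hw := powW_pos μ hx
  have hN := normSq_nonneg x
  have h1 := hC x hx
  have h2 := hD x hx
  rw [Function.iterate_one] at h1
  rw [Function.iterate_succ_apply, Function.iterate_one] at h2
  rw [besselTerm, bessel_term_eq i eqOn_powW_smul_reduced hφ.contDiffOn_reduced hx, norm_smul,
    Real.norm_of_nonneg hw.le, mul_assoc, mul_comm]
  refine mul_le_mul_of_nonneg_right ?_ hw.le
  refine (mul_le_mul_of_nonneg_right (norm_add_le _ _) (by positivity)).trans ?_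
  rw [norm_smul, norm_smul, Real.norm_eq_abs, Real.norm_of_nonneg (sq_nonneg _), add_mul]
  refine add_le_add ?_ ?_
  · rw [mul_assoc]
    exact mul_le_mul_of_nonneg_left h1 (abs_nonneg _)
  · refine le_trans ?_ h2
    have := sq_le_normSq x i
    calc _ = ‖opT i (opT i (reduced μ φ)) x‖ * (1 + normSq x) ^ M * x i ^ 2 := by ring
      _ ≤ ‖opT i (opT i (reduced μ φ)) x‖ * (1 + normSq x) ^ M * (1 + normSq x) :=
        mul_le_mul_of_nonneg_left (by linarith) (by positivity)
      _ = _ := by ring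

lemma continuousOn_besselTerm (i : Fin n) (hφ : ContDiffOn ℝ ∞ φ (orthant n)) :
    ContinuousOn (besselTerm μ i φ) (orthant n) := by
  have hc : ContinuousOn (fun x : Fin n → ℝ => (4 * μ i ^ 2 - 1) / (4 * x i ^ 2))
      (orthant n) := by
    refine ContinuousOn.div continuousOn_const (by fun_prop) fun x hx => ?_
    have := hx i
    positivity
  exact (contDiffOn_pderiv i (contDiffOn_pderiv i hφ)).continuousOn.sub
    (hc.smul hφ.continuousOn)

end Calculus

/-! ### Rapidly decreasing functions -/

/-- The integrand is at most t^s on (0,1], and at most t^{s-2N} ≤ t^{-2} beyond 1. -/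
lemma lintegral_rpow_mul_inv_lt_top {s : ℝ} (hs : -1 < s) {N : ℕ} (hN : s + 2 ≤ 2 * N) :
    ∫⁻ t in Ioi (0 : ℝ), ENNReal.ofReal (t ^ s * ((1 + t ^ 2) ^ N)⁻¹) < ⊤ := by
  have h1 : ∫⁻ t in Ioc (0 : ℝ) 1, ENNReal.ofReal (t ^ s * ((1 + t ^ 2) ^ N)⁻¹) < ⊤ := by
    have hi := (intervalIntegral.intervalIntegrable_rpow' (a := 0) (b := 1) hs).1
    refine lt_of_le_of_lt ?_ hi.2
    refine setLIntegral_mono_ae' measurableSet_Ioc (Filter.Eventually.of_forall fun t ht => ?_)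
    have ht0 : 0 < t := ht.1
    rw [Real.enorm_of_nonneg (by positivity)]
    refine ENNReal.ofReal_le_ofReal (mul_le_of_le_one_right (by positivity) ?_)
    exact inv_le_one_of_one_le₀ (one_le_pow₀ (by nlinarith))
  have h2 : ∫⁻ t in Ioi (1 : ℝ), ENNReal.ofReal (t ^ s * ((1 + t ^ 2) ^ N)⁻¹) < ⊤ := by
    have hi := integrableOn_Ioi_rpow_of_lt (a := -2) (by norm_num) one_pos
    refine lt_of_le_of_lt ?_ hi.2
    refine setLIntegral_mono_ae' measurableSet_Ioi (Filter.Eventually.of_forall fun t ht => ?_)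
    have ht1 : 1 < t := ht
    have ht0 : 0 < t := by linarith
    rw [Real.enorm_of_nonneg (by positivity)]
    refine ENNReal.ofReal_le_ofReal ?_
    calc t ^ s * ((1 + t ^ 2) ^ N)⁻¹ ≤ t ^ s * ((t ^ 2) ^ N)⁻¹ := by gcongr; linarith
      _ = t ^ (s - 2 * N) := by
        rw [← pow_mul, ← Real.rpow_natCast, ← Real.rpow_neg ht0.le, ← Real.rpow_add ht0]
        push_cast
        ring_nf
      _ ≤ t ^ (-2 : ℝ) := Real.rpow_le_rpow_of_exponent_le ht1.le (by linarith)
  rw [← Ioc_union_Ioi_eq_Ioi zero_le_one]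
  exact lt_of_le_of_lt (lintegral_union_le _ _ _) (ENNReal.add_lt_top.2 ⟨h1, h2⟩)

section Decay

variable {n : ℕ} {μ : Fin n → ℝ}

/-- An exponent that makes `w² (1+‖x‖²)⁻ᴹ` integrable. -/
lemma exists_lintegral_powW_sq_lt_top (hμ : ∀ i, -(1 / 2) < μ i) : ∃ M : ℕ,
    ∫⁻ x, ENNReal.ofReal (powW μ x ^ 2 * ((1 + normSq x) ^ M)⁻¹) ∂vol n < ⊤ := by
  -- One N serves all coordinates. The final exponent is N n because (1 + ‖x‖²)^{Nn} dominates the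
  -- product of the (1 + x_i²)^N, which reduces the claim to one-dimensional integrals.
  obtain ⟨N, hN⟩ := exists_nat_ge (∑ i, |μ i| + 2)
  refine ⟨N * n, ?_⟩
  have hNi (i : Fin n) : 2 * μ i + 1 + 2 ≤ 2 * N := by
    have h1 : |μ i| ≤ ∑ j, |μ j| :=
      Finset.single_le_sum (f := fun j => |μ j|) (fun _ _ => abs_nonneg _) (Finset.mem_univ i)
    have h2 := le_abs_self (μ i)
    linarith
  have hle : ∀ᵐ x ∂vol n, ENNReal.ofReal (powW μ x ^ 2 * ((1 + normSq x) ^ (N * n))⁻¹)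
      ≤ ∏ i, ENNReal.ofReal (x i ^ (2 * μ i + 1) * ((1 + x i ^ 2) ^ N)⁻¹) := by
    filter_upwards [ae_mem_orthant n] with x hx
    rw [← ENNReal.ofReal_prod_of_nonneg]
    · refine ENNReal.ofReal_le_ofReal ?_
      rw [Finset.prod_mul_distrib]
      have h1 : powW μ x ^ 2 = ∏ i, x i ^ (2 * μ i + 1) := by
        unfold powW
        rw [← Finset.prod_pow]
        refine Finset.prod_congr rfl fun i _ => ?_
        rw [← Real.rpow_natCast, ← Real.rpow_mul (hx i).le]
        congr 1
        push_cast
        ring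
      rw [h1]
      refine mul_le_mul_of_nonneg_left ?_
        (Finset.prod_nonneg fun i _ => Real.rpow_nonneg (hx i).le _)
      rw [Finset.prod_inv_distrib, pow_mul]
      refine inv_anti₀ (Finset.prod_pos fun i _ => by positivity) ?_
      calc ∏ i, (1 + x i ^ 2) ^ N ≤ ∏ _i : Fin n, (1 + normSq x) ^ N :=
            Finset.prod_le_prod (fun i _ => by positivity) fun i _ =>
              pow_le_pow_left₀ (by positivity) (by linarith [sq_le_normSq x i]) _
        _ = _ := by simp
    · intro i _
      have := hx i
      positivity
  refine lt_of_le_of_lt (lintegral_mono_ae hle) ?_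
  rw [lintegral_vol_prod
    (f := fun i t => ENNReal.ofReal (t ^ (2 * μ i + 1) * ((1 + t ^ 2) ^ N)⁻¹))]
  · exact ENNReal.prod_lt_top fun i _ =>
      lintegral_rpow_mul_inv_lt_top (by linarith [hμ i]) (hNi i)
  · intro i
    exact ((measurable_id.pow_const _).mul (by fun_prop)).ennreal_ofReal

/-- M = 0 gives the bound by w; a large M gives w|f| ≤ C w² (1 + ‖x‖²)^{-M}, which is integrable. -/
lemma inInter_of_bound (hμ : ∀ i, -(1 / 2) < μ i) {f : (Fin n → ℝ) → ℂ}
    (hf : AEStronglyMeasurable f (vol n))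
    (h : ∀ M : ℕ, ∃ C : ℝ, 0 ≤ C ∧ ∀ x ∈ orthant n, ‖f x‖ * (1 + normSq x) ^ M ≤ C * powW μ x) :
    InInter μ f := by
  refine ⟨hf, ?_, ?_⟩
  · obtain ⟨C, hC0, hC⟩ := h 0
    refine ⟨C.toNNReal, ?_⟩
    filter_upwards [ae_mem_orthant n] with x hx
    have := hC x hx
    rw [pow_zero, mul_one] at this
    rw [← ofReal_norm]
    refine (ENNReal.ofReal_le_ofReal this).trans (le_of_eq ?_)
    rw [ENNReal.ofReal_mul hC0]
    rfl
  · obtain ⟨M, hM⟩ := exists_lintegral_powW_sq_lt_top hμ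
    obtain ⟨C, hC0, hC⟩ := h M
    refine lt_of_le_of_lt ?_ (ENNReal.mul_lt_top (a := ENNReal.ofReal C) ENNReal.ofReal_lt_top hM)
    rw [← lintegral_const_mul' _ _ ENNReal.ofReal_ne_top]
    refine lintegral_mono_ae ?_
    filter_upwards [ae_mem_orthant n] with x hx
    have hw := powW_pos μ hx
    have hN : 0 < (1 + normSq x) ^ M := by have := normSq_nonneg x; positivity
    rw [← ofReal_norm, ← ENNReal.ofReal_mul hw.le, ← ENNReal.ofReal_mul hC0]
    refine ENNReal.ofReal_le_ofReal ?_
    have h1 : ‖f x‖ ≤ C * powW μ x * ((1 + normSq x) ^ M)⁻¹ := by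
      rw [← div_eq_mul_inv, le_div_iff₀ hN]
      exact hC x hx
    calc _ ≤ powW μ x * (C * powW μ x * ((1 + normSq x) ^ M)⁻¹) :=
          mul_le_mul_of_nonneg_left h1 hw.le
      _ = _ := by ring

lemma IsZemanian.inInter {φ : (Fin n → ℝ) → ℂ} (hμ : ∀ i, -(1 / 2) < μ i)
    (hφ : IsZemanian μ φ) : InInter μ φ := by
  refine inInter_of_bound hμ (hφ.smooth.continuousOn.aestronglyMeasurable
    (isOpen_orthant n).measurableSet) fun M => ?_
  obtain ⟨C, hC0, hC⟩ := hφ.bound_reduced M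
  refine ⟨C, hC0, fun x hx => ?_⟩
  have hw := powW_pos μ hx
  have h1 := eqOn_powW_smul_reduced (μ := μ) (φ := φ) hx
  rw [h1]
  simp only
  rw [norm_smul, Real.norm_of_nonneg hw.le, mul_assoc, mul_comm]
  exact mul_le_mul_of_nonneg_right (hC x hx) hw.le

lemma IsZemanian.inInter_besselTerm {φ : (Fin n → ℝ) → ℂ} (hμ : ∀ i, -(1 / 2) < μ i)
    (hφ : IsZemanian μ φ) (i : Fin n) : InInter μ (besselTerm μ i φ) :=
  inInter_of_bound hμ ((continuousOn_besselTerm i hφ.smooth).aestronglyMeasurable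
    (isOpen_orthant n).measurableSet) fun M => hφ.bound_besselTerm i M

lemma inInter_zero : InInter μ 0 :=
  ⟨aestronglyMeasurable_zero, ⟨0, by simp⟩, by simp⟩

lemma IsZemanian.inInter_besselS {φ : (Fin n → ℝ) → ℂ} (hμ : ∀ i, -(1 / 2) < μ i)
    (hφ : IsZemanian μ φ) : InInter μ (besselS μ φ) := by
  have h : besselS μ φ = ∑ i, besselTerm μ i φ := by
    ext x
    simp [besselS, besselTerm]
  rw [h]
  exact Finset.sum_induction _ (InInter μ) (fun _ _ => InInter.add) inInter_zero
    fun i _ => hφ.inInter_besselTerm hμ i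

end Decay


/-! ### Symmetry of the Bessel operator on the Zemanian space -/

section Symmetry

lemma insertNth_mem_orthant {m : ℕ} (i : Fin (m + 1)) {y : Fin m → ℝ} (hy : y ∈ orthant m) {t : ℝ}
    (ht : 0 < t) : (i.insertNth t y : Fin (m + 1) → ℝ) ∈ orthant (m + 1) := by
  intro j
  refine Fin.succAboveCases i ?_ (fun k => ?_) j
  · simpa using ht
  · simpa using hy k

lemma hasDerivAt_insertNth {m : ℕ} (i : Fin (m + 1)) (y : Fin m → ℝ) (t : ℝ) :
    HasDerivAt (fun s : ℝ => (i.insertNth s y : Fin (m + 1) → ℝ)) (Pi.single i 1) t := by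
  have h : (fun s : ℝ => (i.insertNth s y : Fin (m + 1) → ℝ))
      = fun s => Function.update (i.insertNth 0 y : Fin (m + 1) → ℝ) i s := by
    ext1 s
    rw [Fin.update_insertNth]
  rw [h]
  exact hasDerivAt_update _ i t

lemma hasDerivAt_comp_insertNth {m : ℕ} (i : Fin (m + 1)) {y : Fin m → ℝ} (hy : y ∈ orthant m)
    {F : (Fin (m + 1) → ℝ) → ℂ} (hF : ContDiffOn ℝ ∞ F (orthant (m + 1))) {t : ℝ} (ht : 0 < t) :
    HasDerivAt (fun s : ℝ => F (i.insertNth s y)) (pderiv i F (i.insertNth t y)) t :=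
  (differentiableAt_of_contDiffOn hF (insertNth_mem_orthant i hy ht)).hasFDerivAt.comp_hasDerivAt
    t (hasDerivAt_insertNth i y t)

lemma powW_insertNth {m : ℕ} (μ : Fin (m + 1) → ℝ) (i : Fin (m + 1)) (y : Fin m → ℝ) (t : ℝ) :
    powW μ (i.insertNth t y) = t ^ (μ i + 1 / 2) * powW (fun j => μ (i.succAbove j)) y := by
  unfold powW
  rw [Fin.prod_univ_succAbove _ i]
  simp

/-- The singular terms (μ_i + 1/2)/x_i are common to both derivatives and cancel in the Wronskian.
The remainder carries w² x_i, which vanishes at x_i = 0 precisely because 2μ_i + 2 > 0. -/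
lemma exists_wronskian_bound {n : ℕ} {μ : Fin n → ℝ} {φ χ : (Fin n → ℝ) → ℂ}
    (hφ : IsZemanian μ φ) (hχ : IsZemanian μ χ) (i : Fin n) (N : ℕ) :
    ∃ K : ℝ, 0 ≤ K ∧ ∀ x ∈ orthant n, ‖pderiv i φ x * χ x - φ x * pderiv i χ x‖
      ≤ K * powW μ x ^ 2 * (x i * ((1 + x i ^ 2) ^ N)⁻¹) := by
  obtain ⟨A, hA0, hA⟩ := hφ.bound_opT_iterate i 1 N
  obtain ⟨B, hB0, hB⟩ := hχ.bound_opT_iterate i 1 N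
  obtain ⟨C, hC0, hC⟩ := hφ.bound_reduced 0
  obtain ⟨D, hD0, hD⟩ := hχ.bound_reduced 0
  simp only [Function.iterate_one, pow_zero, mul_one] at hA hB hC hD
  refine ⟨A * D + C * B, by positivity, fun x hx => ?_⟩
  have hw := powW_pos μ hx
  have hxi := hx i
  have hp (ξ : (Fin n → ℝ) → ℂ) (hξ : IsZemanian μ ξ) : pderiv i ξ x = powW μ x •
      (((μ i + 1 / 2) / x i) • reduced μ ξ x + x i • opT i (reduced μ ξ) x) := by
    rw [pderiv_congr eqOn_powW_smul_reduced hx, pderiv_powW_smul i hξ.contDiffOn_reduced hx]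
  have h1 : pderiv i φ x * χ x - φ x * pderiv i χ x
      = (powW μ x ^ 2 * x i) • (opT i (reduced μ φ) x * reduced μ χ x
        - reduced μ φ x * opT i (reduced μ χ) x) := by
    rw [hp φ hφ, hp χ hχ, eqOn_powW_smul_reduced (μ := μ) (φ := φ) hx,
      eqOn_powW_smul_reduced (μ := μ) (φ := χ) hx]
    simp only [Complex.real_smul]
    push_cast
    ring
  have hN : 0 < (1 + x i ^ 2) ^ N := by positivity
  have hle : (1 + x i ^ 2) ^ N ≤ (1 + normSq x) ^ N :=
    pow_le_pow_left₀ (by positivity) (by linarith [sq_le_normSq x i]) _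
  have hA' : ‖opT i (reduced μ φ) x‖ ≤ A * ((1 + x i ^ 2) ^ N)⁻¹ := by
    rw [← div_eq_mul_inv, le_div_iff₀ hN]
    exact (mul_le_mul_of_nonneg_left hle (norm_nonneg _)).trans (hA x hx)
  have hB' : ‖opT i (reduced μ χ) x‖ ≤ B * ((1 + x i ^ 2) ^ N)⁻¹ := by
    rw [← div_eq_mul_inv, le_div_iff₀ hN]
    exact (mul_le_mul_of_nonneg_left hle (norm_nonneg _)).trans (hB x hx)
  rw [h1, norm_smul, Real.norm_of_nonneg (by positivity)]
  calc _ ≤ powW μ x ^ 2 * x i * (A * ((1 + x i ^ 2) ^ N)⁻¹ * D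
        + C * (B * ((1 + x i ^ 2) ^ N)⁻¹)) := by
        refine mul_le_mul_of_nonneg_left ((norm_sub_le _ _).trans ?_) (by positivity)
        rw [norm_mul, norm_mul]
        exact add_le_add (mul_le_mul hA' (hD x hx) (norm_nonneg _) (by positivity))
          (mul_le_mul (hC x hx) hB' (norm_nonneg _) hC0)
    _ = _ := by ring

/-- Lagrange's identity: the potentials cancel, the integrand is the derivative of the Wronskian,
and the Wronskian tends to 0 at both ends of the line. -/
lemma integral_besselTerm_line {m : ℕ} {μ : Fin (m + 1) → ℝ} (hμ : ∀ i, -(1 / 2) < μ i)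
    {φ χ : (Fin (m + 1) → ℝ) → ℂ} (hφ : IsZemanian μ φ) (hχ : IsZemanian μ χ) (i : Fin (m + 1))
    {y : Fin m → ℝ} (hy : y ∈ orthant m)
    (hint : IntegrableOn (fun t : ℝ => besselTerm μ i φ (i.insertNth t y) * χ (i.insertNth t y)
      - φ (i.insertNth t y) * besselTerm μ i χ (i.insertNth t y)) (Ioi 0)) :
    ∫ t in Ioi (0 : ℝ), (besselTerm μ i φ (i.insertNth t y) * χ (i.insertNth t y)
      - φ (i.insertNth t y) * besselTerm μ i χ (i.insertNth t y)) = 0 := by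
  set A : ℝ → ℂ := fun t => pderiv i φ (i.insertNth t y) * χ (i.insertNth t y)
    - φ (i.insertNth t y) * pderiv i χ (i.insertNth t y) with hA
  have hder : ∀ t ∈ Ioi (0 : ℝ), HasDerivAt A
      (besselTerm μ i φ (i.insertNth t y) * χ (i.insertNth t y)
      - φ (i.insertNth t y) * besselTerm μ i χ (i.insertNth t y)) t := by
    intro t ht
    refine (((hasDerivAt_comp_insertNth i hy (contDiffOn_pderiv i hφ.smooth) ht).mul
      (hasDerivAt_comp_insertNth i hy hχ.smooth ht)).sub
      ((hasDerivAt_comp_insertNth i hy hφ.smooth ht).mul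
      (hasDerivAt_comp_insertNth i hy (contDiffOn_pderiv i hχ.smooth) ht))).congr_deriv ?_
    unfold besselTerm
    simp only [Complex.real_smul]
    ring
  -- This N makes 2μ_i + 2 - 2N ≤ -1, so the Wronskian is O(1/t) at infinity.
  obtain ⟨N, hN⟩ := exists_nat_ge (μ i + 3 / 2)
  obtain ⟨K, hK0, hK⟩ := exists_wronskian_bound hφ hχ i N
  set c := powW (fun j => μ (i.succAbove j)) y
  have hbound : ∀ t : ℝ, 0 < t →
      ‖A t‖ ≤ K * c ^ 2 * (t ^ (2 * μ i + 2) * ((1 + t ^ 2) ^ N)⁻¹) := by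
    intro t ht
    have h := hK _ (insertNth_mem_orthant i hy ht)
    rw [powW_insertNth, Fin.insertNth_apply_same] at h
    refine h.trans (le_of_eq ?_)
    have : t ^ (2 * μ i + 2) = t ^ (μ i + 1 / 2) * t ^ (μ i + 1 / 2) * t := by
      rw [← Real.rpow_add ht, ← Real.rpow_add_one ht.ne']
      congr 1
      ring
    rw [this]
    ring
  have hs : 0 < 2 * μ i + 2 := by linarith [hμ i]
  have h0 : Filter.Tendsto A (nhdsWithin 0 (Ioi 0)) (nhds 0) := by
    have hz : Filter.Tendsto (fun t : ℝ => K * c ^ 2 * t ^ (2 * μ i + 2))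
        (nhdsWithin 0 (Ioi 0)) (nhds 0) := by
      have := ((Real.continuousAt_rpow_const 0 (2 * μ i + 2) (Or.inr hs.le)).tendsto.mono_left
        (nhdsWithin_le_nhds (s := Ioi 0))).const_mul (K * c ^ 2)
      rwa [Real.zero_rpow hs.ne', mul_zero] at this
    refine squeeze_zero_norm' ?_ hz
    filter_upwards [self_mem_nhdsWithin] with t ht
    have ht' : 0 < t := ht
    refine (hbound t ht').trans (mul_le_mul_of_nonneg_left ?_ (by positivity))
    exact mul_le_of_le_one_right (by positivity)
      (inv_le_one_of_one_le₀ (one_le_pow₀ (by nlinarith)))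
  have htop : Filter.Tendsto A Filter.atTop (nhds 0) := by
    have hz : Filter.Tendsto (fun t : ℝ => K * c ^ 2 * t⁻¹) Filter.atTop (nhds 0) := by
      have := tendsto_inv_atTop_zero (𝕜 := ℝ).const_mul (K * c ^ 2)
      rwa [mul_zero] at this
    refine squeeze_zero_norm' ?_ hz
    filter_upwards [Filter.eventually_ge_atTop 1] with t ht
    have ht' : 0 < t := by linarith
    refine (hbound t ht').trans (mul_le_mul_of_nonneg_left ?_ (by positivity))
    calc t ^ (2 * μ i + 2) * ((1 + t ^ 2) ^ N)⁻¹ ≤ t ^ (2 * μ i + 2) * ((t ^ 2) ^ N)⁻¹ := by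
          gcongr; linarith
      _ = t ^ (2 * μ i + 2 - 2 * N) := by
        rw [← pow_mul, ← Real.rpow_natCast, ← Real.rpow_neg ht'.le, ← Real.rpow_add ht']
        push_cast
        ring_nf
      _ ≤ t ^ (-1 : ℝ) := Real.rpow_le_rpow_of_exponent_le ht (by linarith)
      _ = t⁻¹ := Real.rpow_neg_one t
  -- Integration by parts against the constant 1 serves as the fundamental theorem of calculus with
  -- one-sided limits at the open endpoint 0.
  have h := integral_Ioi_deriv_mul_eq_sub (a := 0) (a' := 0) (b' := 0) (u := A)
    (v := fun _ => (1 : ℂ)) (v' := fun _ => 0) hder (fun x _ => hasDerivAt_const x 1) ?_ ?_ ?_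
  · simpa using h
  · refine hint.congr_fun (fun t _ => ?_) measurableSet_Ioi
    simp
  · simpa [Pi.mul_def] using h0
  · simpa [Pi.mul_def] using htop

lemma integral_besselTerm_mul {n : ℕ} {μ : Fin n → ℝ} (hμ : ∀ i, -(1 / 2) < μ i)
    {φ χ : (Fin n → ℝ) → ℂ} (hφ : IsZemanian μ φ) (hχ : IsZemanian μ χ) (i : Fin n) :
    ∫ x, besselTerm μ i φ x * χ x ∂vol n = ∫ x, φ x * besselTerm μ i χ x ∂vol n := by
  have i1 := (hφ.inInter_besselTerm hμ i).inSum.integrable_mul (hχ.inInter hμ)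
  have i2 := (hφ.inInter hμ).inSum.integrable_mul (hχ.inInter_besselTerm hμ i)
  rw [← sub_eq_zero, ← integral_sub i1 i2]
  have i3 := i1.sub i2
  cases n with
  | zero => exact i.elim0
  | succ m =>
    have hmp := (measurePreserving_piFinSuccAbove
      (fun _ : Fin (m + 1) => (volume : Measure ℝ).restrict (Ioi 0)) i).symm
    rw [← vol_eq_pi, ← vol_eq_pi] at hmp
    have hemb :=
      (MeasurableEquiv.piFinSuccAbove (fun _ : Fin (m + 1) => ℝ) i).symm.measurableEmbedding
    have i4 := (hmp.integrable_comp_emb hemb).2 i3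
    rw [← hmp.integral_comp hemb]
    refine (integral_prod_symm _ i4).trans ?_
    refine integral_eq_zero_of_ae ?_
    filter_upwards [i4.prod_left_ae, ae_mem_orthant m] with y hy hyo
    exact integral_besselTerm_line hμ hφ hχ i hyo hy

/-- The Bessel operator is symmetric on the Zemanian space. -/
lemma integral_besselS_mul {n : ℕ} {μ : Fin n → ℝ} (hμ : ∀ i, -(1 / 2) < μ i)
    {φ χ : (Fin n → ℝ) → ℂ} (hφ : IsZemanian μ φ) (hχ : IsZemanian μ χ) :
    ∫ x, besselS μ φ x * χ x ∂vol n = ∫ x, φ x * besselS μ χ x ∂vol n := by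
  have h (ξ : (Fin n → ℝ) → ℂ) (x : Fin n → ℝ) : besselS μ ξ x = ∑ i, besselTerm μ i ξ x := rfl
  simp_rw [h, Finset.sum_mul, Finset.mul_sum]
  rw [integral_finsetSum _ fun i _ =>
      (hφ.inInter_besselTerm hμ i).inSum.integrable_mul (hχ.inInter hμ),
    integral_finsetSum _ fun i _ =>
      (hφ.inInter hμ).inSum.integrable_mul (hχ.inInter_besselTerm hμ i)]
  exact Finset.sum_congr rfl fun i _ => integral_besselTerm_mul hμ hφ hχ i

end Symmetry

/-! ### Gaussians belong to the Zemanian space -/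

section Gaussian

variable {n : ℕ} {μ σ : Fin n → ℝ}

/-- The exponential `c e^{-∑ xⱼ²/(4σⱼ)}`. -/
noncomputable def expQuad (σ : Fin n → ℝ) (c : ℝ) (x : Fin n → ℝ) : ℂ :=
  ((c * Real.exp (-∑ j, x j ^ 2 * (1 / (4 * σ j))) : ℝ) : ℂ)

lemma gam_eq_powW_mul (μ σ x : Fin n → ℝ) : gam μ σ x
    = powW μ x * ((∏ i, (2 * σ i) ^ (-(μ i + 1)))
      * Real.exp (-∑ j, x j ^ 2 * (1 / (4 * σ j)))) := by
  rw [← Finset.sum_neg_distrib, Real.exp_sum, powW, gam, ← Finset.prod_mul_distrib,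
    ← Finset.prod_mul_distrib]
  refine Finset.prod_congr rfl fun i _ => ?_
  rw [gauss, mul_one_div]

lemma contDiff_expQuad (σ : Fin n → ℝ) (c : ℝ) : ContDiff ℝ ∞ (expQuad σ c) := by
  unfold expQuad
  refine Complex.ofRealCLM.contDiff.comp (contDiff_const.mul (Real.contDiff_exp.comp ?_))
  exact (ContDiff.sum fun i _ => ((contDiff_apply ℝ ℝ i).pow 2).mul contDiff_const).neg

/-- The exponential is an eigenfunction of T_i with eigenvalue -1/(2σ_i), so every T^k only changes
the constant and every Zemanian seminorm reduces to one estimate. -/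
lemma opT_expQuad (i : Fin n) (c : ℝ) :
    EqOn (opT i (expQuad σ c)) (expQuad σ (c * -(1 / (2 * σ i)))) (orthant n) := by
  intro x hx
  have hxi := (hx i).ne'
  have hd (j : Fin n) := (((hasFDerivAt_apply (𝕜 := ℝ) j x).pow 2).mul_const (1 / (4 * σ j)))
  have h := ((HasFDerivAt.fun_sum (u := Finset.univ) fun j _ => hd j).fun_neg.exp).const_mul c
  have h' : fderiv ℝ (expQuad σ c) x = _ := (Complex.ofRealCLM.hasFDerivAt.comp x h).fderiv
  rw [opT, pderiv, h']
  have hsum : ∑ j, (1 / (4 * σ j)) * (2 * x j * (Pi.single i 1 : Fin n → ℝ) j)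
      = 1 / (4 * σ i) * (2 * x i) := by
    rw [Finset.sum_eq_single i]
    · simp
    · intro j _ hj
      simp [hj]
    · simp
  simp only [ContinuousLinearMap.comp_apply, smul_apply, neg_apply, FunLike.coe_sum,
    Finset.sum_apply, ContinuousLinearMap.proj_apply, Complex.ofRealCLM_apply, Complex.real_smul,
    smul_eq_mul, FunLike.coe_smul, Pi.smul_apply, expQuad, ← Complex.ofReal_mul]
  congr 1
  simp only [Nat.add_one_sub_one, pow_one, Nat.cast_ofNat, nsmul_eq_mul]
  rw [hsum]
  field_simp
  ring

lemma opTpow_expQuad {f : (Fin n → ℝ) → ℂ} (c : ℝ) (hf : EqOn f (expQuad σ c) (orthant n))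
    (k : Fin n → ℕ) : ∃ d : ℝ, EqOn (opTpow k f) (expQuad σ d) (orthant n) := by
  have hit : ∀ (i : Fin n) (m : ℕ) (g : (Fin n → ℝ) → ℂ) (c : ℝ),
      EqOn g (expQuad σ c) (orthant n) →
      ∃ d : ℝ, EqOn ((opT i)^[m] g) (expQuad σ d) (orthant n) := by
    intro i m
    induction m with
    | zero => exact fun g c hg => ⟨c, hg⟩
    | succ m ih => exact fun g c hg => ih _ _ ((opT_congr hg).trans (opT_expQuad i c))
  unfold opTpow
  generalize List.finRange n = L
  induction L generalizing f c with
  | nil => exact ⟨c, hf⟩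
  | cons a L ih =>
    obtain ⟨d, hd⟩ := hit a (k a) f c hf
    exact ih d hd

lemma reduced_gam : EqOn (reduced μ fun x => (gam μ σ x : ℂ))
    (expQuad σ (∏ i, (2 * σ i) ^ (-(μ i + 1)))) (orthant n) := by
  intro x hx
  simp only [reduced, expQuad]
  rw [gam_eq_powW_mul, Complex.real_smul, ← Complex.ofReal_mul, ← mul_assoc,
    mul_comm (weightR μ x), powW_mul_weightR μ hx, one_mul]

lemma pow_mul_exp_neg_le {δ : ℝ} (hδ : 0 < δ) (m : ℕ) {t : ℝ} (ht : 0 ≤ t) :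
    (1 + t) ^ m * Real.exp (-(δ * t)) ≤ m.factorial * Real.exp δ / δ ^ m := by
  have h := Real.pow_div_factorial_le_exp (δ * (1 + t)) (by positivity) m
  have hf : (0 : ℝ) < m.factorial := by positivity
  rw [div_le_iff₀ hf, mul_pow, mul_add, mul_one, Real.exp_add] at h
  rw [le_div_iff₀ (by positivity), Real.exp_neg]
  calc (1 + t) ^ m * (Real.exp (δ * t))⁻¹ * δ ^ m
      = δ ^ m * (1 + t) ^ m * (Real.exp (δ * t))⁻¹ := by ring
    _ ≤ Real.exp δ * Real.exp (δ * t) * m.factorial * (Real.exp (δ * t))⁻¹ :=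
      mul_le_mul_of_nonneg_right h (by positivity)
    _ = _ := by field_simp

lemma exists_quad_lower_bound (hσ : ∀ i, 0 < σ i) : ∃ δ : ℝ, 0 < δ ∧ ∀ x : Fin n → ℝ,
    δ * normSq x ≤ ∑ j, x j ^ 2 * (1 / (4 * σ j)) := by
  have h0 : 0 ≤ ∑ j, σ j := Finset.sum_nonneg fun j _ => (hσ j).le
  -- The sum bounds every σ_j; the added 1 keeps the denominator positive when n = 0.
  refine ⟨1 / (4 * (∑ j, σ j + 1)), by positivity, fun x => ?_⟩
  rw [normSq, Finset.mul_sum]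
  refine Finset.sum_le_sum fun j _ => ?_
  rw [mul_comm]
  refine mul_le_mul_of_nonneg_left ?_ (sq_nonneg _)
  have h1 : σ j ≤ ∑ j, σ j := Finset.single_le_sum (fun j _ => (hσ j).le) (Finset.mem_univ j)
  have := hσ j
  exact one_div_le_one_div_of_le (by positivity) (by linarith)

lemma isZemanian_gam (hσ : ∀ i, 0 < σ i) : IsZemanian μ fun x => (gam μ σ x : ℂ) := by
  refine ⟨?_, fun m k => ?_⟩
  · have h : EqOn (fun x => (gam μ σ x : ℂ)) (fun x => powW μ x •
        expQuad σ (∏ i, (2 * σ i) ^ (-(μ i + 1))) x) (orthant n) := fun x _ => by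
      simp only [gam_eq_powW_mul, expQuad, Complex.real_smul]
      push_cast
      ring
    have hw : ContDiffOn ℝ ∞ (powW μ) (orthant n) :=
      fun x hx => (contDiffAt_powW hx).contDiffWithinAt
    exact (hw.smul (contDiff_expQuad σ _).contDiffOn).congr h
  · obtain ⟨d, hd⟩ := opTpow_expQuad _ (reduced_gam (μ := μ) (σ := σ)) k
    obtain ⟨δ, hδ, hq⟩ := exists_quad_lower_bound hσ
    refine ⟨|d| * (m.factorial * Real.exp δ / δ ^ m), fun x hx => ?_⟩
    have hN := normSq_nonneg x
    have h1 : opTpow k (fun y => weightR μ y • (gam μ σ y : ℂ)) x = expQuad σ d x := hd hx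
    rw [h1, expQuad, norm_smul, Complex.norm_real, norm_mul, Real.norm_eq_abs d,
      Real.norm_of_nonneg (Real.exp_pos _).le, Real.norm_of_nonneg (by positivity),
      mul_left_comm]
    refine mul_le_mul_of_nonneg_left ?_ (abs_nonneg _)
    refine le_trans (mul_le_mul_of_nonneg_left ?_ (by positivity)) (pow_mul_exp_neg_le hδ m hN)
    exact Real.exp_le_exp.2 (neg_le_neg (hq x))

/-- The image of a Gaussian under the Bessel operator. -/
noncomputable def gamS {n : ℕ} (μ σ x : Fin n → ℝ) : ℝ :=
  (∑ i, (x i ^ 2 / (4 * σ i ^ 2) - (μ i + 1) / σ i)) * gam μ σ x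

lemma besselS_gam (hσ : ∀ i, 0 < σ i) {x : Fin n → ℝ} (hx : x ∈ orthant n) :
    besselS μ (fun x => (gam μ σ x : ℂ)) x = gamS μ σ x := by
  rw [besselS, gamS]
  push_cast
  rw [Finset.sum_mul]
  refine Finset.sum_congr rfl fun i _ => ?_
  have hs := (hσ i).ne'
  rw [bessel_term_eq i eqOn_powW_smul_reduced (isZemanian_gam hσ).contDiffOn_reduced hx]
  have h1 : EqOn (opT i (reduced μ fun x => (gam μ σ x : ℂ))) _ (orthant n) :=
    (opT_congr reduced_gam).trans (opT_expQuad i _)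
  have h2 := (opT_congr (i := i) h1).trans (opT_expQuad i _)
  rw [h1 hx, h2 hx, gam_eq_powW_mul]
  simp only [expQuad, Complex.real_smul]
  push_cast
  have : (σ i : ℂ) ≠ 0 := by exact_mod_cast hs
  field_simp
  ring

end Gaussian


/-! ### Laplace representation of a Gaussian along the heat flow -/

section Laplace

variable {n : ℕ} {μ σ : Fin n → ℝ} {l : ℝ}

lemma measurable_gamS_add (μ σ : Fin n → ℝ) :
    Measurable fun w : ℝ × (Fin n → ℝ) => gamS μ (fun i => σ i + w.1) w.2 := by
  unfold gamS
  refine Measurable.mul (Finset.measurable_sum _ fun i _ => ?_) (measurable_gam_add μ σ)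
  fun_prop

lemma measurable_gam_add_left (μ σ x : Fin n → ℝ) :
    Measurable fun τ : ℝ => gam μ (fun i => σ i + τ) x :=
  Measurable.of_uncurry_right (f := fun (τ : ℝ) (x : Fin n → ℝ) => gam μ (fun i => σ i + τ) x)
    (measurable_gam_add μ σ)

lemma measurable_gamS_add_left (μ σ x : Fin n → ℝ) :
    Measurable fun τ : ℝ => gamS μ (fun i => σ i + τ) x :=
  Measurable.of_uncurry_right (f := fun (τ : ℝ) (x : Fin n → ℝ) => gamS μ (fun i => σ i + τ) x)
    (measurable_gamS_add μ σ)

/-- The heat equation: moving all times at equal speed applies S to the Gaussian. The logarithmic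
derivative of each factor is the corresponding summand of `gamS`. -/
lemma hasDerivAt_gam_add (hσ : ∀ i, 0 < σ i) (x : Fin n → ℝ) {τ : ℝ} (hτ : 0 ≤ τ) :
    HasDerivAt (fun t => gam μ (fun i => σ i + t) x) (gamS μ (fun i => σ i + τ) x) τ := by
  have hpos : ∀ i, 0 < σ i + τ := fun i => by linarith [hσ i]
  have hexp : (fun t => powW μ x * Real.exp (∑ i, (Real.log (2 * (σ i + t)) * (-(μ i + 1))
      - x i ^ 2 * (4 * (σ i + t))⁻¹))) =ᶠ[nhds τ] fun t => gam μ (fun i => σ i + t) x := by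
    have hev : ∀ᶠ t in nhds τ, ∀ i, 0 < σ i + t := by
      rw [Filter.eventually_all]
      exact fun i => ContinuousAt.eventually_lt continuousAt_const (by fun_prop) (hpos i)
    filter_upwards [hev] with t ht
    rw [Real.exp_sum, powW, gam, ← Finset.prod_mul_distrib]
    refine Finset.prod_congr rfl fun i _ => ?_
    have := ht i
    rw [gauss, Real.rpow_def_of_pos (x := 2 * (σ i + t)) (by positivity), ← Real.exp_add]
    congr 2
  have hd (i : Fin n) : HasDerivAt (fun t => Real.log (2 * (σ i + t)) * (-(μ i + 1))
      - x i ^ 2 * (4 * (σ i + t))⁻¹)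
      (x i ^ 2 / (4 * (σ i + τ) ^ 2) - (μ i + 1) / (σ i + τ)) τ := by
    have h0 := (hpos i).ne'
    have h1 := ((hasDerivAt_id τ).const_add (σ i)).const_mul 2
    have h2 := ((hasDerivAt_id τ).const_add (σ i)).const_mul 4
    refine (((h1.log (by simpa using h0)).mul_const (-(μ i + 1))).sub
      ((h2.inv (by simpa using h0)).const_mul (x i ^ 2))).congr_deriv ?_
    simp only [id]
    field_simp
    ring
  have h := ((HasDerivAt.fun_sum (u := Finset.univ) fun i _ => hd i).exp).const_mul (powW μ x)
  refine (h.congr_of_eventuallyEq hexp.symm).congr_deriv ?_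
  have hself := hexp.self_of_nhds
  simp only at hself
  rw [gamS, ← hself]
  ring

/-- The exponents -(μ_i + 1) are negative, so the height relative to w is largest at the initial
time; the bound is uniform along the heat flow. -/
lemma gam_le_powW (hμ : ∀ i, -(1 / 2) < μ i) (hσ : ∀ i, 0 < σ i) {ρ x : Fin n → ℝ}
    (hρ : ∀ i, σ i ≤ ρ i) (hx : x ∈ orthant n) :
    gam μ ρ x ≤ (∏ i, (2 * σ i) ^ (-(μ i + 1))) * powW μ x := by
  have hρ0 : ∀ i, 0 < ρ i := fun i => (hσ i).trans_le (hρ i)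
  rw [gam_eq_powW_mul, mul_comm]
  refine mul_le_mul_of_nonneg_right ?_ (powW_pos μ hx).le
  refine le_trans (mul_le_of_le_one_right (Finset.prod_nonneg fun i _ => ?_) ?_)
    (Finset.prod_le_prod (fun i _ => ?_) fun i _ => ?_)
  · have := hρ0 i
    positivity
  · refine Real.exp_le_one_iff.2 (neg_nonpos.2 (Finset.sum_nonneg fun i _ => ?_))
    have := hρ0 i
    positivity
  · have := hρ0 i
    positivity
  · have := hσ i
    exact Real.rpow_le_rpow_of_nonpos (by positivity) (by linarith [hρ i]) (by linarith [hμ i])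

lemma gam_eq_gam_two_mul {ρ : Fin n → ℝ} (hρ : ∀ i, 0 < ρ i) (x : Fin n → ℝ) :
    gam μ ρ x = (∏ i, (2 : ℝ) ^ (μ i + 1)) * Real.exp (-∑ i, x i ^ 2 / (8 * ρ i))
      * gam μ (fun i => 2 * ρ i) x := by
  rw [gam_eq_powW_mul, gam_eq_powW_mul]
  have h1 : ∏ i, (2 * ρ i) ^ (-(μ i + 1))
      = (∏ i, (2 : ℝ) ^ (μ i + 1)) * ∏ i, (2 * (2 * ρ i)) ^ (-(μ i + 1)) := by
    rw [← Finset.prod_mul_distrib]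
    refine Finset.prod_congr rfl fun i _ => ?_
    have := hρ i
    rw [Real.mul_rpow two_pos.le (by positivity : 0 ≤ 2 * ρ i), ← mul_assoc,
      ← Real.rpow_add two_pos]
    simp
  have h2 : Real.exp (-∑ j, x j ^ 2 * (1 / (4 * ρ j)))
      = Real.exp (-∑ i, x i ^ 2 / (8 * ρ i))
        * Real.exp (-∑ j, x j ^ 2 * (1 / (4 * (2 * ρ j)))) := by
    rw [← Real.exp_add, ← neg_add, ← Finset.sum_add_distrib]
    congr 2
    refine Finset.sum_congr rfl fun i _ => ?_
    have := (hρ i).ne'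
    field_simp
    ring
  rw [h1, h2]
  ring

lemma gam_le_gam_two_mul {ρ x : Fin n → ℝ} (hρ : ∀ i, 0 < ρ i) (hx : x ∈ orthant n) :
    gam μ ρ x ≤ (∏ i, (2 : ℝ) ^ (μ i + 1)) * gam μ (fun i => 2 * ρ i) x := by
  rw [gam_eq_gam_two_mul hρ]
  have h0 : 0 < gam μ (fun i => 2 * ρ i) x := gam_pos μ (fun i => by have := hρ i; positivity) hx
  refine mul_le_mul_of_nonneg_right (mul_le_of_le_one_right
    (Finset.prod_nonneg fun i _ => by positivity) ?_) h0.le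
  refine Real.exp_le_one_iff.2 (neg_nonpos.2 (Finset.sum_nonneg fun i _ => ?_))
  have := hρ i
  positivity

/-- Doubling the times gives away half of the exponent, a factor e^{-Y} with Y = ∑ x_i²/(8ρ_i). It
absorbs the quadratic polynomial produced by S, since Y e^{-Y} ≤ 1, and the constant depends only on
the lower bound σ of the times. -/
lemma exists_resolvent_gam_bound (hσ : ∀ i, 0 < σ i) (l : ℝ) : ∃ C : ℝ, 0 ≤ C ∧
    ∀ ρ : Fin n → ℝ, (∀ i, σ i ≤ ρ i) → ∀ x ∈ orthant n,
      |l * gam μ ρ x - gamS μ ρ x| ≤ C * gam μ (fun i => 2 * ρ i) x := by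
  have hP : 0 < ∏ i, (2 : ℝ) ^ (μ i + 1) := Finset.prod_pos fun i _ => by positivity
  refine ⟨(|l| + ∑ i, (2 / σ i + |μ i + 1| / σ i)) * ∏ i, (2 : ℝ) ^ (μ i + 1), ?_,
    fun ρ hρ x hx => ?_⟩
  · refine mul_nonneg (add_nonneg (abs_nonneg _) (Finset.sum_nonneg fun i _ => ?_)) hP.le
    have := hσ i
    positivity
  have hρ0 : ∀ i, 0 < ρ i := fun i => (hσ i).trans_le (hρ i)
  have h0 : 0 < gam μ (fun i => 2 * ρ i) x := gam_pos μ (fun i => by have := hρ0 i; positivity) hx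
  set Y := ∑ i, x i ^ 2 / (8 * ρ i) with hY
  have hYi : ∀ i, x i ^ 2 / (8 * ρ i) ≤ Y := fun i =>
    Finset.single_le_sum (f := fun i => x i ^ 2 / (8 * ρ i))
      (fun j _ => by have := hρ0 j; positivity) (Finset.mem_univ i)
  have hYe : ∀ i, x i ^ 2 / (8 * ρ i) * Real.exp (-Y) ≤ 1 := fun i => by
    rw [Real.exp_neg, ← div_eq_mul_inv, div_le_one (Real.exp_pos _)]
    linarith [hYi i, Real.add_one_le_exp Y]
  have hY0 : 0 ≤ Y := Finset.sum_nonneg fun j _ => by have := hρ0 j; positivity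
  have he1 : Real.exp (-Y) ≤ 1 := Real.exp_le_one_iff.2 (by linarith)
  have hkey : |l - ∑ i, (x i ^ 2 / (4 * ρ i ^ 2) - (μ i + 1) / ρ i)| * Real.exp (-Y)
      ≤ |l| + ∑ i, (2 / σ i + |μ i + 1| / σ i) := by
    refine (mul_le_mul_of_nonneg_right (abs_sub _ _) (Real.exp_pos _).le).trans ?_
    rw [add_mul]
    refine add_le_add (mul_le_of_le_one_right (abs_nonneg _) he1) ?_
    refine (mul_le_mul_of_nonneg_right (Finset.abs_sum_le_sum_abs _ _) (Real.exp_pos _).le).trans ?_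
    rw [Finset.sum_mul]
    refine Finset.sum_le_sum fun i _ => ?_
    have hs := hσ i
    have hr := hρ0 i
    refine (mul_le_mul_of_nonneg_right (abs_sub _ _) (Real.exp_pos _).le).trans ?_
    rw [add_mul, abs_div, abs_div, abs_of_pos hr, abs_of_nonneg (sq_nonneg (x i)),
      abs_of_pos (by positivity : 0 < 4 * ρ i ^ 2)]
    refine add_le_add ?_ ?_
    · calc x i ^ 2 / (4 * ρ i ^ 2) * Real.exp (-Y)
          = 2 / ρ i * (x i ^ 2 / (8 * ρ i) * Real.exp (-Y)) := by field_simp; ring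
        _ ≤ 2 / ρ i * 1 := mul_le_mul_of_nonneg_left (hYe i) (by positivity)
        _ ≤ 2 / σ i := by
          rw [mul_one]
          exact div_le_div_of_nonneg_left two_pos.le hs (hρ i)
    · exact (mul_le_of_le_one_right (by positivity) he1).trans
        (div_le_div_of_nonneg_left (abs_nonneg _) hs (hρ i))
  rw [gamS, ← sub_mul, abs_mul, abs_of_pos (gam_pos μ hρ0 hx), gam_eq_gam_two_mul hρ0, ← hY]
  calc _ = |l - ∑ i, (x i ^ 2 / (4 * ρ i ^ 2) - (μ i + 1) / ρ i)| * Real.exp (-Y)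
        * ((∏ i, (2 : ℝ) ^ (μ i + 1)) * gam μ (fun i => 2 * ρ i) x) := by ring
    _ ≤ (|l| + ∑ i, (2 / σ i + |μ i + 1| / σ i))
        * ((∏ i, (2 : ℝ) ^ (μ i + 1)) * gam μ (fun i => 2 * ρ i) x) :=
      mul_le_mul_of_nonneg_right hkey (mul_pos hP h0).le
    _ = _ := by ring

/-- The resolvent of the heat flow at a Gaussian recovers the Gaussian. -/
lemma integral_exp_mul_resolvent_gam (hμ : ∀ i, -(1 / 2) < μ i) (hσ : ∀ i, 0 < σ i) (hl : 0 < l)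
    {x : Fin n → ℝ} (hx : x ∈ orthant n) :
    ∫ τ in Ioi (0 : ℝ), Real.exp (-(l * τ)) * (l * gam μ (fun i => σ i + τ) x
      - gamS μ (fun i => σ i + τ) x) = gam μ σ x := by
  -- By the heat equation the integrand is the derivative of -e^{-λτ} G_{σ+τ}, which is -G_σ at τ =
  -- 0 and tends to 0 at infinity.
  have hE : ∀ τ ∈ Ici (0 : ℝ), HasDerivAt
      (fun t => -(Real.exp (-(l * t)) * gam μ (fun i => σ i + t) x))
      (Real.exp (-(l * τ)) * (l * gam μ (fun i => σ i + τ) x - gamS μ (fun i => σ i + τ) x)) τ := by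
    intro τ hτ
    have h1 : HasDerivAt (fun t => Real.exp (-(l * t))) (Real.exp (-(l * τ)) * -(l * 1)) τ :=
      (((hasDerivAt_id τ).const_mul l).fun_neg).exp
    refine (h1.mul (hasDerivAt_gam_add hσ x hτ)).fun_neg.congr_deriv ?_
    ring
  have hexp := integrableOn_exp_mul_Ioi (a := -l) (by linarith) 0
  simp only [neg_mul] at hexp
  have hm : Measurable fun τ => Real.exp (-(l * τ)) * (l * gam μ (fun i => σ i + τ) x
      - gamS μ (fun i => σ i + τ) x) :=
    Measurable.mul (by fun_prop) (((measurable_gam_add_left μ σ x).const_mul l).sub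
      (measurable_gamS_add_left μ σ x))
  obtain ⟨C, hC0, hC⟩ := exists_resolvent_gam_bound (μ := μ) hσ l
  have hint : IntegrableOn (fun τ => Real.exp (-(l * τ)) * (l * gam μ (fun i => σ i + τ) x
      - gamS μ (fun i => σ i + τ) x)) (Ioi 0) := by
    refine Integrable.mono' (hexp.const_mul (C * ((∏ i, (2 * σ i) ^ (-(μ i + 1))) * powW μ x)))
      hm.aestronglyMeasurable ?_
    filter_upwards [ae_restrict_mem measurableSet_Ioi] with τ hτ
    have hτ' : 0 < τ := hτ
    rw [norm_mul, Real.norm_of_nonneg (Real.exp_pos _).le, mul_comm]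
    refine mul_le_mul_of_nonneg_right ?_ (Real.exp_pos _).le
    refine (hC _ (fun i => by linarith) x hx).trans (mul_le_mul_of_nonneg_left ?_ hC0)
    exact gam_le_powW hμ hσ (fun i => by linarith [hσ i]) hx
  have htop : Filter.Tendsto (fun t => -(Real.exp (-(l * t)) * gam μ (fun i => σ i + t) x))
      Filter.atTop (nhds 0) := by
    have hz : Filter.Tendsto (fun t => ((∏ i, (2 * σ i) ^ (-(μ i + 1))) * powW μ x)
        * Real.exp (-(l * t))) Filter.atTop (nhds 0) := by
      have h1 : Filter.Tendsto (fun t => Real.exp (-(l * t))) Filter.atTop (nhds 0) :=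
        Real.tendsto_exp_neg_atTop_nhds_zero.comp
          (Filter.Tendsto.const_mul_atTop hl Filter.tendsto_id)
      have := h1.const_mul ((∏ i, (2 * σ i) ^ (-(μ i + 1))) * powW μ x)
      rwa [mul_zero] at this
    refine squeeze_zero_norm' ?_ hz
    filter_upwards [Filter.eventually_ge_atTop 0] with t ht
    have hpos := gam_pos μ (σ := fun i => σ i + t) (fun i => by linarith [hσ i]) hx
    rw [norm_neg, norm_mul, Real.norm_of_nonneg (Real.exp_pos _).le, Real.norm_of_nonneg hpos.le,
      mul_comm]
    exact mul_le_mul_of_nonneg_right (gam_le_powW hμ hσ (fun i => by linarith) hx)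
      (Real.exp_pos _).le
  rw [integral_Ioi_of_hasDerivAt_of_tendsto' hE hint htop]
  simp

/-- Fubini's theorem for families of functions dominated by Gaussians along the heat flow. -/
lemma integral_mul_laplace (hμ : ∀ i, -(1 / 2) < μ i) (hσ : ∀ i, 0 < σ i) (hl : 0 < l)
    {f : (Fin n → ℝ) → ℂ} (hf : InSum μ f) {G : ℝ → (Fin n → ℝ) → ℝ}
    (hG : Measurable fun w : ℝ × (Fin n → ℝ) => G w.1 w.2)
    (hbound : ∃ C : ℝ, 0 ≤ C ∧ ∀ τ : ℝ, 0 < τ → ∀ x ∈ orthant n,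
      |G τ x| ≤ C * gam μ (fun i => 2 * (σ i + τ)) x) :
    ∫ x, f x * ((∫ τ in Ioi (0 : ℝ), Real.exp (-(l * τ)) * G τ x : ℝ) : ℂ) ∂vol n
      = ∫ τ in Ioi (0 : ℝ), (Real.exp (-(l * τ)) : ℂ) * ∫ x, f x * (G τ x : ℂ) ∂vol n := by
  obtain ⟨C, hC0, hC⟩ := hbound
  obtain ⟨A, B, hAB⟩ := hf.exists_bound
  have hm : AEStronglyMeasurable
      (Function.uncurry fun x τ => f x * ((Real.exp (-(l * τ)) * G τ x : ℝ) : ℂ))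
      ((vol n).prod (volume.restrict (Ioi (0 : ℝ)))) := by
    refine hf.1.comp_fst.mul (Measurable.aestronglyMeasurable (Complex.measurable_ofReal.comp ?_))
    exact Measurable.mul (by fun_prop) (hG.comp measurable_swap)
  set D := ∏ i, (2 * σ i) ^ (-(μ i + 1))
  have hD : 0 ≤ D := Finset.prod_nonneg fun i _ => by have := hσ i; positivity
  have hinner : ∀ τ ∈ Ioi (0 : ℝ),
      ∫⁻ x, ‖f x * ((Real.exp (-(l * τ)) * G τ x : ℝ) : ℂ)‖ₑ ∂vol n
        ≤ ENNReal.ofReal (Real.exp (-(l * τ)))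
          * (ENNReal.ofReal C * (A * ENNReal.ofReal (constC μ) + B * D.toNNReal)) := by
    intro τ hτ
    have hτ' : 0 < τ := hτ
    have hρ : ∀ i, 0 < 2 * (σ i + τ) := fun i => by linarith [hσ i]
    -- The dominating Gaussians all have w-mass C_μ and the common bound D w, so their pairing with
    -- |f| is bounded independently of τ.
    have h1 := hAB D.toNNReal (fun x => ENNReal.ofReal (gam μ (fun i => 2 * (σ i + τ)) x))
      (measurable_gam μ _).ennreal_ofReal.aemeasurable (by
        filter_upwards [ae_mem_orthant n] with x hx
        refine (ENNReal.ofReal_le_ofReal (gam_le_powW hμ hσ (fun i => ?_) hx)).trans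
          (le_of_eq (ENNReal.ofReal_mul hD))
        linarith [hσ i])
    rw [lintegral_powW_mul_gam hμ hρ] at h1
    refine le_trans ?_ (mul_le_mul_right (mul_le_mul_right h1 _) _)
    rw [← lintegral_const_mul' _ _ ENNReal.ofReal_ne_top,
      ← lintegral_const_mul' _ _ ENNReal.ofReal_ne_top]
    refine lintegral_mono_ae ?_
    filter_upwards [ae_mem_orthant n] with x hx
    have h2 : ‖((Real.exp (-(l * τ)) * G τ x : ℝ) : ℂ)‖ₑ ≤ ENNReal.ofReal (Real.exp (-(l * τ)))
        * (ENNReal.ofReal C * ENNReal.ofReal (gam μ (fun i => 2 * (σ i + τ)) x)) := by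
      rw [← ENNReal.ofReal_mul hC0, ← ENNReal.ofReal_mul (Real.exp_pos _).le, ← ofReal_norm,
        Complex.norm_real, norm_mul, Real.norm_of_nonneg (Real.exp_pos _).le, Real.norm_eq_abs]
      exact ENNReal.ofReal_le_ofReal
        (mul_le_mul_of_nonneg_left (hC τ hτ' x hx) (Real.exp_pos _).le)
    rw [enorm_mul]
    refine (mul_le_mul_right h2 _).trans (le_of_eq ?_)
    ring
  have hint : Integrable
      (Function.uncurry fun x τ => f x * ((Real.exp (-(l * τ)) * G τ x : ℝ) : ℂ))
      ((vol n).prod (volume.restrict (Ioi (0 : ℝ)))) := by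
    refine ⟨hm, ?_⟩
    rw [hasFiniteIntegral_iff_enorm, lintegral_prod_symm _ hm.enorm]
    refine lt_of_le_of_lt (setLIntegral_mono_ae' measurableSet_Ioi
      (Filter.Eventually.of_forall hinner)) ?_
    have hc : ENNReal.ofReal C * (A * ENNReal.ofReal (constC μ) + B * D.toNNReal) ≠ ⊤ :=
      ENNReal.mul_ne_top ENNReal.ofReal_ne_top (ENNReal.add_ne_top.2
        ⟨ENNReal.mul_ne_top ENNReal.coe_ne_top ENNReal.ofReal_ne_top,
          ENNReal.mul_ne_top ENNReal.coe_ne_top ENNReal.coe_ne_top⟩)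
    rw [lintegral_mul_const' _ _ hc, lintegral_exp_neg_mul hl]
    exact ENNReal.mul_lt_top ENNReal.ofReal_lt_top hc.lt_top
  have e1 (x : Fin n → ℝ) : f x * ((∫ τ in Ioi (0 : ℝ), Real.exp (-(l * τ)) * G τ x : ℝ) : ℂ)
      = ∫ τ in Ioi (0 : ℝ), f x * ((Real.exp (-(l * τ)) * G τ x : ℝ) : ℂ) := by
    rw [integral_const_mul, integral_complex_ofReal]
  simp_rw [e1]
  rw [integral_integral_swap hint]
  refine integral_congr_ae (Filter.Eventually.of_forall fun τ => ?_)
  simp only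
  rw [← integral_const_mul]
  refine integral_congr_ae (Filter.Eventually.of_forall fun x => ?_)
  simp only
  push_cast
  ring

lemma inInter_gam (hμ : ∀ i, -(1 / 2) < μ i) (hσ : ∀ i, 0 < σ i) :
    InInter μ fun x => (gam μ σ x : ℂ) := (isZemanian_gam hσ).inInter hμ

lemma inInter_gamS (hμ : ∀ i, -(1 / 2) < μ i) (hσ : ∀ i, 0 < σ i) :
    InInter μ fun x => (gamS μ σ x : ℂ) := by
  obtain ⟨h1, ⟨C, hC⟩, h3⟩ := (isZemanian_gam hσ).inInter_besselS hμ
  have hae : besselS μ (fun x => (gam μ σ x : ℂ)) =ᵐ[vol n] fun x => (gamS μ σ x : ℂ) := by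
    filter_upwards [ae_mem_orthant n] with x hx
    exact besselS_gam hσ hx
  refine ⟨h1.congr hae, ⟨C, ?_⟩, ?_⟩
  · filter_upwards [hC, hae] with x hx he
    rwa [← he]
  · refine lt_of_eq_of_lt (lintegral_congr_ae ?_) h3
    filter_upwards [hae] with x he
    rw [he]

/-- The pairing with G_σ is recovered from the pairings with (λ - S) G_{σ+τ} alone. This gives the
injectivity of λ - S. -/
lemma integral_mul_gam_eq_laplace (hμ : ∀ i, -(1 / 2) < μ i) (hσ : ∀ i, 0 < σ i) (hl : 0 < l)
    {f : (Fin n → ℝ) → ℂ} (hf : InSum μ f) :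
    ∫ x, f x * (gam μ σ x : ℂ) ∂vol n = ∫ τ in Ioi (0 : ℝ), (Real.exp (-(l * τ)) : ℂ)
      * ∫ x, f x * ((l * gam μ (fun i => σ i + τ) x - gamS μ (fun i => σ i + τ) x : ℝ) : ℂ)
        ∂vol n := by
  rw [← integral_mul_laplace hμ hσ hl hf
    (G := fun τ x => l * gam μ (fun i => σ i + τ) x - gamS μ (fun i => σ i + τ) x)]
  · refine integral_congr_ae ?_
    filter_upwards [ae_mem_orthant n] with x hx
    rw [integral_exp_mul_resolvent_gam hμ hσ hl hx]
  · exact ((measurable_gam_add μ σ).const_mul l).sub (measurable_gamS_add μ σ)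
  · obtain ⟨C, hC0, hC⟩ := exists_resolvent_gam_bound (μ := μ) hσ l
    exact ⟨C, hC0, fun τ hτ x hx => hC _ (fun i => by linarith) x hx⟩

/-- The semigroup law integrated over τ. The integrand is non-negative, so the computation takes
place in [0,∞] and needs no prior integrability. -/
lemma hankelConv_gam (hμ : ∀ i, -(1 / 2) < μ i) (hσ : ∀ i, 0 < σ i) (hl : 0 < l)
    {x : Fin n → ℝ} (hx : x ∈ orthant n) :
    hankelConv μ (fun y => (kernelN μ l y : ℂ)) (fun z => (gam μ σ z : ℂ)) x
      = ((∫ τ in Ioi (0 : ℝ), Real.exp (-(l * τ)) * gam μ (fun i => σ i + τ) x : ℝ) : ℂ) := by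
  have hgm : AEStronglyMeasurable (fun z => (gam μ σ z : ℂ)) (vol n) := (inInter_gam hμ hσ).1
  have hl1 := lintegral_enorm_convIntegrand hμ hl hgm hx
  have hms := aestronglyMeasurable_convIntegrand (μ := μ) (l := l) hgm x
  set F : (Fin n → ℝ) × (Fin n → ℝ) → ℝ :=
    fun w => kernelD μ x w.1 w.2 * kernelN μ l w.1 * gam μ σ w.2 with hF
  have hcF : convIntegrand μ (fun y => (kernelN μ l y : ℂ)) (fun z => (gam μ σ z : ℂ)) x
      = fun w => (F w : ℂ) := by
    ext w
    simp [convIntegrand, hF]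
  have hF0 : ∀ᵐ w ∂(vol n).prod (vol n), 0 ≤ F w := by
    have h1 := (Measure.quasiMeasurePreserving_fst (μ := vol n) (ν := vol n)).ae
      (ae_mem_orthant n)
    have h2 := (Measure.quasiMeasurePreserving_snd (μ := vol n) (ν := vol n)).ae
      (ae_mem_orthant n)
    filter_upwards [h1, h2] with w hw1 hw2
    exact mul_nonneg (mul_nonneg (kernelD_nonneg hμ hx hw1 hw2) (kernelN_nonneg μ hl hw1))
      (gam_pos μ hσ hw2).le
  have hFm : AEStronglyMeasurable F ((vol n).prod (vol n)) := by
    rw [hcF] at hms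
    simpa using hms.re
  have hpos : ∀ᵐ τ ∂(volume : Measure ℝ).restrict (Ioi 0),
      0 ≤ Real.exp (-(l * τ)) * gam μ (fun i => σ i + τ) x := by
    filter_upwards [ae_restrict_mem measurableSet_Ioi] with τ hτ
    have hτ' : 0 < τ := hτ
    exact mul_nonneg (Real.exp_pos _).le (gam_pos μ (fun i => by linarith [hσ i]) hx).le
  have hmg : Measurable fun τ => Real.exp (-(l * τ)) * gam μ (fun i => σ i + τ) x :=
    Measurable.mul (by fun_prop) (measurable_gam_add_left μ σ x)
  rw [hankelConv, hcF, integral_complex_ofReal, integral_eq_lintegral_of_nonneg_ae hF0 hFm,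
    integral_eq_lintegral_of_nonneg_ae hpos hmg.aestronglyMeasurable]
  congr 2
  simp_rw [ENNReal.ofReal_mul (Real.exp_pos _).le]
  rw [← lintegral_kerE_gam hμ hl hσ hx]
  have h3 : ∫⁻ z, kerE μ l x z * ENNReal.ofReal (gam μ σ z) ∂vol n
      = ∫⁻ z, kerE μ l x z * ‖(gam μ σ z : ℂ)‖ₑ ∂vol n := by
    refine lintegral_congr_ae ?_
    filter_upwards [ae_mem_orthant n] with z hz
    rw [← ofReal_norm, Complex.norm_real, Real.norm_of_nonneg (gam_pos μ hσ hz).le]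
  rw [h3, ← hl1, hcF]
  refine lintegral_congr_ae ?_
  filter_upwards [hF0] with w hw
  rw [← ofReal_norm, Complex.norm_real, Real.norm_of_nonneg hw]

end Laplace


/-! ### Totality of the Gaussians -/

open BoundedContinuousFunction in
/-- An integrable function on a Polish space which is orthogonal to a point-separating algebra of
bounded continuous functions vanishes almost everywhere. -/
lemma ae_eq_zero_of_integral_mul_eq_zero {E : Type*} [TopologicalSpace E] [PolishSpace E]
    [MeasurableSpace E] [BorelSpace E] {ν : Measure E} {g : E → ℝ} (hg : Integrable g ν)
    {A : StarSubalgebra ℝ (BoundedContinuousFunction E ℝ)}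
    (hA : (A.map (toContinuousMapStarₐ ℝ)).SeparatesPoints)
    (h : ∀ F ∈ A, ∫ x, g x * F x ∂ν = 0) : g =ᵐ[ν] 0 := by
  have hfin : ∀ g : E → ℝ, Integrable g ν →
      IsFiniteMeasure (ν.withDensity fun x => ENNReal.ofReal (g x)) := fun g hg =>
    isFiniteMeasure_withDensity_ofReal hg.2
  have := hfin g hg
  have := hfin _ hg.neg
  have hint : ∀ g : E → ℝ, Integrable g ν → ∀ F : BoundedContinuousFunction E ℝ,
      ∫ x, F x ∂(ν.withDensity fun x => ENNReal.ofReal (g x)) = ∫ x, max (g x) 0 * F x ∂ν := by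
    intro g hg F
    rw [integral_withDensity_eq_integral_toReal_smul₀ hg.1.aemeasurable.ennreal_ofReal
      (Filter.Eventually.of_forall fun x => ENNReal.ofReal_lt_top)]
    simp only [ENNReal.toReal_ofReal', smul_eq_mul]
  have hmul : ∀ g : E → ℝ, Integrable g ν → ∀ F : BoundedContinuousFunction E ℝ,
      Integrable (fun x => max (g x) 0 * F x) ν := fun g hg F =>
    hg.pos_part.mul_bdd F.continuous.aestronglyMeasurable
      (Filter.Eventually.of_forall F.norm_coe_le_norm)
  -- `ENNReal.ofReal` truncates at 0, so these two finite measures have the positive and negative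
  -- parts of g as densities. They agree on a separating algebra, hence coincide, and two equal
  -- parts must both vanish.
  have hP := ext_of_forall_mem_subalgebra_integral_eq_of_polish (𝕜 := ℝ)
    (P := ν.withDensity fun x => ENNReal.ofReal (g x))
    (P' := ν.withDensity fun x => ENNReal.ofReal ((-g) x)) hA fun F hF => by
      rw [hint g hg, hint _ hg.neg, ← sub_eq_zero, ← integral_sub (hmul g hg F) (hmul _ hg.neg F)]
      refine Eq.trans (integral_congr_ae (Filter.Eventually.of_forall fun x => ?_)) (h F hF)
      simp only [← sub_mul, Pi.neg_apply]
      congr 1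
      rcases le_total (g x) 0 with h0 | h0
      · rw [max_eq_right h0, max_eq_left (by linarith)]; ring
      · rw [max_eq_left h0, max_eq_right (by linarith)]; ring
  have hne : ∫⁻ x, ENNReal.ofReal (g x) ∂ν ≠ ⊤ := by
    have := measure_ne_top (ν.withDensity fun x => ENNReal.ofReal (g x)) univ
    rwa [withDensity_apply _ MeasurableSet.univ, Measure.restrict_univ] at this
  have hae := (withDensity_eq_iff hg.1.aemeasurable.ennreal_ofReal
    hg.neg.1.aemeasurable.ennreal_ofReal hne).1 hP
  filter_upwards [hae] with x hx
  simp only [Pi.neg_apply] at hx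
  rcases le_total (g x) 0 with h0 | h0
  · rw [ENNReal.ofReal_of_nonpos h0, eq_comm, ENNReal.ofReal_eq_zero] at hx
    simp only [Pi.zero_apply]
    linarith
  · rw [ENNReal.ofReal_of_nonpos (p := -g x) (by linarith), ENNReal.ofReal_eq_zero] at hx
    simp only [Pi.zero_apply]
    linarith

/-- `x ↦ e^{-xᵢ²}` on the orthant. -/
noncomputable def expSq (n : ℕ) (i : Fin n) : BoundedContinuousFunction (orthant n) ℝ :=
  BoundedContinuousFunction.ofNormedAddCommGroup (fun x => Real.exp (-(x : Fin n → ℝ) i ^ 2))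
    (Real.continuous_exp.comp
      ((((continuous_apply i).comp continuous_subtype_val).pow 2).neg)) 1 fun x => by
      rw [Real.norm_of_nonneg (Real.exp_pos _).le, Real.exp_le_one_iff]
      nlinarith [sq_nonneg ((x : Fin n → ℝ) i)]

lemma expSq_apply (n : ℕ) (i : Fin n) (x : orthant n) :
    expSq n i x = Real.exp (-(x : Fin n → ℝ) i ^ 2) := rfl

/-- The algebra generated by the functions `x ↦ e^{-xᵢ²}`. -/
noncomputable def expAlgebra (n : ℕ) : StarSubalgebra ℝ (BoundedContinuousFunction (orthant n) ℝ) where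
  toSubalgebra := Algebra.adjoin ℝ (range (expSq n))
  star_mem' {F} hF := by
    have : star F = F := by ext x; simp
    rwa [this]

/-- Squaring is injective on positive coordinates. Separation needs one exponential per coordinate,
which is why the Gaussians carry independent times σ_i. -/
lemma expAlgebra_separatesPoints (n : ℕ) : ((expAlgebra n).map
    (BoundedContinuousFunction.toContinuousMapStarₐ ℝ)).SeparatesPoints := by
  intro x y hxy
  have : ∃ i, (x : Fin n → ℝ) i ≠ (y : Fin n → ℝ) i := by
    by_contra! hc
    exact hxy (Subtype.ext (funext hc))
  obtain ⟨i, hi⟩ := this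
  refine ⟨expSq n i, ⟨BoundedContinuousFunction.toContinuousMapStarₐ ℝ (expSq n i),
    ⟨expSq n i, Algebra.subset_adjoin ⟨i, rfl⟩, rfl⟩, rfl⟩, fun h => hi ?_⟩
  rw [expSq_apply, expSq_apply, Real.exp_eq_exp, neg_inj] at h
  exact (sq_eq_sq₀ (x.2 i).le (y.2 i).le).1 h

lemma exists_exp_of_mem_closure {n : ℕ} {F : BoundedContinuousFunction (orthant n) ℝ}
    (hF : F ∈ Submonoid.closure (range (expSq n))) :
    ∃ k : Fin n → ℕ, ∀ x, F x = Real.exp (-∑ i, k i * (x : Fin n → ℝ) i ^ 2) := by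
  induction hF using Submonoid.closure_induction with
  | mem F hF =>
    obtain ⟨i, rfl⟩ := hF
    refine ⟨Pi.single i 1, fun x => ?_⟩
    rw [expSq_apply, Finset.sum_eq_single i (fun j _ hj => by simp [hj]) (by simp)]
    simp
  | one => exact ⟨0, fun x => by simp⟩
  | mul F G _ _ hF hG =>
    obtain ⟨k, hk⟩ := hF
    obtain ⟨m, hm⟩ := hG
    refine ⟨k + m, fun x => ?_⟩
    rw [BoundedContinuousFunction.coe_mul, Pi.mul_apply, hk, hm, ← Real.exp_add]
    congr 1
    simp only [Pi.add_apply, Nat.cast_add, add_mul, Finset.sum_add_distrib]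
    ring

/-- The algebra is spanned by the monomials in the e^{-x_i²}, which are exactly the functions
tested. The argument is run on the orthant as a Polish space in its own right, since the squares do
not separate points of the whole space. -/
lemma ae_eq_zero_of_integral_exp_eq_zero {n : ℕ} {g : (Fin n → ℝ) → ℝ} (hg : Integrable g (vol n))
    (h : ∀ k : Fin n → ℕ, ∫ x, g x * Real.exp (-∑ i, k i * x i ^ 2) ∂vol n = 0) :
    g =ᵐ[vol n] 0 := by
  have hm := (isOpen_orthant n).measurableSet
  have : PolishSpace (orthant n) := (isOpen_orthant n).polishSpace
  let ν : Measure (orthant n) := Measure.comap Subtype.val volume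
  have hν : ν.map Subtype.val = vol n := map_comap_subtype_coe hm volume
  have hemb : MeasurableEmbedding (Subtype.val : orthant n → Fin n → ℝ) :=
    MeasurableEmbedding.subtype_coe hm
  have hgi : Integrable (fun x : orthant n => g x) ν :=
    (hemb.integrable_map_iff).1 (hν ▸ hg)
  have hz : (fun x : orthant n => g x) =ᵐ[ν] 0 := by
    refine ae_eq_zero_of_integral_mul_eq_zero hgi (expAlgebra_separatesPoints n) fun F hF => ?_
    have hF' : F ∈ Submodule.span ℝ
        (Submonoid.closure (range (expSq n)) : Set (BoundedContinuousFunction (orthant n) ℝ)) := by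
      rw [← Algebra.adjoin_eq_span]
      exact hF
    have hmul : ∀ F : BoundedContinuousFunction (orthant n) ℝ,
        Integrable (fun x : orthant n => g x * F x) ν := fun F =>
      hgi.mul_bdd F.continuous.aestronglyMeasurable
        (Filter.Eventually.of_forall F.norm_coe_le_norm)
    clear hF
    induction hF' using Submodule.span_induction with
    | mem F hF =>
      obtain ⟨k, hk⟩ := exists_exp_of_mem_closure hF
      rw [← h k, ← hν, hemb.integral_map]
      simp only [hk]
    | zero => simp
    | add F G _ _ hF hG =>
      simp only [BoundedContinuousFunction.coe_add, Pi.add_apply, mul_add]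
      rw [integral_add (hmul F) (hmul G), hF, hG, add_zero]
    | smul c F _ hF =>
      simp only [BoundedContinuousFunction.coe_smul, smul_eq_mul, mul_left_comm _ c]
      rw [integral_const_mul, hF, mul_zero]
  rw [← hν]
  exact (hemb.ae_map_iff).2 hz

variable {n : ℕ} {μ : Fin n → ℝ}

/-- The heat kernels form a total family. -/
lemma InSum.ae_eq_zero (hμ : ∀ i, -(1 / 2) < μ i) {f : (Fin n → ℝ) → ℂ} (hf : InSum μ f)
    (h : ∀ σ : Fin n → ℝ, (∀ i, 0 < σ i) → ∫ x, f x * (gam μ σ x : ℂ) ∂vol n = 0) :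
    f =ᵐ[vol n] 0 := by
  have hG : Integrable (fun x => f x * ((powW μ x * Real.exp (-normSq x) : ℝ) : ℂ)) (vol n) ∧
      ∀ k : Fin n → ℕ, Integrable (fun x => f x * ((powW μ x * Real.exp (-normSq x) : ℝ) : ℂ)
        * (Real.exp (-∑ i, k i * x i ^ 2) : ℂ)) (vol n) ∧
        ∫ x, f x * ((powW μ x * Real.exp (-normSq x) : ℝ) : ℂ)
        * (Real.exp (-∑ i, k i * x i ^ 2) : ℂ) ∂vol n = 0 := by
    have key : ∀ k : Fin n → ℕ,
        Integrable (fun x => f x * ((powW μ x * Real.exp (-normSq x) : ℝ) : ℂ)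
        * (Real.exp (-∑ i, k i * x i ^ 2) : ℂ)) (vol n) ∧
        ∫ x, f x * ((powW μ x * Real.exp (-normSq x) : ℝ) : ℂ)
        * (Real.exp (-∑ i, k i * x i ^ 2) : ℂ) ∂vol n = 0 := by
      intro k
      -- This choice makes e^{-x_i²/(4σ_i)} = e^{-(1+k_i)x_i²}: the 1 supplies the factor e^{-‖x‖²}
      -- that makes f w e^{-‖x‖²} integrable, and k_i supplies the test monomial.
      set σ : Fin n → ℝ := fun i => 1 / (4 * (1 + k i)) with hσd
      have hσ : ∀ i, 0 < σ i := fun i => by positivity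
      set c : ℝ := ∏ i, (2 * σ i) ^ (-(μ i + 1)) with hc
      have hcpos : 0 < c := Finset.prod_pos fun i _ => Real.rpow_pos_of_pos (by linarith [hσ i]) _
      have heq : ∀ x, f x * ((powW μ x * Real.exp (-normSq x) : ℝ) : ℂ)
          * (Real.exp (-∑ i, k i * x i ^ 2) : ℂ) = ((c⁻¹ : ℝ) : ℂ) * (f x * (gam μ σ x : ℂ)) := by
        intro x
        have : c⁻¹ * gam μ σ x
            = powW μ x * Real.exp (-normSq x) * Real.exp (-∑ i, k i * x i ^ 2) := by
          rw [gam_eq_powW_mul, ← hc, mul_left_comm c⁻¹, inv_mul_cancel_left₀ hcpos.ne', mul_assoc,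
            ← Real.exp_add, normSq, ← neg_add, ← Finset.sum_add_distrib]
          congr 3
          refine Finset.sum_congr rfl fun i _ => ?_
          simp only [hσd]
          field_simp
        rw [mul_assoc, ← Complex.ofReal_mul, ← this]
        push_cast
        ring
      simp only [heq]
      refine ⟨(hf.integrable_mul (inInter_gam hμ hσ)).const_mul _, ?_⟩
      rw [integral_const_mul, h σ hσ, mul_zero]
    refine ⟨?_, key⟩
    simpa using (key 0).1
  obtain ⟨hG, hk⟩ := hG
  have hre := ae_eq_zero_of_integral_exp_eq_zero hG.re fun k => by
    have h1 := congrArg Complex.re (hk k).2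
    rw [← RCLike.re_eq_complex_re, ← integral_re (hk k).1] at h1
    simpa only [RCLike.re_eq_complex_re, Complex.re_mul_ofReal, Complex.zero_re] using h1
  have him := ae_eq_zero_of_integral_exp_eq_zero hG.im fun k => by
    have h1 := congrArg Complex.im (hk k).2
    rw [← RCLike.im_eq_complex_im, ← integral_im (hk k).1] at h1
    simpa only [RCLike.im_eq_complex_im, Complex.im_mul_ofReal, Complex.zero_im] using h1
  filter_upwards [hre, him, ae_mem_orthant n] with x h1 h2 hx
  have hz : f x * ((powW μ x * Real.exp (-normSq x) : ℝ) : ℂ) = 0 :=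
    Complex.ext h1 h2
  refine (mul_eq_zero.1 hz).resolve_right ?_
  exact_mod_cast (mul_pos (powW_pos μ hx) (Real.exp_pos _)).ne'


/-! ### The resolvent equation in the dual of the Zemanian space -/

section Resolvent

variable {n : ℕ} {μ : Fin n → ℝ} {l : ℝ} {φ f g : (Fin n → ℝ) → ℂ}

lemma IsZemanian.inInter_resolvent (hμ : ∀ i, -(1 / 2) < μ i) (hφ : IsZemanian μ φ) (l : ℝ) :
    InInter μ ((l : ℂ) • φ - besselS μ φ) :=
  ((hφ.inInter hμ).const_smul _).sub (hφ.inInter_besselS hμ)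

lemma besselS_gam_ae {σ : Fin n → ℝ} (hσ : ∀ i, 0 < σ i) :
    besselS μ (fun x => (gam μ σ x : ℂ)) =ᵐ[vol n] fun x => (gamS μ σ x : ℂ) := by
  filter_upwards [ae_mem_orthant n] with x hx
  exact besselS_gam hσ hx

lemma integral_resolvent_mul_gam (hμ : ∀ i, -(1 / 2) < μ i) (hφ : IsZemanian μ φ)
    {σ : Fin n → ℝ} (hσ : ∀ i, 0 < σ i) :
    ∫ x, ((l : ℂ) • φ - besselS μ φ) x * (gam μ σ x : ℂ) ∂vol n
      = ∫ x, φ x * ((l * gam μ σ x - gamS μ σ x : ℝ) : ℂ) ∂vol n := by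
  have hg := inInter_gam hμ hσ
  have h1 := (hφ.inInter hμ).inSum.integrable_mul hg
  have h2 := (hφ.inInter_besselS hμ).inSum.integrable_mul hg
  have h3 := (hφ.inInter hμ).inSum.integrable_mul (inInter_gamS hμ hσ)
  have e1 : ∫ x, besselS μ φ x * (gam μ σ x : ℂ) ∂vol n
      = ∫ x, φ x * (gamS μ σ x : ℂ) ∂vol n := by
    rw [integral_besselS_mul hμ hφ (isZemanian_gam hσ)]
    refine integral_congr_ae ?_
    filter_upwards [besselS_gam_ae hσ] with x hx
    rw [hx]
  have e2 : ∀ x, ((l : ℂ) • φ - besselS μ φ) x * (gam μ σ x : ℂ)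
      = l * (φ x * (gam μ σ x : ℂ)) - besselS μ φ x * (gam μ σ x : ℂ) := fun x => by
    simp only [Pi.sub_apply, Pi.smul_apply, smul_eq_mul]
    ring
  have e3 : ∀ x, φ x * ((l * gam μ σ x - gamS μ σ x : ℝ) : ℂ)
      = l * (φ x * (gam μ σ x : ℂ)) - φ x * (gamS μ σ x : ℂ) := fun x => by
    push_cast
    ring
  simp_rw [e2, e3]
  rw [integral_sub (h1.const_mul _) h2, integral_sub (h1.const_mul _) h3, e1]

/-- Convolution with the resolvent kernel inverts `λ - S` on the Zemanian space. -/
lemma IsZemanian.hankelConv_resolvent (hμ : ∀ i, -(1 / 2) < μ i) (hl : 0 < l)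
    (hφ : IsZemanian μ φ) :
    hankelConv μ (fun y => (kernelN μ l y : ℂ)) ((l : ℂ) • φ - besselS μ φ) =ᵐ[vol n] φ := by
  have hκ := hφ.inInter_resolvent hμ l
  have hN := InInter.hankelConv hμ hl hκ
  have hz : hankelConv μ (fun y => (kernelN μ l y : ℂ)) ((l : ℂ) • φ - besselS μ φ) - φ
      =ᵐ[vol n] 0 := by
    -- Against G_σ, symmetry moves N_λ ♯ onto the Gaussian, where it becomes ∫ e^{-λτ} G_{σ+τ} dτ;
    -- symmetry of S moves λ - S there too, and the Laplace formula returns the pairing of φ with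
    -- G_σ.
    refine (hN.sub (hφ.inInter hμ)).inSum.ae_eq_zero hμ fun σ hσ => ?_
    have hg := inInter_gam hμ hσ
    simp only [Pi.sub_apply, sub_mul]
    rw [integral_sub (hN.inSum.integrable_mul hg) ((hφ.inInter hμ).inSum.integrable_mul hg),
      sub_eq_zero, integral_hankelConv_mul hμ hl hκ.inSum hg,
      integral_mul_gam_eq_laplace hμ hσ hl (hφ.inInter hμ).inSum]
    have e1 : ∫ x, ((l : ℂ) • φ - besselS μ φ) x *
          hankelConv μ (fun y => (kernelN μ l y : ℂ)) (fun z => (gam μ σ z : ℂ)) x ∂vol n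
        = ∫ x, ((l : ℂ) • φ - besselS μ φ) x *
          ((∫ τ in Ioi (0 : ℝ), Real.exp (-(l * τ)) * gam μ (fun i => σ i + τ) x : ℝ) : ℂ)
          ∂vol n := by
      refine integral_congr_ae ?_
      filter_upwards [ae_mem_orthant n] with x hx
      rw [hankelConv_gam hμ hσ hl hx]
    rw [e1, integral_mul_laplace hμ hσ hl hκ.inSum (G := fun τ x => gam μ (fun i => σ i + τ) x)
      (measurable_gam_add μ σ)]
    · refine setIntegral_congr_fun measurableSet_Ioi fun τ hτ => ?_
      have hτ' : 0 < τ := hτ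
      rw [integral_resolvent_mul_gam hμ hφ fun i => by linarith [hσ i]]
    · refine ⟨∏ i, 2 ^ (μ i + 1), Finset.prod_nonneg fun i _ => by positivity,
        fun τ hτ x hx => ?_⟩
      have hρ : ∀ i, 0 < σ i + τ := fun i => by linarith [hσ i]
      rw [abs_of_pos (gam_pos μ hρ hx)]
      exact gam_le_gam_two_mul hρ hx
  filter_upwards [hz] with x hx
  exact sub_eq_zero.1 hx

/-- `λ - S` is injective. -/
lemma InSum.eq_zero_of_isBesselImage (hμ : ∀ i, -(1 / 2) < μ i) (hl : 0 < l) (hf : InSum μ f)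
    (h : IsBesselImage μ f ((l : ℂ) • f)) : f =ᵐ[vol n] 0 := by
  refine hf.ae_eq_zero hμ fun σ hσ => ?_
  rw [integral_mul_gam_eq_laplace hμ hσ hl hf]
  refine (setIntegral_congr_fun measurableSet_Ioi fun τ hτ => ?_).trans (integral_zero _ _)
  have hτ' : 0 < τ := hτ
  have hρ : ∀ i, 0 < σ i + τ := fun i => by linarith [hσ i]
  refine mul_eq_zero_of_right _ ?_
  -- With G_{σ+τ} as test function, S f = λ f says that f is orthogonal to (λ - S) G_{σ+τ}.
  obtain ⟨h1, h2, h3⟩ := h _ (isZemanian_gam hρ)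
  rw [← sub_eq_zero, ← integral_sub h1 h2] at h3
  rw [← neg_eq_zero, ← h3, ← integral_neg]
  refine integral_congr_ae ?_
  filter_upwards [besselS_gam_ae (μ := μ) hρ] with x hx
  simp only [hx, Pi.smul_apply, smul_eq_mul]
  push_cast
  ring

/-- `S (N_λ ♯ f) = λ (N_λ ♯ f) - f`. -/
lemma InSum.isBesselImage_hankelConv (hμ : ∀ i, -(1 / 2) < μ i) (hl : 0 < l) (hf : InSum μ f)
    (hR : InSum μ (hankelConv μ (fun y => (kernelN μ l y : ℂ)) f)) :
    IsBesselImage μ (hankelConv μ (fun y => (kernelN μ l y : ℂ)) f)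
      ((l : ℂ) • hankelConv μ (fun y => (kernelN μ l y : ℂ)) f - f) := by
  intro φ hφ
  have i1 := hR.integrable_mul (hφ.inInter_besselS hμ)
  have i2 := hR.integrable_mul (hφ.inInter hμ)
  have i3 := hf.integrable_mul (hφ.inInter hμ)
  -- Transposition: N_λ ♯ f paired with (λ - S)φ equals f paired with N_λ ♯ (λ - S)φ, which is φ
  -- almost everywhere.
  have hsymm := integral_hankelConv_mul hμ hl hf (hφ.inInter_resolvent hμ l)
  have e1 : ∫ x, f x * hankelConv μ (fun y => (kernelN μ l y : ℂ)) ((l : ℂ) • φ - besselS μ φ) x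
      ∂vol n = ∫ x, f x * φ x ∂vol n := by
    refine integral_congr_ae ?_
    filter_upwards [hφ.hankelConv_resolvent hμ hl] with x hx
    rw [hx]
  have e2 : ∀ x, hankelConv μ (fun y => (kernelN μ l y : ℂ)) f x
        * ((l : ℂ) • φ - besselS μ φ) x
      = l * (hankelConv μ (fun y => (kernelN μ l y : ℂ)) f x * φ x)
        - hankelConv μ (fun y => (kernelN μ l y : ℂ)) f x * besselS μ φ x := fun x => by
    simp only [Pi.sub_apply, Pi.smul_apply, smul_eq_mul]
    ring
  simp_rw [e2] at hsymm
  rw [e1, integral_sub (i2.const_mul _) i1] at hsymm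
  have e3 : ∀ x, ((l : ℂ) • hankelConv μ (fun y => (kernelN μ l y : ℂ)) f - f) x * φ x
      = l * (hankelConv μ (fun y => (kernelN μ l y : ℂ)) f x * φ x) - f x * φ x := fun x => by
    simp only [Pi.sub_apply, Pi.smul_apply, smul_eq_mul]
    ring
  simp_rw [e3]
  refine ⟨i1, (i2.const_mul _).sub i3, ?_⟩
  rw [integral_sub (i2.const_mul _) i3, ← hsymm]
  ring

end Resolvent

/-! ### Unbounded operators with a bounded inverse -/

section Operators

variable {X : Type*} [NormedAddCommGroup X] [NormedSpace ℂ X]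

lemma isBoundedInverse_shift_iff {A : X →ₗ.[ℂ] X} {z : ℂ} {R : X →L[ℂ] X} :
    IsBoundedInverse (shift z A) R ↔
      (∀ x, ∃ h : R x ∈ A.domain, z • R x + A ⟨R x, h⟩ = x) ∧
        ∀ x : A.domain, R (z • (x : X) + A x) = x := Iff.rfl

lemma isBoundedInverse_shift_neg_iff {A : X →ₗ.[ℂ] X} {z : ℂ} {R : X →L[ℂ] X} :
    IsBoundedInverse (shift z (-A)) R ↔
      (∀ x, ∃ h : R x ∈ A.domain, z • R x - A ⟨R x, h⟩ = x) ∧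
        ∀ x : A.domain, R (z • (x : X) - A x) = x := by
  simp only [sub_eq_add_neg]
  exact Iff.rfl

lemma IsBoundedInverse.unique {B : X →ₗ.[ℂ] X} {R R' : X →L[ℂ] X} (h : IsBoundedInverse B R)
    (h' : IsBoundedInverse B R') : R = R' := by
  ext x
  obtain ⟨hx, hB⟩ := h'.1 x
  have := h.2 ⟨R' x, hx⟩
  rwa [hB] at this

/-- An operator with a bounded inverse after a shift is closed. -/
lemma IsBoundedInverse.isClosed {A : X →ₗ.[ℂ] X} {z : ℂ} {R : X →L[ℂ] X}
    (h : IsBoundedInverse (shift z A) R) : A.IsClosed := by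
  -- The graph is the set where two continuous maps agree.
  have hset : (A.graph : Set (X × X)) = {q | R (z • q.1 + q.2) = q.1} := by
    ext ⟨x, y⟩
    simp only [SetLike.mem_coe, LinearPMap.mem_graph_iff, mem_ofPred_eq]
    constructor
    · rintro ⟨a, rfl, rfl⟩
      exact h.2 a
    · intro hxy
      obtain ⟨hx, hB⟩ := (isBoundedInverse_shift_iff.1 h).1 (z • x + y)
      refine ⟨⟨R (z • x + y), hx⟩, hxy, ?_⟩
      have h1 : z • R (z • x + y) = z • x := by rw [hxy]
      rw [h1] at hB
      exact add_left_cancel hB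
  rw [LinearPMap.IsClosed, hset]
  exact isClosed_eq (by fun_prop) continuous_fst

lemma IsBoundedInverse.neg {A : X →ₗ.[ℂ] X} {z : ℂ} {R : X →L[ℂ] X}
    (h : IsBoundedInverse (shift z (-A)) R) : IsBoundedInverse (shift (-z) A) (-R) := by
  obtain ⟨h1, h2⟩ := isBoundedInverse_shift_neg_iff.1 h
  refine isBoundedInverse_shift_iff.2 ⟨fun x => ?_, fun x => ?_⟩
  · obtain ⟨hx, hB⟩ := h1 (-x)
    have hR : (-R) x = R (-x) := (map_neg R x).symm
    rw [hR]
    refine ⟨hx, ?_⟩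
    rw [neg_smul, neg_add_eq_sub, ← neg_sub, hB, neg_neg]
  · have e : -z • (x : X) + A x = -(z • (x : X) - A x) := by
      rw [neg_smul, neg_sub, neg_add_eq_sub]
    have hR : (-R) (-z • (x : X) + A x) = R (z • (x : X) - A x) := by
      rw [e, map_neg]
      exact neg_neg _
    rw [hR, h2]

/-- A resolvent estimate on the positive half-line makes an operator non-negative. -/
lemma isNonnegative_of_resolvent {A : X →ₗ.[ℂ] X} {M : ℝ}
    (h : ∀ t : ℝ, 0 < t → ∃ R : X →L[ℂ] X,
      IsBoundedInverse (shift (t : ℂ) A) R ∧ ‖(t : ℂ) • R‖ ≤ M) : IsNonnegative A := by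
  refine ⟨?_, fun t ht => ?_, M, fun t ht R hR => ?_⟩
  · obtain ⟨R, hR, -⟩ := h 1 one_pos
    exact hR.isClosed
  · obtain ⟨R, hR, -⟩ := h (-t) (neg_pos.2 ht)
    rw [← neg_neg A] at hR
    have := hR.neg
    rw [Complex.ofReal_neg, neg_neg] at this
    exact ⟨-R, this⟩
  · obtain ⟨R', hR', hM⟩ := h t ht
    rwa [hR.unique hR']

end Operators

/-! ### Convolution as a bounded operator on the weighted spaces -/

section Packaging

variable {n : ℕ} {μ : Fin n → ℝ} {hμ : ∀ i, -(1 / 2) < μ i} {p : ℝ≥0∞} [hp : Fact (1 ≤ p)]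
  {l : ℝ}

lemma WeightedLp.inSum (f : WeightedLp hμ p) : InSum μ f :=
  inSum_of_wnorm_lt_top hμ hp.out f.toAEEqFun.aestronglyMeasurable f.wnorm_lt_top

lemma WeightedLp.ae_integrable_convIntegrand (hl : 0 < l) (f : WeightedLp hμ p) :
    ∀ᵐ x ∂vol n, Integrable (convIntegrand μ (fun y => (kernelN μ l y : ℂ)) f x)
      ((vol n).prod (vol n)) := by
  filter_upwards [f.inSum.ae_lintegral_kerE_lt_top hμ hl, ae_mem_orthant n] with x h hx
  exact integrable_convIntegrand hμ hl f.toAEEqFun.aestronglyMeasurable hx h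

lemma WeightedLp.wnorm_conv_le (hl : 0 < l) (f : WeightedLp hμ p) :
    wnorm μ p (hankelConv μ (fun y => (kernelN μ l y : ℂ)) f)
      ≤ ENNReal.ofReal l⁻¹ * wnorm μ p f :=
  wnorm_hankelConv_le hμ hl hp.out f.toAEEqFun.aestronglyMeasurable

/-- The element `N_λ ♯ f` of the weighted space. -/
noncomputable def WeightedLp.conv (hl : 0 < l) (f : WeightedLp hμ p) : WeightedLp hμ p :=
  (⟨AEEqFun.mk (hankelConv μ (fun y => (kernelN μ l y : ℂ)) f)
    (aestronglyMeasurable_hankelConv f.toAEEqFun.aestronglyMeasurable), by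
      change wnorm μ p _ < ⊤
      rw [wnorm_congr μ p (AEEqFun.coeFn_mk _ _)]
      exact (f.wnorm_conv_le hl).trans_lt
        (ENNReal.mul_lt_top ENNReal.ofReal_lt_top f.wnorm_lt_top)⟩ :
    weightedLpSubmodule hμ p hp.out)

lemma WeightedLp.coeFn_conv (hl : 0 < l) (f : WeightedLp hμ p) :
    f.conv hl =ᵐ[vol n] hankelConv μ (fun y => (kernelN μ l y : ℂ)) f :=
  AEEqFun.coeFn_mk _ _

lemma hankelConv_congr {f g h : (Fin n → ℝ) → ℂ} (hfg : f =ᵐ[vol n] g) (x : Fin n → ℝ) :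
    hankelConv μ h f x = hankelConv μ h g x := by
  refine integral_congr_ae ?_
  filter_upwards [(Measure.quasiMeasurePreserving_snd (μ := vol n) (ν := vol n)).ae hfg] with w hw
  rw [convIntegrand, convIntegrand, hw]

lemma WeightedLp.conv_add (hl : 0 < l) (f g : WeightedLp hμ p) :
    (f + g).conv hl = f.conv hl + g.conv hl := by
  refine toAEEqFun_injective (AEEqFun.ext ?_)
  filter_upwards [(f + g).coeFn_conv hl, f.coeFn_conv hl, g.coeFn_conv hl,
    AEEqFun.coeFn_add (f.conv hl).toAEEqFun (g.conv hl).toAEEqFun,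
    f.ae_integrable_convIntegrand hl, g.ae_integrable_convIntegrand hl] with x h1 h2 h3 h4 h5 h6
  rw [h1, toAEEqFun_add (f.conv hl), h4, Pi.add_apply, h2, h3, toAEEqFun_add,
    hankelConv_congr (AEEqFun.coeFn_add f.toAEEqFun g.toAEEqFun), hankelConv, hankelConv,
    hankelConv, ← integral_add h5 h6]
  refine integral_congr_ae (Filter.Eventually.of_forall fun w => ?_)
  simp only [convIntegrand, Pi.add_apply]
  ring

lemma WeightedLp.conv_smul (hl : 0 < l) (c : ℂ) (f : WeightedLp hμ p) :
    (c • f).conv hl = c • f.conv hl := by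
  refine toAEEqFun_injective (AEEqFun.ext ?_)
  filter_upwards [(c • f).coeFn_conv hl, f.coeFn_conv hl,
    AEEqFun.coeFn_smul c (f.conv hl).toAEEqFun] with x h1 h2 h3
  rw [h1, toAEEqFun_smul c (f.conv hl), h3, Pi.smul_apply, h2, toAEEqFun_smul,
    hankelConv_congr (AEEqFun.coeFn_smul c f.toAEEqFun), hankelConv, hankelConv, smul_eq_mul,
    ← integral_const_mul]
  refine integral_congr_ae (Filter.Eventually.of_forall fun w => ?_)
  simp only [convIntegrand, Pi.smul_apply, smul_eq_mul]
  ring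

lemma WeightedLp.norm_conv_le (hl : 0 < l) (f : WeightedLp hμ p) :
    ‖f.conv hl‖ ≤ l⁻¹ * ‖f‖ := by
  rw [norm_def, norm_def, wnorm_congr μ p (f.coeFn_conv hl)]
  refine (ENNReal.toReal_mono (ENNReal.mul_lt_top ENNReal.ofReal_lt_top f.wnorm_lt_top).ne
    (f.wnorm_conv_le hl)).trans_eq ?_
  rw [ENNReal.toReal_mul, ENNReal.toReal_ofReal (inv_nonneg.2 hl.le)]

/-- Hankel convolution with the resolvent kernel as a bounded operator. -/
noncomputable def convCLM (hμ : ∀ i, -(1 / 2) < μ i) (p : ℝ≥0∞) [Fact (1 ≤ p)] (hl : 0 < l) :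
    WeightedLp hμ p →L[ℂ] WeightedLp hμ p :=
  LinearMap.mkContinuous
    { toFun := fun f => f.conv hl
      map_add' := WeightedLp.conv_add hl
      map_smul' := WeightedLp.conv_smul hl } l⁻¹ (WeightedLp.norm_conv_le hl)

lemma norm_smul_convCLM_le (hl : 0 < l) : ‖(l : ℂ) • convCLM hμ p hl‖ ≤ 1 := by
  rw [norm_smul, Complex.norm_real, Real.norm_of_nonneg hl.le]
  calc l * ‖convCLM hμ p hl‖ ≤ l * l⁻¹ :=
        mul_le_mul_of_nonneg_left (LinearMap.mkContinuous_norm_le _ (inv_nonneg.2 hl.le) _) hl.le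
    _ = 1 := mul_inv_cancel₀ hl.ne'

lemma WeightedLp.coeFn_smul_sub (c : ℂ) (f g : WeightedLp hμ p) :
    (c • (f : (Fin n → ℝ) → ℂ) - g : (Fin n → ℝ) → ℂ) =ᵐ[vol n] (c • f - g : WeightedLp hμ p) := by
  have h1 : (c • f - g : WeightedLp hμ p).toAEEqFun = c • f.toAEEqFun - g.toAEEqFun := rfl
  rw [h1]
  filter_upwards [AEEqFun.coeFn_sub (c • f.toAEEqFun) g.toAEEqFun,
    AEEqFun.coeFn_smul c f.toAEEqFun] with x hx hy
  rw [hx, Pi.sub_apply, Pi.sub_apply, hy]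

lemma WeightedLp.isBesselImage_conv (hl : 0 < l) (f : WeightedLp hμ p) :
    IsBesselImage μ (f.conv hl) ((l : ℂ) • f.conv hl - f : WeightedLp hμ p) := by
  have hc := f.coeFn_conv hl
  refine (f.inSum.isBesselImage_hankelConv hμ hl ?_).congr hc.symm ?_
  · exact inSum_of_wnorm_lt_top hμ hp.out
      (aestronglyMeasurable_hankelConv f.toAEEqFun.aestronglyMeasurable)
      ((f.wnorm_conv_le hl).trans_lt (ENNReal.mul_lt_top ENNReal.ofReal_lt_top f.wnorm_lt_top))
  · filter_upwards [hc, WeightedLp.coeFn_smul_sub (l : ℂ) (f.conv hl) f] with x h1 h2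
    rw [← h2, Pi.sub_apply, Pi.sub_apply, Pi.smul_apply, Pi.smul_apply, h1]

/-- Convolution is a right inverse by the resolvent equation. It is also a left inverse because λ -
S is injective: the difference u of R(λ - S)f and f satisfies S u = λ u. -/
lemma isBoundedInverse_convCLM (hl : 0 < l) :
    IsBoundedInverse (shift (l : ℂ) (-besselPart hμ p)) (convCLM hμ p hl) := by
  have hright : ∀ f : WeightedLp hμ p, ∃ h : f.conv hl ∈ (besselPart hμ p).domain,
      (l : ℂ) • f.conv hl - besselPart hμ p ⟨f.conv hl, h⟩ = f := fun f => by
    have himg := f.isBesselImage_conv hl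
    refine ⟨⟨_, himg⟩, ?_⟩
    have : besselPart hμ p ⟨f.conv hl, ⟨_, himg⟩⟩ = (l : ℂ) • f.conv hl - f :=
      partFun_eq hμ p himg
    rw [this, sub_sub_cancel]
  refine isBoundedInverse_shift_neg_iff.2 ⟨hright, fun f => ?_⟩
  obtain ⟨h, hB⟩ := hright ((l : ℂ) • (f : WeightedLp hμ p) - besselPart hμ p f)
  set u : (besselPart hμ p).domain := ⟨_, h⟩ - f with hu
  have hzero : (l : ℂ) • (u : WeightedLp hμ p) = besselPart hμ p u := by
    rw [hu, LinearPMap.map_sub, Submodule.coe_sub, smul_sub, sub_eq_sub_iff_sub_eq_sub, hB]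
  have himg : IsBesselImage μ (u : WeightedLp hμ p)
      ((l : ℂ) • ((u : WeightedLp hμ p) : (Fin n → ℝ) → ℂ)) := by
    refine (partFun_spec hμ p u).congr Filter.EventuallyEq.rfl ?_
    have h1 : partFun hμ p u = (l : ℂ) • (u : WeightedLp hμ p) := hzero.symm
    rw [h1]
    exact AEEqFun.coeFn_smul _ _
  have hu0 : (u : WeightedLp hμ p) = 0 := by
    refine WeightedLp.toAEEqFun_injective (AEEqFun.ext ?_)
    exact ((WeightedLp.inSum _).eq_zero_of_isBesselImage hμ hl himg).trans
      AEEqFun.coeFn_zero.symm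
  exact sub_eq_zero.1 hu0

end Packaging

end BesselOp

theorem theorem4p7 {n : ℕ} {μ : Fin n → ℝ} (hμ : ∀ i, -(1 / 2) < μ i)
    (p : ℝ≥0∞) [Fact (1 ≤ p)] :
    (besselPart hμ p).IsClosed ∧
    IsNonnegative (-besselPart hμ p) ∧
    ∀ l : ℝ, 0 < l → ∃ R : WeightedLp hμ p →L[ℂ] WeightedLp hμ p,
      IsBoundedInverse (shift (l : ℂ) (-besselPart hμ p)) R ∧
      ‖(l : ℂ) • R‖ ≤ 1 ∧
      ∀ f : WeightedLp hμ p,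
        (∀ᵐ x ∂vol n, Integrable (convIntegrand μ (fun y => (kernelN μ l y : ℂ)) f x)
          ((vol n).prod (vol n))) ∧
        R f =ᵐ[vol n] hankelConv μ (fun y => (kernelN μ l y : ℂ)) f :=
  -- Closedness is read off at λ = 1, after changing the sign of 1 - S to obtain a shift of S
  -- itself.
  ⟨(isBoundedInverse_convCLM one_pos).neg.isClosed,
    isNonnegative_of_resolvent fun _ ht =>
      ⟨_, isBoundedInverse_convCLM ht, norm_smul_convCLM_le ht⟩,
    fun _ hl => ⟨convCLM hμ p hl, isBoundedInverse_convCLM hl, norm_smul_convCLM_le hl,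
      fun f => ⟨f.ae_integrable_convIntegrand hl, f.coeFn_conv hl⟩⟩⟩
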